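/- **Setting.** For $\ell\ge 0$ let $Y^\ell=(Y^\ell_m)_{|m|\le \ell}$ be the real spherical harmonics, extended from the unit sphere to $\mathbb R^3$ as homogeneous harmonic polynomials of degree $\ell$ (so $Y^\ell(0)=0$ for $\ell\ge1$ and $Y^0$ is constant). Let $W_\ell=\mathbb R^{2\ell+1}$, on which $R\in \mathrm{SO}(3)$ acts by the real Wigner matrix $D^{(\ell)}(R)$, i.e. the matrix with $Y^\ell(Rx)=D^{(\ell)}(R)Y^\ell(x)$ for all $x$. For a finite family $\mathbf l=(\ell_1,\dots,\ell_K)$ put $W_{\mathbf l}=\bigoplus_k W_{\ell_k}$. For all $\ell_1,\ell_2$ choose a Clebsch–Gordan decomposition, that is, a linear $\mathrm{SO}(3)$-equivariant isomorphism $W_{\ell_1}\otimes W_{\ell_2}\to\bigoplus_{\ell=|\ell_1-\ell_2|}^{\ell_1+\ell_2}W_\ell$ (for instance the usual unitary one). Taken together on all summands, these give isomorphisms $U(\mathbf l_1,\mathbf l_2):W_{\mathbf l_1}\otimes W_{\mathbf l_2}\to W_{\mathbf l(\mathbf l_1,\mathbf l_2)}$, where $\mathbf l(\mathbf l_1,\mathbf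 l_2)$ lists the degrees that occur. The group $G=(\mathbb R^3\rtimes \mathrm{SO}(3))\times S_n$ acts on point clouds $X=(x_1,\dots,x_n)\in\mathbb R^{3\times n}$ by $(t,R,P)X=R(X-t1_n^T)P^T$ and on $W_{\mathbf l_T}^n$ by $(t,R,P)Y=\rho(R)YP^T$, where $\rho$ is the action of $\mathrm{SO}(3)$ on $W_{\mathbf l_T}$. **Architecture.** Fix $D\ge0$ and $\mathbf l_f=(0,1,\dots,D)$. A convolution layer is given by $\theta_0\in\mathbb R$ and real polynomials $R^{(0)},\dots,R^{(D)}$ of degree at most $D$. It maps $(X,V)$, with $V\in W_{\mathbf l}^n$, to $(X,\tilde V)$, where $$\tilde V_a=U(\mathbf l_f,\mathbf l)\Big(\theta_0V_a+\sum_{b=1}^nF(x_a-x_b)\otimes V_b\Big),\qquad F^{(\ell)}_m(x)=R^{(\ell)}(\|x\|)\,Y^\ell_m(\hat x),\quad 0\le\ell\le D,$$ with $\hat x=x/\|x\|$ for $x\ne0$ and $\hat x=0$ for $x=0$; here $V_a\in W_{\mathbf l}$ is identified with $(1,0,\dots,0)\otimes V_a\in W_{\mathbf l_f}\otimes W_{\mathbf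 l}$, where $(1,0,\dots,0)\in W_0\oplus\dots\oplus W_D$. Let $\mathcal F_{\mathrm{feat}}(D)$ be the set of maps $\mathbb R^{3\times n}\to W_{\mathbf l(D)}^n$ obtained by applying $2D$ consecutive convolution layers to $(X,1_n)$, $1_n\in W_0^n$, and keeping the $V$-component. Let $\mathcal F_{\mathrm{pool}}(D)$ be the set of all linear $\mathrm{SO}(3)$-equivariant maps $\Lambda:W_{\mathbf l(D)}\to W_{\mathbf l_T}$; write $\hat\Lambda$ for the application of $\Lambda$ to each of the $n$ points (a self-interaction layer). Let $\mathcal F^{\mathrm{TFN}}_{C,D}$ be the set of functions $X\mapsto\sum_{c=1}^C\hat\Lambda_c(g_c(X))$ with $\Lambda_c\in\mathcal F_{\mathrm{pool}}(D)$ and $g_c\in\mathcal F_{\mathrm{feat}}(D)$. **Theorem.** Clebsch–Gordan decompositions as above exist, and there are numbers $C(D)\in\mathbb N$, $D\ge 0$, such that for every choice of Clebsch–Gordan decompositions, every $n\in\mathbb N$ and every finite family $\mathbf l_T$ of degrees: 1. For every $D\ge0$ and every $C\ge C(D)$, every $G$-equivariant polynomial map $p:\mathbb R^{3\times n}\to W_{\mathbf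 l_T}^n$ of degree at most $D$ belongs to $\mathcal F^{\mathrm{TFN}}_{C,D}$. In particular it belongs to $\mathcal F^{\mathrm{TFN}}_{C(D),D}$. 2. Every continuous $G$-equivariant function $f:\mathbb R^{3\times n}\to W_{\mathbf l_T}^n$ can be approximated, uniformly on every compact set and to any accuracy $\varepsilon>0$, by functions in $\bigcup_{D\ge0}\mathcal F^{\mathrm{TFN}}_{C(D),D}$. -/

import Mathlib

open scoped TensorProduct

noncomputable section

namespace TFN

/-! ### Point clouds, rotations and real spherical harmonics -/

/-- Point clouds `X = (x_1, …, x_n) ∈ ℝ^{3 × n}`; `X a` is the column `x_a`. -/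
abbrev PointCloud (n : ℕ) : Type := Fin n → Fin 3 → ℝ

/-- The rotation group `SO(3)`. -/
abbrev SO3 : Type := Matrix.specialOrthogonalGroup (Fin 3) ℝ

/-- The Euclidean norm on `ℝ³` (plain functions carry the sup norm). -/
def euclNorm (x : Fin 3 → ℝ) : ℝ := ‖WithLp.toLp 2 x‖

/-- `x̂ = x / ‖x‖` for `x ≠ 0`, and `x̂ = 0` for `x = 0`. -/
def unitVec (x : Fin 3 → ℝ) : Fin 3 → ℝ := (euclNorm x)⁻¹ • x

/-- The `μ`-th derivative of the Legendre polynomial of degree `ℓ`, at `z`, made homogeneous of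
degree `ℓ - μ` by means of `s = ‖x‖²`.  At `s = 1` it is `(d/dz)^μ P_ℓ (z)`. -/
def legendreDeriv (ℓ μ : ℕ) (z s : ℝ) : ℝ :=
  (1 / 2 ^ ℓ) * ∑ k ∈ Finset.range (ℓ / 2 + 1),
    (-1) ^ k * (ℓ.choose k : ℝ) * ((2 * ℓ - 2 * k).choose ℓ : ℝ) *
      ((ℓ - 2 * k).descFactorial μ : ℝ) * s ^ k * z ^ (ℓ - 2 * k - μ)

/-- The factor which makes the real spherical harmonics of order `±μ` orthonormal in `L²(S²)`. -/
def harmonicNormalization (ℓ μ : ℕ) : ℝ :=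
  (if μ = 0 then 1 else √2) *
    √((2 * ℓ + 1) / (4 * Real.pi) * ((ℓ - μ).factorial / (ℓ + μ).factorial))

/-- The real spherical harmonics `Y^ℓ = (Y^ℓ_m)_{m = -ℓ, …, ℓ}`, with `m = j - ℓ` for
`j = 0, …, 2ℓ`, extended from the unit sphere to `ℝ³` as homogeneous harmonic polynomials of
degree `ℓ`.  In particular `Y^ℓ(0) = 0` for `ℓ ≥ 1`, and `Y^0` is constant. On the unit sphere,
`Re (x + iy)^μ = (sin θ)^μ cos (μφ)` and `Im (x + iy)^μ = (sin θ)^μ sin (μφ)`. -/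
def sphericalHarmonic (ℓ : ℕ) (x : Fin 3 → ℝ) : Fin (2 * ℓ + 1) → ℝ := fun j =>
  let m : ℤ := (j : ℤ) - ℓ
  let μ : ℕ := m.natAbs
  harmonicNormalization ℓ μ *
    legendreDeriv ℓ μ (x 2) (x 0 ^ 2 + x 1 ^ 2 + x 2 ^ 2) *
    (if 0 ≤ m then (((x 0 : ℂ) + (x 1 : ℂ) * Complex.I) ^ μ).re
      else (((x 0 : ℂ) + (x 1 : ℂ) * Complex.I) ^ μ).im)

/-! ### Irreducible representations of `SO(3)` and their direct sums -/

/-- The real Wigner `D`-matrix `D^{(ℓ)}(R)`: the unique matrix with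
`Y^ℓ(R x) = D^{(ℓ)}(R) Y^ℓ(x)` for all `x`. -/
def wignerD (ℓ : ℕ) (R : SO3) : Matrix (Fin (2 * ℓ + 1)) (Fin (2 * ℓ + 1)) ℝ :=
  Classical.epsilon fun M =>
    ∀ x : Fin 3 → ℝ, sphericalHarmonic ℓ (R.1.mulVec x) = M.mulVec (sphericalHarmonic ℓ x)

/-- The space `W_ℓ = ℝ^{2ℓ+1}`. -/
abbrev Irrep (ℓ : ℕ) : Type := Fin (2 * ℓ + 1) → ℝ

/-- The direct sum `W_l = ⊕_i W_{l_i}`, for a finite family `l = (l_i)_i`. -/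
abbrev W {ι : Type} (l : ι → ℕ) : Type := (i : ι) → Irrep (l i)

/-- The action of `SO(3)` on `W_l`. -/
def rotate {ι : Type} (l : ι → ℕ) (R : SO3) (w : W l) : W l :=
  fun i => (wignerD (l i) R).mulVec (w i)

/-- A family `l = (l_i)_{i ∈ ι}` of degrees together with its index set. -/
structure Degrees where
  ι : Type
  deg : ι → ℕ

/-! ### Clebsch-Gordan decompositions -/

/-- A choice, for all `ℓ₁, ℓ₂`, of a Clebsch-Gordan decomposition: a linear `SO(3)`-equivariant
isomorphism of `W_{ℓ₁} ⊗ W_{ℓ₂}` onto `⊕ W_ℓ`, `|ℓ₁ - ℓ₂| ≤ ℓ ≤ ℓ₁ + ℓ₂`.  The unitary ones are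
among these. -/
structure ClebschGordan where
  U : (ℓ₁ ℓ₂ : ℕ) → (Irrep ℓ₁ ⊗[ℝ] Irrep ℓ₂) ≃ₗ[ℝ]
    ((ℓ : Finset.Icc (max ℓ₁ ℓ₂ - min ℓ₁ ℓ₂) (ℓ₁ + ℓ₂)) → Irrep ℓ)
  equivariant : ∀ (ℓ₁ ℓ₂ : ℕ) (R : SO3) (v : Irrep ℓ₁) (w : Irrep ℓ₂)
    (ℓ : Finset.Icc (max ℓ₁ ℓ₂ - min ℓ₁ ℓ₂) (ℓ₁ + ℓ₂)),
    U ℓ₁ ℓ₂ ((wignerD ℓ₁ R).mulVec v ⊗ₜ[ℝ] (wignerD ℓ₂ R).mulVec w) ℓ =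
      (wignerD ℓ R).mulVec (U ℓ₁ ℓ₂ (v ⊗ₜ[ℝ] w) ℓ)

/-- The degrees `l(l₁, l₂)` that occur in `W_{l₁} ⊗ W_{l₂}`, with multiplicity. -/
def tensorDegrees (l₁ l₂ : Degrees) : Degrees where
  ι := Σ p : l₁.ι × l₂.ι,
    Finset.Icc (max (l₁.deg p.1) (l₂.deg p.2) - min (l₁.deg p.1) (l₂.deg p.2))
      (l₁.deg p.1 + l₂.deg p.2)
  deg q := q.2.1

/-- The map `U(l₁, l₂) : W_{l₁} ⊗ W_{l₂} → W_{l(l₁, l₂)}`, assembled from the `U(ℓ₁, ℓ₂)`. -/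
def ClebschGordan.map (U : ClebschGordan) (l₁ l₂ : Degrees) :
    (W l₁.deg ⊗[ℝ] W l₂.deg) →ₗ[ℝ] W (tensorDegrees l₁ l₂).deg :=
  LinearMap.pi fun q =>
    (LinearMap.proj q.2).comp
      ((U.U (l₁.deg q.1.1) (l₂.deg q.1.2)).toLinearMap.comp
        (TensorProduct.map (LinearMap.proj q.1.1) (LinearMap.proj q.1.2)))

/-! ### Convolution layers -/

/-- The degrees `l_f = (0, 1, …, D)` of a filter. -/
def filterDegrees (D : ℕ) : Degrees := ⟨Fin (D + 1), fun ℓ => ℓ⟩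

/-- The parameters of a convolution layer: `θ₀ ∈ ℝ`, and real polynomials `R^{(0)}, …, R^{(D)}` of
degree at most `D`. -/
structure ConvParams (D : ℕ) where
  θ₀ : ℝ
  radial : Fin (D + 1) → Polynomial ℝ
  radial_degree : ∀ ℓ, (radial ℓ).natDegree ≤ D

/-- The filter `F^{(ℓ)}_m(x) = R^{(ℓ)}(‖x‖) Y^ℓ_m(x̂)`. -/
def convFilter {D : ℕ} (P : ConvParams D) (x : Fin 3 → ℝ) : W (filterDegrees D).deg :=
  fun (ℓ : Fin (D + 1)) => (P.radial ℓ).eval (euclNorm x) • sphericalHarmonic ℓ (unitVec x)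

/-- The vector `(1, 0, …, 0) ∈ W_0 ⊕ W_1 ⊕ … ⊕ W_D`; tensoring with it is the embedding
`W_l = W_0 ⊗ W_l ⊆ W_{l_f} ⊗ W_l`. -/
def unitFilter (D : ℕ) : W (filterDegrees D).deg :=
  fun (ℓ : Fin (D + 1)) _ => if ℓ = 0 then 1 else 0

/-- The convolution layer `(X, V) ↦ (X, Ṽ)`,
`Ṽ_a = U(l_f, l) (θ₀ V_a + ∑_b F(x_a - x_b) ⊗ V_b)`, where `V_a ∈ W_l` is viewed in
`W_{l_f} ⊗ W_l` as `(1, 0, …, 0) ⊗ V_a`. -/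
def convLayer (U : ClebschGordan) {D n : ℕ} (P : ConvParams D) (l : Degrees)
    (XV : PointCloud n × (Fin n → W l.deg)) :
    PointCloud n × (Fin n → W (tensorDegrees (filterDegrees D) l).deg) :=
  (XV.1, fun a => U.map (filterDegrees D) l
    (P.θ₀ • (unitFilter D ⊗ₜ[ℝ] XV.2 a) +
      ∑ b, convFilter P (XV.1 a - XV.1 b) ⊗ₜ[ℝ] XV.2 b))

/-! ### The architecture -/

/-- The degrees of the features after `J` convolution layers; the input has one feature of
degree `0`. -/
def featDegrees (D : ℕ) : ℕ → Degrees
  | 0 => ⟨Unit, fun _ => 0⟩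
  | J + 1 => tensorDegrees (filterDegrees D) (featDegrees D J)

/-- `f^J ∘ … ∘ f^1 ∘ ext`, with `ext X = (X, 1_n)` and `f^j` the convolution layer with
parameters `P (j - 1)`. -/
def forward (U : ClebschGordan) {D n : ℕ} (P : ℕ → ConvParams D) :
    (J : ℕ) → PointCloud n → PointCloud n × (Fin n → W (featDegrees D J).deg)
  | 0, X => (X, fun _ _ _ => 1)
  | J + 1, X => convLayer U (P J) (featDegrees D J) (forward U P J X)

/-- `F_feat(D)`: the features computed by `2D` consecutive convolution layers. -/
def feat (U : ClebschGordan) (D n : ℕ) :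
    Set (PointCloud n → Fin n → W (featDegrees D (2 * D)).deg) :=
  {g | ∃ P : ℕ → ConvParams D, ∀ X, g X = (forward U P (2 * D) X).2}

/-- `F_pool(D)`: the linear `SO(3)`-equivariant maps `W_{l(D)} → W_{l_T}`, which are applied
pointwise as self-interaction layers. -/
def pool (D : ℕ) {K : ℕ} (lT : Fin K → ℕ) :
    Set (W (featDegrees D (2 * D)).deg →ₗ[ℝ] W lT) :=
  {Λ | ∀ (R : SO3) (w : W (featDegrees D (2 * D)).deg),
    Λ (rotate (featDegrees D (2 * D)).deg R w) = rotate lT R (Λ w)}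

/-- The networks `F^{TFN}_{C,D}`: the functions `X ↦ ∑_{c=1}^C Λ̂_c (g_c (X))`. -/
def network (U : ClebschGordan) (C D n : ℕ) {K : ℕ} (lT : Fin K → ℕ) :
    Set (PointCloud n → Fin n → W lT) :=
  {f | ∃ (Λ : Fin C → (W (featDegrees D (2 * D)).deg →ₗ[ℝ] W lT))
      (g : Fin C → PointCloud n → Fin n → W (featDegrees D (2 * D)).deg),
      (∀ c, Λ c ∈ pool D lT) ∧ (∀ c, g c ∈ feat U D n) ∧
      ∀ X a, f X a = ∑ c, Λ c (g c X a)}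

/-! ### Equivariant functions and polynomials -/

/-- The action `(t, R, P) X = R (X - t 1ᵀ) Pᵀ` on point clouds. -/
def actIn {n : ℕ} (t : Fin 3 → ℝ) (R : SO3) (σ : Equiv.Perm (Fin n)) (X : PointCloud n) :
    PointCloud n :=
  fun a => R.1.mulVec (X (σ⁻¹ a) - t)

/-- The action `(t, R, P) Y = ρ(R) Y Pᵀ` on `W_{l_T}^n`; translations act trivially. -/
def actOut {n K : ℕ} (lT : Fin K → ℕ) (R : SO3) (σ : Equiv.Perm (Fin n)) (Y : Fin n → W lT) :
    Fin n → W lT :=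
  fun a => rotate lT R (Y (σ⁻¹ a))

/-- `G`-equivariance, for `G = (ℝ³ ⋊ SO(3)) × S_n`. -/
def IsEquivariant {n K : ℕ} (lT : Fin K → ℕ) (f : PointCloud n → Fin n → W lT) : Prop :=
  ∀ (t : Fin 3 → ℝ) (R : SO3) (σ : Equiv.Perm (Fin n)) (X : PointCloud n),
    f (actIn t R σ X) = actOut lT R σ (f X)

/-- Every coordinate is a polynomial of degree at most `D` in the entries of `X`. -/
def IsPolynomialOfDegreeLE {n K : ℕ} (D : ℕ) (lT : Fin K → ℕ)
    (p : PointCloud n → Fin n → W lT) : Prop :=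
  ∀ (a : Fin n) (i : Fin K) (m : Fin (2 * lT i + 1)),
    ∃ q : MvPolynomial (Fin n × Fin 3) ℝ, q.totalDegree ≤ D ∧
      ∀ X, p X a i m = MvPolynomial.eval (fun s => X s.1 s.2) q

end TFN

end

/-! Existence of Clebsch–Gordan decompositions. The starting point is that the `2ℓ+1` spherical
harmonics of degree `ℓ` stay independent modulo the polynomials vanishing on the complex null cone
`x² + y² + z² = 0` (`eq_zero_of_sum_mem_nullIdeal`). A dimension count then splits every form of
degree `ℓ` into a combination of spherical harmonics plus `‖x‖²` times a form of degree `ℓ - 2`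
(`exists_harmonic_decomposition`), and the Wigner matrices exist. Averaging over rotations about the
third axis yields Schur's lemma over `ℝ`, and Haar averaging then yields irreducibility.
Transvectants of harmonic polynomials give a nonzero intertwiner `W_ℓ → W_p ⊗ W_q` for each
admissible `ℓ`; by Schur these are jointly injective, and the dimensions agree.

Polynomials. By translation and permutation equivariance, `p(X)_a` is a mean over permutations `σ`
of polynomials in the differences `x_{σ b} - x_a`. As with Newton's identities, such a
symmetrization is a combination of products of power sums `∑_c φ(x_a - x_c)`, with `φ` a product of
linear forms (`symmSum_mul_powerSum`). A product of `J` power sums is a sum over `J`-tuples of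
points; writing `x_a - x_{b_i} = (x_a - x_{b_0}) + (x_{b_0} - x_{b_i})` and expanding turns it into
nested convolutions, one layer per index (`sum_formProd_mem_chainSpan`). A single convolution can
multiply by any form of degree `r`, because the functions `‖x‖^(r-ℓ) Y^ℓ(x)`, `ℓ ≡ r` mod 2, span
these forms; nothing is lost in a layer, because the Clebsch–Gordan maps are injective. A branch
depends only on its sequence of `2D` filter degrees in `{0, …, D}`, so `C(D) = (D+1)^(2D)` branches
suffice for all `n` and all targets.

The linear readouts found in this way need not be equivariant. Since the features are, replacing
each readout `Λ` by the Haar average of `ρ(R) Λ τ(R)⁻¹` replaces the computed function by its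
average over rotations, which changes nothing when that function is the equivariant `p`
(`exists_network_eq_average`).

Continuous functions. Stone–Weierstrass gives polynomials near `f` on a compact set; the same
symmetrization and averaging fix `f` and enlarge the error by at most a constant factor. -/

noncomputable section

namespace TFN

open MvPolynomial MeasureTheory

/-! ### Harmonic polynomials in three variables -/

section Harmonic

variable {K : Type*} [Field K]

/-- The Laplacian of a polynomial in three variables. -/
def laplacian : MvPolynomial (Fin 3) K →ₗ[K] MvPolynomial (Fin 3) K :=
  ∑ i, (pderiv i).toLinearMap ∘ₗ (pderiv i).toLinearMap

theorem laplacian_apply (f : MvPolynomial (Fin 3) K) :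
    laplacian f = ∑ i, pderiv i (pderiv i f) := by
  simp [laplacian, LinearMap.sum_apply]

/-- The polynomial `x² + y² + z²`. -/
def normSqPoly : MvPolynomial (Fin 3) K := X 0 ^ 2 + X 1 ^ 2 + X 2 ^ 2

theorem normSqPoly_isHomogeneous : (normSqPoly : MvPolynomial (Fin 3) K).IsHomogeneous 2 :=
  ((isHomogeneous_X_pow _ _).add (isHomogeneous_X_pow _ _)).add (isHomogeneous_X_pow _ _)

theorem pderiv_normSqPoly (i : Fin 3) : pderiv i (normSqPoly : MvPolynomial (Fin 3) K) = 2 * X i := by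
  fin_cases i <;> simp [normSqPoly, pderiv_X]

theorem laplacian_mul (f g : MvPolynomial (Fin 3) K) :
    laplacian (f * g) = laplacian f * g + 2 * ∑ i, pderiv i f * pderiv i g + f * laplacian g := by
  simp only [laplacian_apply, Fin.sum_univ_three, pderiv_mul, map_add]
  ring

theorem laplacian_normSqPoly : laplacian (normSqPoly : MvPolynomial (Fin 3) K) = 6 := by
  have h2 : ∀ i : Fin 3, pderiv i (2 : MvPolynomial (Fin 3) K) = 0 := fun i =>
    pderiv_C (R := K) (a := 2)
  simp only [laplacian_apply, Fin.sum_univ_three, pderiv_normSqPoly, pderiv_mul, h2, pderiv_X_self]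
  norm_num

theorem laplacian_normSqPoly_mul {g : MvPolynomial (Fin 3) K} {d : ℕ} (hg : g.IsHomogeneous d) :
    laplacian (normSqPoly * g) = ((6 + 4 * d : ℕ) : MvPolynomial (Fin 3) K) * g + normSqPoly * laplacian g := by
  have h := hg.sum_X_mul_pderiv
  rw [laplacian_mul, laplacian_normSqPoly]
  simp only [pderiv_normSqPoly]
  have : ∑ i, 2 * X i * pderiv i g = 2 * ((d : MvPolynomial (Fin 3) K) * g) := by
    rw [← nsmul_eq_mul, ← h, Finset.mul_sum]
    exact Finset.sum_congr rfl fun i _ => by ring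
  rw [this]
  push_cast
  ring

/-- Euler's identity for homogeneous polynomials, iterated. Over `ℝ` the numerical factor never
vanishes, which later makes the Laplacian injective on multiples of `‖x‖²`. -/
theorem laplacian_normSqPoly_pow_mul {g : MvPolynomial (Fin 3) K} {d : ℕ} (hg : g.IsHomogeneous d)
    (k : ℕ) :
    laplacian (normSqPoly ^ (k + 1) * g) =
      ((2 * (k + 1) * (2 * k + 3 + 2 * d) : ℕ) : MvPolynomial (Fin 3) K) * (normSqPoly ^ k * g) +
        normSqPoly ^ (k + 1) * laplacian g := by
  induction k with
  | zero => simp only [zero_add, pow_one, laplacian_normSqPoly_mul hg]; push_cast; ring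
  | succ k ih =>
    rw [pow_succ', mul_assoc, laplacian_normSqPoly_mul
      (((normSqPoly_isHomogeneous (K := K)).pow (k + 1)).mul hg), ih]
    push_cast
    ring

end Harmonic

/-! ### The spherical harmonics as polynomials -/

/-- The real and imaginary parts of `(x + iy)^μ`, as polynomials. -/
def rePow : ℕ → MvPolynomial (Fin 3) ℝ × MvPolynomial (Fin 3) ℝ
  | 0 => (1, 0)
  | μ + 1 => (X 0 * (rePow μ).1 - X 1 * (rePow μ).2, X 0 * (rePow μ).2 + X 1 * (rePow μ).1)

theorem rePow_isHomogeneous (μ : ℕ) :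
    (rePow μ).1.IsHomogeneous μ ∧ (rePow μ).2.IsHomogeneous μ := by
  induction μ with
  | zero => exact ⟨isHomogeneous_one _ _, isHomogeneous_zero _ _ _⟩
  | succ μ ih =>
    have h := fun i => isHomogeneous_X (R := ℝ) (σ := Fin 3) i
    have h1 := ((h 0).mul ih.1).sub ((h 1).mul ih.2)
    have h2 := ((h 0).mul ih.2).add ((h 1).mul ih.1)
    rw [Nat.add_comm 1 μ] at h1 h2
    exact ⟨h1, h2⟩

theorem pderiv_rePow (μ : ℕ) :
    pderiv 0 (rePow (μ + 1)).1 = (μ + 1) * (rePow μ).1 ∧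
    pderiv 1 (rePow (μ + 1)).1 = -((μ + 1) * (rePow μ).2) ∧
    pderiv 0 (rePow (μ + 1)).2 = (μ + 1) * (rePow μ).2 ∧
    pderiv 1 (rePow (μ + 1)).2 = (μ + 1) * (rePow μ).1 := by
  induction μ with
  | zero => simp [rePow, pderiv_X]
  | succ μ ih =>
    obtain ⟨h1, h2, h3, h4⟩ := ih
    rw [rePow]
    simp only [map_sub, map_add, pderiv_mul, h1, h2, h3, h4, pderiv_X_self,
      pderiv_X_of_ne (show (1 : Fin 3) ≠ 0 by decide), pderiv_X_of_ne (show (0 : Fin 3) ≠ 1 by decide)]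
    simp only [rePow]
    push_cast
    refine ⟨?_, ?_, ?_, ?_⟩ <;> ring

theorem pderiv_two_rePow (μ : ℕ) : pderiv 2 (rePow μ).1 = 0 ∧ pderiv 2 (rePow μ).2 = 0 := by
  induction μ with
  | zero => simp [rePow]
  | succ μ ih =>
    simp [rePow, ih.1, ih.2, pderiv_X_of_ne (show (1 : Fin 3) ≠ 2 by decide),
      pderiv_X_of_ne (show (0 : Fin 3) ≠ 2 by decide)]

theorem laplacian_rePow (μ : ℕ) : laplacian (rePow μ).1 = 0 ∧ laplacian (rePow μ).2 = 0 := by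
  rcases μ with _ | _ | μ
  · simp [rePow, laplacian_apply]
  · simp [rePow, laplacian_apply, Fin.sum_univ_three, pderiv_X]
  · have hn : ∀ i, pderiv i ((μ + 1 : ℕ) + 1 : MvPolynomial (Fin 3) ℝ) = 0 := fun i => by
      rw [map_add, pderiv_one, add_zero]; exact (pderiv i).map_natCast _
    obtain ⟨h1, h2, h3, h4⟩ := pderiv_rePow (μ + 1)
    obtain ⟨g1, g2, g3, g4⟩ := pderiv_rePow μ
    obtain ⟨e1, e2⟩ := pderiv_two_rePow (μ + 1 + 1)
    simp only [laplacian_apply, Fin.sum_univ_three, h1, h2, h3, h4, e1, e2, map_neg, pderiv_mul, hn,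
      g1, g2, g3, g4, map_zero]
    constructor <;> ring

/-- `Re (x + iy)^μ` or `Im (x + iy)^μ`. -/
def azimuthal (b : Prop) [Decidable b] (μ : ℕ) : MvPolynomial (Fin 3) ℝ :=
  if b then (rePow μ).1 else (rePow μ).2

theorem azimuthal_isHomogeneous (b : Prop) [Decidable b] (μ : ℕ) :
    (azimuthal b μ).IsHomogeneous μ := by
  unfold azimuthal; split_ifs <;> simp [rePow_isHomogeneous]

theorem laplacian_X_pow_mul_azimuthal (b : Prop) [Decidable b] (j μ : ℕ) :
    laplacian (X 2 ^ j * azimuthal b μ) =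
      ((j * (j - 1) : ℕ) : MvPolynomial (Fin 3) ℝ) * (X 2 ^ (j - 2) * azimuthal b μ) := by
  have h1 : laplacian (azimuthal b μ) = 0 := by
    unfold azimuthal; split_ifs <;> simp [laplacian_rePow]
  have h2 : pderiv 2 (azimuthal b μ) = 0 := by
    unfold azimuthal; split_ifs <;> simp [pderiv_two_rePow]
  have h3 : ∀ i : Fin 3, i ≠ 2 → pderiv i (X 2 ^ j : MvPolynomial (Fin 3) ℝ) = 0 := fun i hi => by
    simp [pderiv_X_of_ne hi.symm]
  have h4 : laplacian (X 2 ^ j : MvPolynomial (Fin 3) ℝ) =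
      ((j * (j - 1) : ℕ) : MvPolynomial (Fin 3) ℝ) * X 2 ^ (j - 2) := by
    rw [laplacian_apply, Fin.sum_univ_three, h3 0 (by decide), h3 1 (by decide)]
    simp only [map_zero, zero_add, pderiv_pow, pderiv_mul, pderiv_X_self, mul_one]
    rw [show pderiv 2 ((j : ℕ) : MvPolynomial (Fin 3) ℝ) = 0 from (pderiv 2).map_natCast _]
    push_cast
    rw [show j - 1 - 1 = j - 2 by omega]
    ring
  rw [laplacian_mul, h1, h4, Fin.sum_univ_three, h2, h3 0 (by decide), h3 1 (by decide)]
  ring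

/-- The coefficient of `s^k z^(ℓ - 2k - μ)` in `legendreDeriv ℓ μ z s`, up to the factor `2^(-ℓ)`. -/
def legendreCoeff (ℓ μ k : ℕ) : ℝ :=
  (-1) ^ k * (ℓ.choose k : ℝ) * ((2 * ℓ - 2 * k).choose ℓ : ℝ) * ((ℓ - 2 * k).descFactorial μ : ℝ)

theorem legendreCoeff_eq {ℓ μ k : ℕ} (h : 2 * k + μ ≤ ℓ) :
    legendreCoeff ℓ μ k * (k.factorial * (ℓ - k).factorial * (ℓ - 2 * k - μ).factorial) =
      (-1) ^ k * (2 * ℓ - 2 * k).factorial := by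
  have h1 := Nat.choose_mul_factorial_mul_factorial (show k ≤ ℓ by omega)
  have h2 := Nat.choose_mul_factorial_mul_factorial (show ℓ ≤ 2 * ℓ - 2 * k by omega)
  have h3 := Nat.factorial_mul_descFactorial (show μ ≤ ℓ - 2 * k by omega)
  rw [show 2 * ℓ - 2 * k - ℓ = ℓ - 2 * k by omega] at h2
  have h0 : (ℓ.factorial : ℝ) ≠ 0 := by positivity
  rw [← h2, ← h3]
  have h1' : (ℓ.choose k : ℝ) * k.factorial * (ℓ - k).factorial = ℓ.factorial := by exact_mod_cast h1
  unfold legendreCoeff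
  push_cast
  rw [← h1']
  ring

theorem legendreCoeff_eq_zero {ℓ μ k : ℕ} (h : ℓ < 2 * k + μ) : legendreCoeff ℓ μ k = 0 := by
  have : ℓ.choose k = 0 ∨ (ℓ - 2 * k).descFactorial μ = 0 ∨ (2 * ℓ - 2 * k).choose ℓ = 0 := by
    by_cases h' : 2 * k ≤ ℓ
    · right; left; rw [Nat.descFactorial_eq_zero_iff_lt]; omega
    · by_cases h'' : k ≤ ℓ
      · right; right; exact Nat.choose_eq_zero_of_lt (by omega)
      · left; exact Nat.choose_eq_zero_of_lt (by omega)
  rcases this with h | h | h <;> simp [legendreCoeff, h]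

/-- This recursion is what harmonicity requires: differentiating the power of `‖x‖²` in term `k + 1`
must cancel the second `z`-derivative of term `k`. With truncated subtraction both sides vanish
beyond the last term. -/
theorem legendreCoeff_succ (ℓ μ k : ℕ) :
    legendreCoeff ℓ μ (k + 1) *
        ((2 * (k + 1) * (2 * k + 3 + 2 * (ℓ - 2 * (k + 1))) : ℕ) : ℝ) =
      -(legendreCoeff ℓ μ k * (((ℓ - 2 * k - μ) * (ℓ - 2 * k - μ - 1) : ℕ) : ℝ)) := by
  by_cases h : 2 * (k + 1) + μ ≤ ℓ
  · obtain ⟨j, rfl⟩ := Nat.exists_eq_add_of_le h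
    have h1 := legendreCoeff_eq h
    have h2 := legendreCoeff_eq (show 2 * k + μ ≤ 2 * (k + 1) + μ + j by omega)
    rw [show 2 * (k + 1) + μ + j - 2 * (k + 1) - μ = j by omega,
      show 2 * (k + 1) + μ + j - (k + 1) = k + 1 + μ + j by omega,
      show 2 * (2 * (k + 1) + μ + j) - 2 * (k + 1) = 2 * k + 2 + 2 * μ + 2 * j by omega] at h1
    rw [show 2 * (k + 1) + μ + j - 2 * k - μ = j + 1 + 1 by omega,
      show 2 * (k + 1) + μ + j - k = k + 1 + μ + j + 1 by omega,
      show 2 * (2 * (k + 1) + μ + j) - 2 * k = 2 * k + 2 + 2 * μ + 2 * j + 1 + 1 by omega] at h2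
    rw [show 2 * (k + 1) + μ + j - 2 * (k + 1) = μ + j by omega,
      show 2 * (k + 1) + μ + j - 2 * k - μ = j + 1 + 1 by omega]
    generalize legendreCoeff (2 * (k + 1) + μ + j) μ (k + 1) = c' at *
    generalize legendreCoeff (2 * (k + 1) + μ + j) μ k = c at *
    have hk : (k.factorial : ℝ) ≠ 0 := by positivity
    have hj : (j.factorial : ℝ) ≠ 0 := by positivity
    have hm : ((k + 1 + μ + j).factorial : ℝ) ≠ 0 := by positivity
    have hp : ((k : ℝ) + 1 + μ + j + 1) ≠ 0 := by positivity
    simp only [Nat.factorial_succ] at h1 h2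
    push_cast at h1 h2 ⊢
    generalize ((2 * k + 2 + 2 * μ + 2 * j).factorial : ℝ) = F at *
    have : F * (-1) ^ k = - (c' * ((k + 1) * k.factorial * (k + 1 + μ + j).factorial * j.factorial)) := by
      rw [h1]; ring
    rw [show (-1 : ℝ) ^ k * ((2 * k + 2 + 2 * μ + 2 * j + 1 + 1) * ((2 * k + 2 + 2 * μ + 2 * j + 1) * F)) =
      (2 * k + 2 + 2 * μ + 2 * j + 1 + 1) * (2 * k + 2 + 2 * μ + 2 * j + 1) * (F * (-1) ^ k) by ring,
      this] at h2
    have hne : ((k.factorial : ℝ) * (k + 1 + μ + j).factorial * j.factorial * (k + 1 + μ + j + 1)) ≠ 0 := by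
      positivity
    apply mul_right_cancel₀ hne
    linear_combination h2
  · have h1 : legendreCoeff ℓ μ (k + 1) = 0 := legendreCoeff_eq_zero (by omega)
    have h2 : (ℓ - 2 * k - μ) * (ℓ - 2 * k - μ - 1) = 0 := by
      have : ℓ - 2 * k - μ ≤ 1 := by omega
      interval_cases (ℓ - 2 * k - μ) <;> rfl
    rw [h1, h2]; simp

/-- The real spherical harmonic `Y^ℓ_m`, `m = j - ℓ`, as a polynomial. -/
def harmonicPoly (ℓ : ℕ) (j : Fin (2 * ℓ + 1)) : MvPolynomial (Fin 3) ℝ :=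
  let m : ℤ := (j : ℤ) - ℓ
  let μ : ℕ := m.natAbs
  C (harmonicNormalization ℓ μ * (1 / 2 ^ ℓ)) *
    ∑ k ∈ Finset.range (ℓ / 2 + 1),
      C (legendreCoeff ℓ μ k) * (normSqPoly ^ k * (X 2 ^ (ℓ - 2 * k - μ) * azimuthal (0 ≤ m) μ))

theorem eval_rePow (μ : ℕ) (x : Fin 3 → ℝ) :
    eval x (rePow μ).1 = (((x 0 : ℂ) + (x 1 : ℂ) * Complex.I) ^ μ).re ∧
    eval x (rePow μ).2 = (((x 0 : ℂ) + (x 1 : ℂ) * Complex.I) ^ μ).im := by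
  induction μ with
  | zero => simp [rePow]
  | succ μ ih => 
    simp only [rePow, map_sub, map_mul, map_add, eval_X, ih.1, ih.2, pow_succ', Complex.mul_re, Complex.mul_im]
    simp

theorem eval_harmonicPoly (ℓ : ℕ) (j : Fin (2 * ℓ + 1)) (x : Fin 3 → ℝ) :
    eval x (harmonicPoly ℓ j) = sphericalHarmonic ℓ x j := by
  have h : ∀ (b : Prop) [Decidable b] (μ : ℕ), eval x (azimuthal b μ) =
      if b then (((x 0 : ℂ) + (x 1 : ℂ) * Complex.I) ^ μ).re
      else (((x 0 : ℂ) + (x 1 : ℂ) * Complex.I) ^ μ).im := fun b _ μ => by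
    unfold azimuthal; split_ifs <;> simp [eval_rePow]
  simp only [harmonicPoly, sphericalHarmonic, legendreDeriv, map_mul, map_sum, map_pow, eval_C, h,
    normSqPoly, map_add, eval_X, legendreCoeff]
  rw [mul_assoc, mul_assoc, mul_assoc, Finset.sum_mul]
  congr 2
  exact Finset.sum_congr rfl fun k _ => by ring

theorem natAbs_le_of_fin {ℓ : ℕ} (j : Fin (2 * ℓ + 1)) : ((j : ℤ) - ℓ).natAbs ≤ ℓ := by
  have := j.2; omega

theorem harmonicPoly_isHomogeneous (ℓ : ℕ) (j : Fin (2 * ℓ + 1)) :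
    (harmonicPoly ℓ j).IsHomogeneous ℓ := by
  refine IsHomogeneous.C_mul (IsHomogeneous.sum _ _ _ fun k _ => ?_) _
  set μ := ((j : ℤ) - ℓ).natAbs
  by_cases h : 2 * k + μ ≤ ℓ
  · have := (((normSqPoly_isHomogeneous (K := ℝ)).pow k).mul ((isHomogeneous_X_pow (R := ℝ)
      (2 : Fin 3) (ℓ - 2 * k - μ)).mul (azimuthal_isHomogeneous (0 ≤ (j : ℤ) - ℓ) μ))).C_mul
      (legendreCoeff ℓ μ k)
    rwa [show 2 * k + (ℓ - 2 * k - μ + μ) = ℓ by omega] at this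
  · rw [legendreCoeff_eq_zero (by omega), C_0, zero_mul]
    exact isHomogeneous_zero _ _ _

theorem laplacian_harmonicPoly (ℓ : ℕ) (j : Fin (2 * ℓ + 1)) : laplacian (harmonicPoly ℓ j) = 0 := by
  simp only [harmonicPoly]
  generalize (j : ℤ) - ℓ = m
  generalize m.natAbs = μ
  have hC : ∀ (a : ℝ) (f : MvPolynomial (Fin 3) ℝ), laplacian (C a * f) = C a * laplacian f :=
    fun a f => by rw [C_mul', C_mul', map_smul]
  rw [hC, map_sum]
  convert mul_zero _
  set A := azimuthal (0 ≤ m) μ with hA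
  -- `v k` is the part of the Laplacian of term `k` in which the power of `z` is differentiated
  -- twice. The remaining part of term `k + 1` is `-v k`, so the sum telescopes; the last `v`
  -- vanishes because the exponent of `z` there is at most one.
  let v : ℕ → MvPolynomial (Fin 3) ℝ := fun k => C (legendreCoeff ℓ μ k) * (normSqPoly ^ k *
    ((((ℓ - 2 * k - μ) * (ℓ - 2 * k - μ - 1) : ℕ) : MvPolynomial (Fin 3) ℝ) *
      (X 2 ^ (ℓ - 2 * k - μ - 2) * A)))
  have hsucc : ∀ k, laplacian (C (legendreCoeff ℓ μ (k + 1)) *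
      (normSqPoly ^ (k + 1) * (X 2 ^ (ℓ - 2 * (k + 1) - μ) * A))) = -v k + v (k + 1) := by
    intro k
    by_cases h : 2 * (k + 1) + μ ≤ ℓ
    · have hhom : (X 2 ^ (ℓ - 2 * (k + 1) - μ) * A).IsHomogeneous (ℓ - 2 * (k + 1)) := by
        have := (isHomogeneous_X_pow (R := ℝ) (2 : Fin 3) (ℓ - 2 * (k + 1) - μ)).mul
          (azimuthal_isHomogeneous (0 ≤ m) μ)
        rwa [show ℓ - 2 * (k + 1) - μ + μ = ℓ - 2 * (k + 1) by omega] at this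
      rw [hC, laplacian_normSqPoly_pow_mul hhom, laplacian_X_pow_mul_azimuthal, mul_add]
      congr 1
      have := congrArg (C : ℝ → MvPolynomial (Fin 3) ℝ) (legendreCoeff_succ ℓ μ k)
      simp only [map_mul, map_neg, map_natCast] at this
      simp only [v]
      rw [show ℓ - 2 * k - μ - 2 = ℓ - 2 * (k + 1) - μ by omega]
      linear_combination (normSqPoly ^ k * (X 2 ^ (ℓ - 2 * (k + 1) - μ) * A)) * this
    · have h0 : v k = 0 := by
        have : (ℓ - 2 * k - μ) * (ℓ - 2 * k - μ - 1) = 0 := by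
          have : ℓ - 2 * k - μ ≤ 1 := by omega
          interval_cases (ℓ - 2 * k - μ) <;> rfl
        simp only [v, this]; simp
      have h1 := legendreCoeff_eq_zero (show ℓ < 2 * (k + 1) + μ by omega)
      rw [h0]
      simp [v, h1]
  rw [Finset.sum_range_succ']
  simp only [hsucc]
  have h0 : laplacian (C (legendreCoeff ℓ μ 0) *
      (normSqPoly ^ 0 * (X 2 ^ (ℓ - 2 * 0 - μ) * A))) = v 0 := by
    rw [hC, pow_zero, one_mul, hA, laplacian_X_pow_mul_azimuthal]; simp [v, hA]
  rw [h0, show ∑ k ∈ Finset.range (ℓ / 2), (-v k + v (k + 1)) = v (ℓ / 2) - v 0 by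
    rw [← Finset.sum_range_sub]; exact Finset.sum_congr rfl fun k _ => by ring]
  rw [sub_add_cancel]
  have : (ℓ - 2 * (ℓ / 2) - μ) * (ℓ - 2 * (ℓ / 2) - μ - 1) = 0 := by
    have : ℓ - 2 * (ℓ / 2) - μ ≤ 1 := by omega
    interval_cases (ℓ - 2 * (ℓ / 2) - μ) <;> rfl
  simp only [v, this]; simp

/-! ### Polynomials which vanish on the complex null cone -/

/-- The ideal of the real polynomials which vanish on the complex null cone `x² + y² + z² = 0`. -/
def nullIdeal : Ideal (MvPolynomial (Fin 3) ℝ) where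
  carrier := {q | ∀ w : Fin 3 → ℂ, w 0 ^ 2 + w 1 ^ 2 + w 2 ^ 2 = 0 → aeval w q = 0}
  zero_mem' := fun w _ => map_zero _
  add_mem' := fun ha hb w hw => by rw [map_add, ha w hw, hb w hw, add_zero]
  smul_mem' := fun c q hq w hw => by rw [smul_eq_mul, map_mul, hq w hw, mul_zero]

theorem mem_nullIdeal {q : MvPolynomial (Fin 3) ℝ} :
    q ∈ nullIdeal ↔ ∀ w : Fin 3 → ℂ, w 0 ^ 2 + w 1 ^ 2 + w 2 ^ 2 = 0 → aeval w q = 0 := Iff.rfl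

theorem normSqPoly_mem_nullIdeal : normSqPoly ∈ nullIdeal := fun w hw => by
  simpa [normSqPoly] using hw

theorem aeval_rePow (μ : ℕ) (w : Fin 3 → ℂ) :
    aeval w (rePow μ).1 =
      ((w 0 + Complex.I * w 1) ^ μ + (w 0 - Complex.I * w 1) ^ μ) / 2 ∧
    aeval w (rePow μ).2 =
      ((w 0 + Complex.I * w 1) ^ μ - (w 0 - Complex.I * w 1) ^ μ) / (2 * Complex.I) := by
  have hI : Complex.I ^ 2 = -1 := Complex.I_sq
  have hI0 := Complex.I_ne_zero
  induction μ with
  | zero => simp [rePow]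
  | succ μ ih =>
    simp only [rePow, map_sub, map_mul, map_add, aeval_X, ih.1, ih.2, pow_succ']
    generalize (w 0 + Complex.I * w 1) ^ μ = A
    generalize (w 0 - Complex.I * w 1) ^ μ = B
    constructor
    · field_simp
      linear_combination (-w 1 * A + w 1 * B) * hI
    · field_simp
      ring

/-- The coefficient of the restriction of `harmonicPoly ℓ j` to the null cone. -/
def nullCoeff (ℓ μ : ℕ) : ℝ :=
  harmonicNormalization ℓ μ * (1 / 2 ^ ℓ) * legendreCoeff ℓ μ 0

theorem nullCoeff_ne_zero {ℓ μ : ℕ} (h : μ ≤ ℓ) : nullCoeff ℓ μ ≠ 0 := by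
  have h1 : harmonicNormalization ℓ μ ≠ 0 := by
    unfold harmonicNormalization
    have : (0 : ℝ) < (2 * ℓ + 1) / (4 * Real.pi) * ((ℓ - μ).factorial / (ℓ + μ).factorial) := by
      positivity
    refine mul_ne_zero ?_ (Real.sqrt_pos.2 this).ne'
    split_ifs <;> simp
  have h2 : legendreCoeff ℓ μ 0 ≠ 0 := by
    have ha : (2 * ℓ).choose ℓ ≠ 0 := (Nat.choose_pos (by omega)).ne'
    have hb : ℓ.descFactorial μ ≠ 0 := by rw [Ne, Nat.descFactorial_eq_zero_iff_lt]; omega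
    simp [legendreCoeff, ha, hb]
  unfold nullCoeff
  positivity

theorem aeval_harmonicPoly_of_null (ℓ : ℕ) (j : Fin (2 * ℓ + 1)) (w : Fin 3 → ℂ)
    (hw : w 0 ^ 2 + w 1 ^ 2 + w 2 ^ 2 = 0) :
    aeval w (harmonicPoly ℓ j) = nullCoeff ℓ ((j : ℤ) - ℓ).natAbs *
      (w 2 ^ (ℓ - ((j : ℤ) - ℓ).natAbs) *
        aeval w (azimuthal (0 ≤ (j : ℤ) - ℓ) ((j : ℤ) - ℓ).natAbs)) := by
  simp only [harmonicPoly]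
  generalize (j : ℤ) - ℓ = m
  rw [map_mul, map_sum, Finset.sum_range_succ']
  have h0 : aeval w (normSqPoly : MvPolynomial (Fin 3) ℝ) = 0 := normSqPoly_mem_nullIdeal w hw
  simp only [map_mul, map_pow, h0]
  simp [nullCoeff]
  ring

/-- The restriction of `harmonicPoly ℓ j` to the curve `(x + iy, x - iy, z) = (t², -1, t)`. -/
def nullCurvePoly (ℓ : ℕ) (j : Fin (2 * ℓ + 1)) : Polynomial ℂ :=
  let μ := ((j : ℤ) - ℓ).natAbs
  Polynomial.C (nullCoeff ℓ μ : ℂ) * if 0 ≤ (j : ℤ) - ℓ then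
    Polynomial.C (1 / 2) * (Polynomial.X ^ (ℓ + μ) + Polynomial.C ((-1) ^ μ) * Polynomial.X ^ (ℓ - μ))
  else Polynomial.C (1 / (2 * Complex.I)) *
    (Polynomial.X ^ (ℓ + μ) - Polynomial.C ((-1) ^ μ) * Polynomial.X ^ (ℓ - μ))

theorem eval_nullCurvePoly (ℓ : ℕ) (j : Fin (2 * ℓ + 1)) (t : ℂ) :
    (nullCurvePoly ℓ j).eval t =
      aeval ![(t ^ 2 - 1) / 2, (t ^ 2 + 1) / (2 * Complex.I), t] (harmonicPoly ℓ j) := by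
  have hI : Complex.I ^ 2 = -1 := Complex.I_sq
  have hI0 := Complex.I_ne_zero
  have hμ := natAbs_le_of_fin j
  rw [aeval_harmonicPoly_of_null]
  swap
  · simp; field_simp; rw [hI]; ring
  simp only [nullCurvePoly]
  generalize (j : ℤ) - ℓ = m at *
  generalize m.natAbs = μ at *
  have e1 : (t ^ 2 - 1) / 2 + Complex.I * ((t ^ 2 + 1) / (2 * Complex.I)) = t ^ 2 := by
    field_simp; ring
  have e2 : (t ^ 2 - 1) / 2 - Complex.I * ((t ^ 2 + 1) / (2 * Complex.I)) = -1 := by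
    field_simp; ring
  have hp : t ^ (ℓ + μ) = t ^ (ℓ - μ) * (t ^ 2) ^ μ := by
    rw [← pow_mul, ← pow_add]; congr 1; omega
  unfold azimuthal
  split_ifs
  · simp only [Polynomial.eval_mul, Polynomial.eval_C, Polynomial.eval_add, Polynomial.eval_pow,
      Polynomial.eval_X, aeval_rePow, Matrix.cons_val, e1, e2, hp]
    ring
  · simp only [Polynomial.eval_mul, Polynomial.eval_C, Polynomial.eval_sub, Polynomial.eval_pow,
      Polynomial.eval_X, aeval_rePow, Matrix.cons_val, e1, e2, hp]
    ring

/-- On the curve `x + iy = t²`, `x - iy = -1`, `z = t` in the null cone, the harmonics of order `±μ`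
involve only `t^(ℓ+μ)` and `t^(ℓ-μ)`. Comparing coefficients of `t^(ℓ+μ)` therefore isolates each
`μ`. -/
theorem eq_zero_of_sum_mem_nullIdeal {ℓ : ℕ} (c : Fin (2 * ℓ + 1) → ℝ)
    (h : ∑ j, c j • harmonicPoly ℓ j ∈ nullIdeal) : c = 0 := by
  have hI : Complex.I ^ 2 = -1 := Complex.I_sq
  have hI0 := Complex.I_ne_zero
  have hQ : ∑ j, Polynomial.C (c j : ℂ) * nullCurvePoly ℓ j = 0 := by
    refine Polynomial.funext fun t => ?_
    have := h ![(t ^ 2 - 1) / 2, (t ^ 2 + 1) / (2 * Complex.I), t]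
      (by simp; field_simp; rw [hI]; ring)
    rw [map_sum] at this
    rw [Polynomial.eval_finsetSum, Polynomial.eval_zero, ← this]
    refine Finset.sum_congr rfl fun j _ => ?_
    rw [Polynomial.eval_mul, Polynomial.eval_C, eval_nullCurvePoly, map_smul, Complex.real_smul]
  have hcoeff : ∀ i : ℕ, ∑ j, (c j : ℂ) * (nullCurvePoly ℓ j).coeff i = 0 := fun i => by
    have := congrArg (fun q => Polynomial.coeff q i) hQ
    simpa [Polynomial.finsetSum_coeff, Polynomial.coeff_C_mul] using this
  have key : ∀ (μ : ℕ) (hμ : μ ≤ ℓ), c ⟨ℓ + μ, by omega⟩ = 0 ∧ c ⟨ℓ - μ, by omega⟩ = 0 := by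
    intro μ hμ
    have hne : (nullCoeff ℓ μ : ℂ) ≠ 0 := by exact_mod_cast nullCoeff_ne_zero hμ
    have hz : ∀ j : Fin (2 * ℓ + 1), (j : ℕ) ≠ ℓ + μ → (j : ℕ) ≠ ℓ - μ →
        (nullCurvePoly ℓ j).coeff (ℓ + μ) = 0 := by
      intro j h1 h2
      have h3 : ℓ + μ ≠ ℓ + ((j : ℤ) - ℓ).natAbs := by omega
      have h4 : ℓ + μ ≠ ℓ - ((j : ℤ) - ℓ).natAbs := by omega
      simp only [nullCurvePoly, Polynomial.coeff_C_mul]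
      split_ifs <;>
        simp only [Polynomial.coeff_C_mul, Polynomial.coeff_add, Polynomial.coeff_sub,
          Polynomial.coeff_X_pow, h3, h4, if_false] <;> ring
    have e1 : (((ℓ + μ : ℕ) : ℤ) - ℓ).natAbs = μ := by omega
    rcases Nat.eq_zero_or_pos μ with rfl | hpos
    · have := hcoeff (ℓ + 0)
      rw [Fintype.sum_eq_single (⟨ℓ, by omega⟩ : Fin (2 * ℓ + 1))] at this
      · simp [nullCurvePoly, Polynomial.coeff_C_mul, Polynomial.coeff_X_pow] at this
        exact ⟨this.resolve_right (nullCoeff_ne_zero hμ), this.resolve_right (nullCoeff_ne_zero hμ)⟩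
      · intro j hj
        rw [hz j (fun h => hj (Fin.ext h)) (fun h => hj (Fin.ext h)), mul_zero]
    · have := hcoeff (ℓ + μ)
      rw [Fintype.sum_eq_add (⟨ℓ + μ, by omega⟩ : Fin (2 * ℓ + 1)) ⟨ℓ - μ, by omega⟩] at this
      · have e2 : (((ℓ - μ : ℕ) : ℤ) - ℓ).natAbs = μ := by omega
        have e3 : (0 : ℤ) ≤ ((ℓ + μ : ℕ) : ℤ) - ℓ := by omega
        have e4 : ¬ (0 : ℤ) ≤ ((ℓ - μ : ℕ) : ℤ) - ℓ := by omega
        have e5 : ℓ + μ ≠ ℓ - μ := by omega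
        simp only [nullCurvePoly, e1, e2, e3, e4, if_true, if_false, Polynomial.coeff_C_mul,
          Polynomial.coeff_add, Polynomial.coeff_sub, Polynomial.coeff_X_pow, e5] at this
        generalize c ⟨ℓ + μ, _⟩ = a at *
        generalize c ⟨ℓ - μ, _⟩ = b at *
        -- The coefficient is a multiple of `a/2 + b/(2i)`. Since `a` and `b` are real, one complex
        -- equation determines both.
        have h2 : ((a : ℂ) * Complex.I + b) = 0 := by
          have h3 : (nullCoeff ℓ μ : ℂ) * ((a : ℂ) * Complex.I + b) = 0 := by
            field_simp at this
            linear_combination this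
          exact (mul_eq_zero.1 h3).resolve_left hne
        have h4 := congrArg Complex.re h2
        have h5 := congrArg Complex.im h2
        simp at h4 h5
        exact ⟨h5, h4⟩
      · intro h; rw [Fin.mk.injEq] at h; omega
      · rintro j ⟨h1, h2⟩
        rw [hz j (fun h => h1 (Fin.ext h)) (fun h => h2 (Fin.ext h)), mul_zero]
  funext j
  obtain ⟨h1, h2⟩ := key ((j : ℤ) - ℓ).natAbs (natAbs_le_of_fin j)
  by_cases hj : (ℓ : ℕ) ≤ j
  · rw [Pi.zero_apply, ← h1]; congr 1; apply Fin.ext; simp only; omega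
  · rw [Pi.zero_apply, ← h2]; congr 1; apply Fin.ext; simp only; omega

/-! ### Decomposition of homogeneous polynomials -/

/-- The multiples of `x² + y² + z²` which are homogeneous of degree `ℓ`. -/
def normSqMultiples (ℓ : ℕ) : Submodule ℝ (MvPolynomial (Fin 3) ℝ) where
  carrier := {p | ∃ q : MvPolynomial (Fin 3) ℝ, q.IsHomogeneous (ℓ - 2) ∧ (ℓ < 2 → q = 0) ∧
    p = normSqPoly * q}
  zero_mem' := ⟨0, isHomogeneous_zero _ _ _, fun _ => rfl, by simp⟩
  add_mem' := by
    rintro _ _ ⟨q, h1, h2, rfl⟩ ⟨q', h1', h2', rfl⟩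
    exact ⟨q + q', h1.add h1', fun h => by rw [h2 h, h2' h, add_zero], by ring⟩
  smul_mem' := by
    rintro c _ ⟨q, h1, h2, rfl⟩
    refine ⟨c • q, ?_, fun h => by rw [h2 h, smul_zero], by rw [mul_smul_comm]⟩
    rw [← C_mul']; exact h1.C_mul c

theorem normSqMultiples_le_nullIdeal {ℓ : ℕ} {p : MvPolynomial (Fin 3) ℝ}
    (hp : p ∈ normSqMultiples ℓ) : p ∈ nullIdeal := by
  obtain ⟨q, -, -, rfl⟩ := hp
  exact nullIdeal.mul_mem_right _ normSqPoly_mem_nullIdeal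

/-- Monomials of degree `ℓ` in which `x` has exponent at most one. -/
def reducedMonomial (ℓ : ℕ) (i : Fin (2 * ℓ + 1)) : MvPolynomial (Fin 3) ℝ :=
  if (i : ℕ) ≤ ℓ then X 1 ^ (i : ℕ) * X 2 ^ (ℓ - i)
  else X 0 * (X 1 ^ (i - ℓ - 1 : ℕ) * X 2 ^ (2 * ℓ - i))

/-- Modulo `‖x‖²` one may replace `x²` by `-y² - z²`, until the exponent of `x` is `0` or `1`. This
leaves `(ℓ + 1) + ℓ` monomials. -/
theorem mkQ_monomial_mem_span (ℓ a b c : ℕ) (h : a + b + c = ℓ) :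
    (normSqMultiples ℓ).mkQ (X 0 ^ a * (X 1 ^ b * X 2 ^ c)) ∈
      Submodule.span ℝ (Set.range fun i => (normSqMultiples ℓ).mkQ (reducedMonomial ℓ i)) := by
  induction a using Nat.strong_induction_on generalizing b c with
  | _ a ih =>
    rcases a with _ | _ | a
    · refine Submodule.subset_span ⟨⟨b, by omega⟩, ?_⟩
      simp only [reducedMonomial]
      rw [if_pos (by omega), show ℓ - b = c by omega, pow_zero, one_mul]
    · refine Submodule.subset_span ⟨⟨ℓ + 1 + b, by omega⟩, ?_⟩
      simp only [reducedMonomial]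
      rw [if_neg (by omega), show ℓ + 1 + b - ℓ - 1 = b by omega,
        show 2 * ℓ - (ℓ + 1 + b) = c by omega, zero_add, pow_one]
    · have h1 := ih a (by omega) (b + 2) c (by omega)
      have h2 := ih a (by omega) b (c + 2) (by omega)
      have h3 : (normSqMultiples ℓ).mkQ (normSqPoly * (X 0 ^ a * (X 1 ^ b * X 2 ^ c))) = 0 := by
        rw [Submodule.mkQ_apply, Submodule.Quotient.mk_eq_zero]
        refine ⟨_, ?_, fun h => by omega, rfl⟩
        have := (isHomogeneous_X_pow (R := ℝ) (0 : Fin 3) a).mul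
          ((isHomogeneous_X_pow (R := ℝ) (1 : Fin 3) b).mul (isHomogeneous_X_pow (2 : Fin 3) c))
        rwa [show a + (b + c) = ℓ - 2 by omega] at this
      have h4 : (X 0 ^ (a + 1 + 1) * (X 1 ^ b * X 2 ^ c) : MvPolynomial (Fin 3) ℝ) =
          normSqPoly * (X 0 ^ a * (X 1 ^ b * X 2 ^ c)) - X 0 ^ a * (X 1 ^ (b + 2) * X 2 ^ c) -
            X 0 ^ a * (X 1 ^ b * X 2 ^ (c + 2)) := by
        unfold normSqPoly; ring
      rw [h4, map_sub, map_sub, h3, zero_sub]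
      exact Submodule.sub_mem _ (Submodule.neg_mem _ h1) h2

/-- The classes modulo `‖x‖²` are spanned by `2ℓ + 1` reduced monomials, while the `2ℓ + 1` classes
of harmonics are independent, so the latter span as well. The clause for `ℓ < 2` excludes the
spurious constants allowed by the truncated degree `ℓ - 2 = 0`. -/
theorem exists_harmonic_decomposition {ℓ : ℕ} {q : MvPolynomial (Fin 3) ℝ}
    (hq : q.IsHomogeneous ℓ) :
    ∃ (c : Fin (2 * ℓ + 1) → ℝ) (q' : MvPolynomial (Fin 3) ℝ), q'.IsHomogeneous (ℓ - 2) ∧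
      (ℓ < 2 → q' = 0) ∧ q = ∑ j, c j • harmonicPoly ℓ j + normSqPoly * q' := by
  set M := normSqMultiples ℓ with hM
  set E := Submodule.span ℝ (Set.range fun i => M.mkQ (reducedMonomial ℓ i)) with hE
  have hmem : ∀ p : MvPolynomial (Fin 3) ℝ, p.IsHomogeneous ℓ → M.mkQ p ∈ E := by
    intro p hp
    rw [p.as_sum, map_sum]
    refine Submodule.sum_mem _ fun m hm => ?_
    have hdeg : m 0 + m 1 + m 2 = ℓ := by
      have := hp (mem_support_iff.1 hm)
      rw [Finsupp.weight_apply, Finsupp.sum_fintype _ _ (by simp)] at this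
      simpa [Fin.sum_univ_three] using this
    rw [monomial_eq, Finsupp.prod_fintype _ _ (by simp), Fin.prod_univ_three, C_mul', map_smul,
      mul_assoc]
    exact Submodule.smul_mem _ _ (mkQ_monomial_mem_span ℓ _ _ _ hdeg)
  have hind : LinearIndependent ℝ fun j => M.mkQ (harmonicPoly ℓ j) := by
    rw [Fintype.linearIndependent_iff]
    intro g hg
    have h1 : M.mkQ (∑ j, g j • harmonicPoly ℓ j) = 0 := by simpa [map_sum] using hg
    rw [Submodule.mkQ_apply, Submodule.Quotient.mk_eq_zero] at h1
    exact congrFun (eq_zero_of_sum_mem_nullIdeal g (normSqMultiples_le_nullIdeal h1))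
  have hspan : Submodule.span ℝ (Set.range fun j => M.mkQ (harmonicPoly ℓ j)) = E := by
    have : FiniteDimensional ℝ E := FiniteDimensional.span_of_finite ℝ (Set.finite_range _)
    refine Submodule.eq_of_le_of_finrank_le ?_ ?_
    · rw [Submodule.span_le]
      rintro _ ⟨j, rfl⟩
      exact hmem _ (harmonicPoly_isHomogeneous ℓ j)
    · rw [finrank_span_eq_card hind]
      exact finrank_range_le_card _
  have h := hmem q hq
  rw [← hspan, Submodule.mem_span_range_iff_exists_fun] at h
  obtain ⟨c, hc⟩ := h
  have h1 : M.mkQ (q - ∑ j, c j • harmonicPoly ℓ j) = 0 := by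
    rw [map_sub, ← hc]; simp [map_sum]
  rw [Submodule.mkQ_apply, Submodule.Quotient.mk_eq_zero] at h1
  obtain ⟨q', h2, h3, h4⟩ := h1
  exact ⟨c, q', h2, h3, by rw [← h4]; ring⟩

/-! ### Harmonic forms are combinations of spherical harmonics. -/

theorem laplacian_sum_harmonicPoly {ℓ : ℕ} (c : Fin (2 * ℓ + 1) → ℝ) :
    laplacian (∑ j, c j • harmonicPoly ℓ j) = 0 := by
  simp [map_sum, laplacian_harmonicPoly]

theorem sum_harmonicPoly_isHomogeneous {ℓ : ℕ} (c : Fin (2 * ℓ + 1) → ℝ) :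
    (∑ j, c j • harmonicPoly ℓ j).IsHomogeneous ℓ :=
  IsHomogeneous.sum _ _ _ fun j _ => by
    rw [← C_mul']; exact (harmonicPoly_isHomogeneous ℓ j).C_mul _

theorem normSqPoly_ne_zero : (normSqPoly : MvPolynomial (Fin 3) ℝ) ≠ 0 := fun h => by
  have := congrArg (eval ![1, 0, 0]) h
  simp [normSqPoly] at this

/-- Decompose `q` and divide the Laplacian by `‖x‖^(2k)`: what remains puts the harmonic part of `q`
into the null ideal, so that part is zero. Then `q` is a multiple of `‖x‖²`, its degree drops by two
and `k` grows by one, which is why the induction needs all `k`. -/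
theorem eq_zero_of_laplacian_normSqPoly_pow_mul {r k : ℕ} {q : MvPolynomial (Fin 3) ℝ}
    (hq : q.IsHomogeneous r) (h : laplacian (normSqPoly ^ (k + 1) * q) = 0) : q = 0 := by
  induction r using Nat.strong_induction_on generalizing q k with
  | _ r ih =>
    obtain ⟨c, q', h1, h2, rfl⟩ := exists_harmonic_decomposition hq
    have e : normSqPoly ^ (k + 1) * (∑ j, c j • harmonicPoly r j + normSqPoly * q') =
        normSqPoly ^ (k + 1) * ∑ j, c j • harmonicPoly r j + normSqPoly ^ (k + 1 + 1) * q' := by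
      ring
    have h' := h
    rw [e, map_add, laplacian_normSqPoly_pow_mul (sum_harmonicPoly_isHomogeneous c),
      laplacian_normSqPoly_pow_mul h1, laplacian_sum_harmonicPoly, mul_zero, add_zero] at h'
    set N : ℕ := 2 * (k + 1) * (2 * k + 3 + 2 * r)
    have hN : (N : ℝ) ≠ 0 := by positivity
    have h3 : (N : MvPolynomial (Fin 3) ℝ) * ∑ j, c j • harmonicPoly r j + normSqPoly *
        (((2 * (k + 1 + 1) * (2 * (k + 1) + 3 + 2 * (r - 2)) : ℕ) : MvPolynomial (Fin 3) ℝ) * q' +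
          normSqPoly * laplacian q') = 0 := by
      refine (mul_eq_zero.1 ?_).resolve_left (pow_ne_zero k normSqPoly_ne_zero)
      rw [← h']
      ring
    have h4 : (N : MvPolynomial (Fin 3) ℝ) * ∑ j, c j • harmonicPoly r j ∈ nullIdeal := by
      rw [eq_neg_of_add_eq_zero_left h3]
      exact neg_mem (nullIdeal.mul_mem_right _ normSqPoly_mem_nullIdeal)
    have h5 : ∑ j, c j • harmonicPoly r j ∈ nullIdeal := by
      have := nullIdeal.mul_mem_left (C ((N : ℝ)⁻¹)) h4
      rwa [← mul_assoc, show (N : MvPolynomial (Fin 3) ℝ) = C (N : ℝ) by simp, ← C_mul,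
        inv_mul_cancel₀ hN, C_1, one_mul] at this
    have hc := eq_zero_of_sum_mem_nullIdeal c h5
    subst hc
    simp only [Pi.zero_apply, zero_smul, Finset.sum_const_zero, zero_add] at h ⊢
    by_cases hr : r < 2
    · rw [h2 hr, mul_zero]
    · rw [← mul_assoc, ← pow_succ] at h
      rw [ih (r - 2) (by omega) h1 h, mul_zero]

theorem exists_eq_sum_harmonicPoly {ℓ : ℕ} {q : MvPolynomial (Fin 3) ℝ} (hq : q.IsHomogeneous ℓ)
    (h : laplacian q = 0) : ∃ c : Fin (2 * ℓ + 1) → ℝ, q = ∑ j, c j • harmonicPoly ℓ j := by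
  obtain ⟨c, q', h1, h2, rfl⟩ := exists_harmonic_decomposition hq
  refine ⟨c, ?_⟩
  rw [map_add, laplacian_sum_harmonicPoly, zero_add] at h
  rw [eq_zero_of_laplacian_normSqPoly_pow_mul (k := 0) h1 (by simpa using h), mul_zero, add_zero]

/-! ### Linear substitutions -/

section Substitution

variable {K : Type*} [Field K]

/-- The polynomial `f ∘ R`. -/
def linSubst (R : Matrix (Fin 3) (Fin 3) K) :
    MvPolynomial (Fin 3) K →ₐ[K] MvPolynomial (Fin 3) K :=
  aeval fun i => ∑ j, C (R i j) * X j

theorem linSubst_X (R : Matrix (Fin 3) (Fin 3) K) (i : Fin 3) :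
    linSubst R (X i) = ∑ j, C (R i j) * X j := by simp [linSubst]

theorem eval_linSubst (R : Matrix (Fin 3) (Fin 3) K) (f : MvPolynomial (Fin 3) K) (x : Fin 3 → K) :
    eval x (linSubst R f) = eval (R.mulVec x) f := by
  induction f using MvPolynomial.induction_on with
  | C a => simp [linSubst]
  | add p q hp hq => rw [map_add, map_add, map_add, hp, hq]
  | mul_X p i hp =>
    rw [map_mul, map_mul, map_mul, hp, linSubst_X]
    simp [Matrix.mulVec, dotProduct]

theorem pderiv_linSubst (R : Matrix (Fin 3) (Fin 3) K) (f : MvPolynomial (Fin 3) K) (i : Fin 3) :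
    pderiv i (linSubst R f) = ∑ j, C (R j i) * linSubst R (pderiv j f) := by
  induction f using MvPolynomial.induction_on with
  | C a => simp [linSubst]
  | add p q hp hq =>
    simp only [map_add, hp, hq, mul_add, Finset.sum_add_distrib]
  | mul_X p k hp =>
    have h1 : pderiv i (∑ j, C (R k j) * X j) = C (R k i) := by
      simp only [map_sum, pderiv_C_mul, pderiv_X]
      rw [Finset.sum_eq_single i]
      · simp
      · intro b _ hb; simp [hb.symm]
      · simp
    have h2 : ∑ j, C (R j i) * (linSubst R p * linSubst R (pderiv j (X k))) =
        linSubst R p * C (R k i) := by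
      rw [Finset.sum_eq_single k]
      · simp [mul_comm]
      · intro b _ hb; simp [pderiv_X_of_ne hb.symm]
      · simp
    simp only [map_mul, pderiv_mul, hp, map_add, mul_add, Finset.sum_add_distrib, h2, linSubst_X, h1]
    congr 1
    rw [Finset.sum_mul]
    exact Finset.sum_congr rfl fun j _ => by ring

theorem sum_smul_smul_of_mul_transpose {M : Type*} [AddCommMonoid M] [Module K M]
    {R : Matrix (Fin 3) (Fin 3) K} (hR : R * R.transpose = 1) (v : Fin 3 → Fin 3 → M) :
    ∑ i, ∑ j, R j i • ∑ k, R k i • v j k = ∑ j, v j j := by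
  have hR' : ∀ j k, ∑ i, R j i * R k i = if j = k then 1 else 0 := fun j k => by
    have := congrFun (congrFun hR j) k
    rwa [Matrix.mul_apply, Matrix.one_apply] at this
  rw [Finset.sum_comm]
  refine Finset.sum_congr rfl fun j _ => ?_
  simp only [Finset.smul_sum, smul_smul]
  rw [Finset.sum_comm]
  simp only [← Finset.sum_smul, hR', ite_smul, one_smul, zero_smul, Finset.sum_ite_eq,
    Finset.mem_univ, if_true]

/-- The contraction of two gradients is invariant under orthogonal substitutions. An arbitrary
bilinear `β` is allowed so that the identity applies at each stage of a transvectant. -/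
theorem sum_pderiv_linSubst {M : Type*} [AddCommMonoid M] [Module K M]
    {R : Matrix (Fin 3) (Fin 3) K} (hR : R * R.transpose = 1)
    (β : MvPolynomial (Fin 3) K →ₗ[K] MvPolynomial (Fin 3) K →ₗ[K] M)
    (f g : MvPolynomial (Fin 3) K) :
    ∑ i, β (pderiv i (linSubst R f)) (pderiv i (linSubst R g)) =
      ∑ i, β (linSubst R (pderiv i f)) (linSubst R (pderiv i g)) := by
  rw [← sum_smul_smul_of_mul_transpose hR
    fun j k => β (linSubst R (pderiv j f)) (linSubst R (pderiv k g))]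
  refine Finset.sum_congr rfl fun i _ => ?_
  simp only [pderiv_linSubst, C_mul', map_sum, LinearMap.sum_apply, map_smul, LinearMap.smul_apply]
  simp only [Finset.smul_sum]
  rw [Finset.sum_comm]
  exact Finset.sum_congr rfl fun j _ => Finset.sum_congr rfl fun k _ => smul_comm _ _ _

theorem laplacian_linSubst {R : Matrix (Fin 3) (Fin 3) K} (hR : R * R.transpose = 1)
    (f : MvPolynomial (Fin 3) K) : laplacian (linSubst R f) = linSubst R (laplacian f) := by
  rw [laplacian_apply, laplacian_apply, map_sum, ← sum_smul_smul_of_mul_transpose hR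
    fun j k => linSubst R (pderiv k (pderiv j f))]
  refine Finset.sum_congr rfl fun i _ => ?_
  simp only [pderiv_linSubst, C_mul', map_sum, Derivation.map_smul]

theorem linSubst_isHomogeneous (R : Matrix (Fin 3) (Fin 3) K) {f : MvPolynomial (Fin 3) K} {d : ℕ}
    (hf : f.IsHomogeneous d) : (linSubst R f).IsHomogeneous d := by
  have := hf.aeval (fun i => ∑ j, C (R i j) * X j) (n := 1) fun i =>
    IsHomogeneous.sum _ _ _ fun j _ => (isHomogeneous_X K j).C_mul _
  rwa [one_mul] at this

end Substitution

theorem SO3.mul_transpose (R : SO3) : R.1 * R.1.transpose = 1 :=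
  (Matrix.mem_orthogonalGroup_iff _ _).1 R.2.1

theorem SO3.transpose_mul (R : SO3) : R.1.transpose * R.1 = 1 :=
  (Matrix.mem_orthogonalGroup_iff' _ _).1 R.2.1

/-! ### The Wigner matrices -/

theorem exists_wigner (ℓ : ℕ) (R : SO3) : ∃ M : Matrix (Fin (2 * ℓ + 1)) (Fin (2 * ℓ + 1)) ℝ,
    ∀ j, linSubst R.1 (harmonicPoly ℓ j) = ∑ k, M j k • harmonicPoly ℓ k := by
  have h : ∀ j, ∃ c : Fin (2 * ℓ + 1) → ℝ,
      linSubst R.1 (harmonicPoly ℓ j) = ∑ k, c k • harmonicPoly ℓ k := fun j =>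
    exists_eq_sum_harmonicPoly (linSubst_isHomogeneous _ (harmonicPoly_isHomogeneous ℓ j))
      (by rw [laplacian_linSubst R.mul_transpose, laplacian_harmonicPoly, map_zero])
  choose M hM using h
  exact ⟨M, hM⟩

theorem sphericalHarmonic_mulVec (ℓ : ℕ) (R : SO3) (x : Fin 3 → ℝ) :
    sphericalHarmonic ℓ (R.1.mulVec x) = (wignerD ℓ R).mulVec (sphericalHarmonic ℓ x) := by
  have h : ∃ M : Matrix (Fin (2 * ℓ + 1)) (Fin (2 * ℓ + 1)) ℝ, ∀ x : Fin 3 → ℝ,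
      sphericalHarmonic ℓ (R.1.mulVec x) = M.mulVec (sphericalHarmonic ℓ x) := by
    obtain ⟨M, hM⟩ := exists_wigner ℓ R
    refine ⟨M, fun x => funext fun j => ?_⟩
    rw [← eval_harmonicPoly, ← eval_linSubst, hM]
    simp [Matrix.mulVec, dotProduct, eval_harmonicPoly, smul_eval]
  exact Classical.epsilon_spec h x

theorem eq_zero_of_forall_dotProduct_sphericalHarmonic {ℓ : ℕ} (c : Fin (2 * ℓ + 1) → ℝ)
    (h : ∀ x, c ⬝ᵥ sphericalHarmonic ℓ x = 0) : c = 0 := by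
  refine eq_zero_of_sum_mem_nullIdeal c ?_
  have : ∑ j, c j • harmonicPoly ℓ j = 0 := MvPolynomial.funext fun x => by
    simpa [smul_eval, eval_harmonicPoly, dotProduct] using h x
  rw [this]
  exact zero_mem _

/-- A functional vanishing on all values would be a linear relation between the harmonics. Hence
linear maps on `W_ℓ` can be tested on the vectors `Y^ℓ(x)`, and the Wigner matrix is uniquely
determined. -/
theorem span_sphericalHarmonic (ℓ : ℕ) :
    Submodule.span ℝ (Set.range (sphericalHarmonic ℓ)) = ⊤ := by
  by_contra hne
  obtain ⟨f, hf, hf'⟩ := Submodule.exists_le_ker_of_lt_top _ (lt_top_iff_ne_top.2 hne)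
  refine hf ?_
  have hc : ∀ v, f v = (fun j => f (Pi.single j 1)) ⬝ᵥ v := fun v => by
    conv_lhs => rw [pi_eq_sum_univ' v]
    simp [dotProduct, mul_comm]
  have := eq_zero_of_forall_dotProduct_sphericalHarmonic (fun j => f (Pi.single j 1)) fun x => by
    rw [← hc]
    exact hf' (Submodule.subset_span ⟨x, rfl⟩)
  refine LinearMap.ext fun v => ?_
  rw [hc, this, zero_dotProduct, LinearMap.zero_apply]

theorem irrep_hom_ext {ℓ : ℕ} {E : Type*} [AddCommGroup E] [Module ℝ E] {f g : Irrep ℓ →ₗ[ℝ] E}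
    (h : ∀ x, f (sphericalHarmonic ℓ x) = g (sphericalHarmonic ℓ x)) : f = g :=
  LinearMap.ext_on_range (span_sphericalHarmonic ℓ) h

theorem wignerD_mulVec_mul (ℓ : ℕ) (R S : SO3) (w : Irrep ℓ) :
    (wignerD ℓ (R * S)).mulVec w = (wignerD ℓ R).mulVec ((wignerD ℓ S).mulVec w) := by
  have : (wignerD ℓ (R * S)).mulVecLin =
      (wignerD ℓ R).mulVecLin ∘ₗ (wignerD ℓ S).mulVecLin := irrep_hom_ext fun x => by
    simp only [Matrix.mulVecLin_apply, LinearMap.comp_apply, ← sphericalHarmonic_mulVec,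
      Matrix.mulVec_mulVec]
    rfl
  exact LinearMap.congr_fun this w

theorem wignerD_mulVec_one (ℓ : ℕ) (w : Irrep ℓ) : (wignerD ℓ 1).mulVec w = w := by
  have : (wignerD ℓ 1).mulVecLin = LinearMap.id := irrep_hom_ext fun x => by
    simp only [Matrix.mulVecLin_apply, LinearMap.id_apply, ← sphericalHarmonic_mulVec]
    congr 1
    exact Matrix.one_mulVec x
  exact LinearMap.congr_fun this w

theorem continuous_sphericalHarmonic (ℓ : ℕ) : Continuous (sphericalHarmonic ℓ) := by
  refine continuous_pi fun j => ?_
  simp only [← eval_harmonicPoly]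
  exact MvPolynomial.continuous_eval _

/-- The Wigner matrix is only a choice, so continuity is read off from `R ↦ Y^ℓ(R x)` on a spanning
set. -/
theorem continuous_wignerD_mulVec (ℓ : ℕ) (w : Irrep ℓ) :
    Continuous fun R : SO3 => (wignerD ℓ R).mulVec w := by
  have hw : w ∈ Submodule.span ℝ (Set.range (sphericalHarmonic ℓ)) := by
    rw [span_sphericalHarmonic]; trivial
  induction hw using Submodule.span_induction with
  | mem v hv =>
    obtain ⟨x, rfl⟩ := hv
    simp only [← sphericalHarmonic_mulVec]
    exact (continuous_sphericalHarmonic ℓ).comp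
      (continuous_subtype_val.matrix_mulVec continuous_const)
  | zero => simp only [Matrix.mulVec_zero]; exact continuous_const
  | add u v _ _ hu hv => simp only [Matrix.mulVec_add]; exact hu.add hv
  | smul a u _ hu => simp only [Matrix.mulVec_smul]; exact hu.const_smul a

theorem continuous_wignerD (ℓ : ℕ) : Continuous (wignerD ℓ) := by
  refine continuous_matrix fun i j => ?_
  have := (continuous_apply i).comp (continuous_wignerD_mulVec ℓ (Pi.single j 1))
  refine this.congr fun R => ?_
  simp

theorem eval_smul_of_isHomogeneous {f : MvPolynomial (Fin 3) ℝ} {d : ℕ} (hf : f.IsHomogeneous d)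
    (a : ℝ) (x : Fin 3 → ℝ) : eval (a • x) f = a ^ d * eval x f := by
  rw [eval_eq', eval_eq', Finset.mul_sum]
  refine Finset.sum_congr rfl fun m hm => ?_
  have hdeg : ∑ i, m i = d := by
    have := hf (mem_support_iff.1 hm)
    rw [Finsupp.weight_apply, Finsupp.sum_fintype _ _ (by simp)] at this
    simpa using this
  simp only [Pi.smul_apply, smul_eq_mul, mul_pow, Finset.prod_mul_distrib, Finset.prod_pow_eq_pow_sum,
    hdeg]
  ring

theorem sphericalHarmonic_smul (ℓ : ℕ) (a : ℝ) (x : Fin 3 → ℝ) :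
    sphericalHarmonic ℓ (a • x) = a ^ ℓ • sphericalHarmonic ℓ x := by
  funext j
  rw [Pi.smul_apply, smul_eq_mul, ← eval_harmonicPoly, ← eval_harmonicPoly,
    eval_smul_of_isHomogeneous (harmonicPoly_isHomogeneous ℓ j)]

/-! ### Averaging over the rotation group -/

instance : ContinuousInv SO3 where
  continuous_inv := Continuous.subtype_mk
    (f := fun R : SO3 => R.1.transpose) continuous_subtype_val.matrix_transpose _

instance : IsTopologicalGroup SO3 where

instance : CompactSpace SO3 := by
  refine isCompact_iff_compactSpace.1 ?_
  have hK : IsCompact {M : Matrix (Fin 3) (Fin 3) ℝ | ∀ i j, M i j ∈ Set.Icc (-1 : ℝ) 1} :=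
    IsCompact.matrix isCompact_Icc
  refine hK.of_isClosed_subset ?_ ?_
  · have : ((Matrix.specialOrthogonalGroup (Fin 3) ℝ : Submonoid _) :
        Set (Matrix (Fin 3) (Fin 3) ℝ)) = {M | M * M.transpose = 1} ∩ {M | M.det = 1} := by
      ext M
      exact and_congr_left fun _ => Matrix.mem_orthogonalGroup_iff _ _
    rw [this]
    exact (isClosed_eq (continuous_id.matrix_mul continuous_id.matrix_transpose)
      continuous_const).inter (isClosed_eq continuous_id.matrix_det continuous_const)
  · intro M hM i j
    have h1 : M * M.transpose = 1 := SO3.mul_transpose ⟨M, hM⟩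
    have h2 := congrFun (congrFun h1 i) i
    rw [Matrix.mul_apply, Matrix.one_apply_eq] at h2
    simp only [Matrix.transpose_apply] at h2
    have h3 : M i j * M i j ≤ 1 := by
      rw [← h2]
      exact Finset.single_le_sum (f := fun k => M i k * M i k)
        (fun k _ => mul_self_nonneg _) (Finset.mem_univ j)
    exact abs_le.1 (abs_le_one_iff_mul_self_le_one.2 h3)

instance : MeasurableSpace SO3 := borel SO3

instance : BorelSpace SO3 := ⟨rfl⟩

/-- The normalized Haar measure of the rotation group. -/
def haarSO3 : Measure SO3 := Measure.haarMeasure ⊤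

instance : IsProbabilityMeasure haarSO3 := ⟨Measure.haarMeasure_self⟩

instance : Measure.IsMulLeftInvariant haarSO3 :=
  inferInstanceAs (Measure.IsMulLeftInvariant (Measure.haarMeasure ⊤))

theorem integrable_of_continuous_SO3 {E : Type*} [NormedAddCommGroup E] {f : SO3 → E}
    (hf : Continuous f) : Integrable f haarSO3 :=
  hf.integrable_of_hasCompactSupport (HasCompactSupport.of_compactSpace f)

section Average

variable {V E : Type*} [AddCommGroup V] [Module ℝ V] [NormedAddCommGroup E] [NormedSpace ℝ E]

/-- The average of a family of linear maps over the rotation group. -/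
def averageLinear (F : SO3 → V →ₗ[ℝ] E) (hF : ∀ v, Continuous fun R => F R v) : V →ₗ[ℝ] E where
  toFun v := ∫ R, F R v ∂haarSO3
  map_add' v w := by
    simp only [map_add]
    exact integral_add (integrable_of_continuous_SO3 (hF v)) (integrable_of_continuous_SO3 (hF w))
  map_smul' a v := by
    simp only [map_smul, RingHom.id_apply]
    exact integral_smul a _

theorem averageLinear_apply (F : SO3 → V →ₗ[ℝ] E) (hF : ∀ v, Continuous fun R => F R v) (v : V) :
    averageLinear F hF v = ∫ R, F R v ∂haarSO3 := rfl

variable [FiniteDimensional ℝ E]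

/-- The substitution `R ↦ S R` and left invariance of Haar measure. It is applied to projections, to
left inverses and to the readouts of networks. -/
theorem averageLinear_conj_equivariant (τ : Representation ℝ SO3 V) (ρ : Representation ℝ SO3 E)
    (Λ : V →ₗ[ℝ] E) (hF : ∀ v, Continuous fun R => (ρ R ∘ₗ Λ ∘ₗ τ R⁻¹) v) (S : SO3) (v : V) :
    averageLinear (fun R => ρ R ∘ₗ Λ ∘ₗ τ R⁻¹) hF (τ S v) =
      ρ S (averageLinear (fun R => ρ R ∘ₗ Λ ∘ₗ τ R⁻¹) hF v) := by
  rw [averageLinear_apply, averageLinear_apply,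
    ← integral_mul_left_eq_self (fun R => (ρ R ∘ₗ Λ ∘ₗ τ R⁻¹) (τ S v)) S]
  have := (LinearMap.toContinuousLinearMap (ρ S)).integral_comp_comm
    (integrable_of_continuous_SO3 (hF v))
  rw [LinearMap.coe_toContinuousLinearMap'] at this
  rw [← this]
  refine integral_congr_ae (Filter.Eventually.of_forall fun R => ?_)
  simp only [LinearMap.comp_apply, map_mul, mul_inv_rev, Module.End.mul_apply]
  rw [← Module.End.mul_apply (τ S⁻¹), ← map_mul, inv_mul_cancel, map_one, Module.End.one_apply]

end Average

/-! ### The irreducible representations -/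

/-- The representation of `SO(3)` on `W_ℓ`. -/
def irrepRep (ℓ : ℕ) : Representation ℝ SO3 (Irrep ℓ) where
  toFun R := (wignerD ℓ R).mulVecLin
  map_one' := LinearMap.ext fun w => wignerD_mulVec_one ℓ w
  map_mul' R S := LinearMap.ext fun w => wignerD_mulVec_mul ℓ R S w

theorem irrepRep_apply (ℓ : ℕ) (R : SO3) (w : Irrep ℓ) :
    irrepRep ℓ R w = (wignerD ℓ R).mulVec w := rfl

theorem irrepRep_sphericalHarmonic (ℓ : ℕ) (R : SO3) (x : Fin 3 → ℝ) :
    irrepRep ℓ R (sphericalHarmonic ℓ x) = sphericalHarmonic ℓ (R.1.mulVec x) :=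
  (sphericalHarmonic_mulVec ℓ R x).symm

/-- The rotation about the third axis with cosine `c` and sine `s`. -/
def rotZ (c s : ℝ) (h : c ^ 2 + s ^ 2 = 1) : SO3 :=
  ⟨!![c, -s, 0; s, c, 0; 0, 0, 1], (Matrix.mem_orthogonalGroup_iff _ _).2 (by
    ext i j; fin_cases i <;> fin_cases j <;>
      simp [Matrix.mul_apply, Fin.sum_univ_three] <;> linarith), by
    simp [Matrix.det_fin_three]; linarith⟩

/-- The rotation about the second axis with cosine `c` and sine `s`. -/
def rotY (c s : ℝ) (h : c ^ 2 + s ^ 2 = 1) : SO3 :=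
  ⟨!![c, 0, s; 0, 1, 0; -s, 0, c], (Matrix.mem_orthogonalGroup_iff _ _).2 (by
    ext i j; fin_cases i <;> fin_cases j <;>
      simp [Matrix.mul_apply, Fin.sum_univ_three] <;> linarith), by
    simp [Matrix.det_fin_three]; linarith⟩

theorem exists_rotation_northPole (x : Fin 3 → ℝ) :
    ∃ (r : ℝ) (R : SO3), x = r • R.1.mulVec ![0, 0, 1] := by
  set ρ := √(x 0 ^ 2 + x 1 ^ 2) with hρ
  set r := √(x 0 ^ 2 + x 1 ^ 2 + x 2 ^ 2) with hr
  have hρ2 : ρ ^ 2 = x 0 ^ 2 + x 1 ^ 2 := Real.sq_sqrt (by positivity)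
  have hr2 : r ^ 2 = x 0 ^ 2 + x 1 ^ 2 + x 2 ^ 2 := Real.sq_sqrt (by positivity)
  by_cases hr0 : r = 0
  · refine ⟨0, 1, ?_⟩
    rw [hr0] at hr2
    funext i
    fin_cases i <;> simp <;> nlinarith [sq_nonneg (x 0), sq_nonneg (x 1), sq_nonneg (x 2)]
  · have hY : (x 2 / r) ^ 2 + (ρ / r) ^ 2 = 1 := by
      field_simp; rw [hρ2, hr2]; ring
    by_cases hρ0 : ρ = 0
    · have h0 : x 0 = 0 ∧ x 1 = 0 := by
        rw [hρ0] at hρ2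
        constructor <;> nlinarith [sq_nonneg (x 0), sq_nonneg (x 1)]
      refine ⟨r, rotY _ _ hY, ?_⟩
      funext i
      fin_cases i <;> simp [rotY, h0, hρ0]
      field_simp
    · have hZ : (x 0 / ρ) ^ 2 + (x 1 / ρ) ^ 2 = 1 := by
        field_simp; rw [hρ2]
      refine ⟨r, rotZ _ _ hZ * rotY _ _ hY, ?_⟩
      have : (rotZ _ _ hZ * rotY _ _ hY).1 = (rotZ _ _ hZ).1 * (rotY _ _ hY).1 := rfl
      rw [this, ← Matrix.mulVec_mulVec]
      funext i
      fin_cases i <;> simp [rotZ, rotY, dotProduct, Fin.sum_univ_three] <;> field_simp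

/-- The weight zero vector of `W_ℓ`. -/
def zeroWeight (ℓ : ℕ) : Irrep ℓ := Pi.single ⟨ℓ, by omega⟩ 1

/-- The rotation about the third axis by the angle `2πk/(ℓ+1)`. -/
def rotCyclic (ℓ k : ℕ) : SO3 :=
  rotZ (Real.cos (2 * Real.pi * k / (ℓ + 1))) (Real.sin (2 * Real.pi * k / (ℓ + 1)))
    (Real.cos_sq_add_sin_sq _)

/-- A discrete projection onto weight zero: order `μ` acquires the factor `∑_k ω^(kμ)`, which is
zero for `0 < μ ≤ ℓ` because `ω` is a primitive root of unity of order `ℓ + 1`. -/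
theorem sum_rotCyclic_sphericalHarmonic (ℓ : ℕ) (x : Fin 3 → ℝ) :
    ∑ k ∈ Finset.range (ℓ + 1), sphericalHarmonic ℓ ((rotCyclic ℓ k).1.mulVec x) =
      ((ℓ + 1 : ℝ) * sphericalHarmonic ℓ x ⟨ℓ, by omega⟩) • zeroWeight ℓ := by
  set ω : ℂ := Complex.exp (2 * Real.pi * Complex.I / (ℓ + 1 : ℕ)) with hω
  have hprim : IsPrimitiveRoot ω (ℓ + 1) := Complex.isPrimitiveRoot_exp _ (by omega)
  have hrot : ∀ k, ((((rotCyclic ℓ k).1.mulVec x) 0 : ℝ) : ℂ) +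
      (((rotCyclic ℓ k).1.mulVec x) 1 : ℝ) * Complex.I = ω ^ k * (x 0 + x 1 * Complex.I) := by
    intro k
    have : ω ^ k = Complex.cos (2 * Real.pi * k / (ℓ + 1)) +
        Complex.sin (2 * Real.pi * k / (ℓ + 1)) * Complex.I := by
      rw [hω, ← Complex.exp_nat_mul, ← Complex.exp_mul_I]
      congr 1
      push_cast
      ring
    rw [this]
    simp [rotCyclic, rotZ, Matrix.mulVec, dotProduct, Fin.sum_univ_three]
    ring_nf
    rw [Complex.I_sq]
    ring
  have hz : ∀ k, ((rotCyclic ℓ k).1.mulVec x) 2 = x 2 := fun k => by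
    simp [rotCyclic, rotZ, Matrix.mulVec, dotProduct, Fin.sum_univ_three]
  have hs : ∀ k, ((rotCyclic ℓ k).1.mulVec x) 0 ^ 2 + ((rotCyclic ℓ k).1.mulVec x) 1 ^ 2 +
      x 2 ^ 2 = x 0 ^ 2 + x 1 ^ 2 + x 2 ^ 2 := fun k => by
    simp only [rotCyclic, rotZ, Matrix.mulVec, dotProduct, Fin.sum_univ_three]
    simp
    linear_combination (x 0 ^ 2 + x 1 ^ 2) *
      Real.cos_sq_add_sin_sq (2 * Real.pi * k / (ℓ + 1))
  funext j
  rw [Finset.sum_apply]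
  by_cases hj : (j : ℕ) = ℓ
  · have hj' : j = ⟨ℓ, by omega⟩ := Fin.ext hj
    rw [hj']
    simp [sphericalHarmonic, hz, hs, zeroWeight]
  · have hμ : ((j : ℤ) - ℓ).natAbs ≠ 0 := by omega
    have hμ' := natAbs_le_of_fin j
    have hz' : zeroWeight ℓ j = 0 := by
      simp only [zeroWeight, Pi.single_apply]
      rw [if_neg fun h => hj (congrArg Fin.val h)]
    rw [Pi.smul_apply, hz', smul_zero]
    simp only [sphericalHarmonic, hz, hs, hrot]
    generalize (j : ℤ) - ℓ = m at *
    generalize m.natAbs = μ at *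
    have hne : ω ^ μ ≠ 1 := hprim.pow_ne_one_of_pos_of_lt hμ (by omega)
    have hsum : ∑ k ∈ Finset.range (ℓ + 1), (ω ^ k * (x 0 + x 1 * Complex.I)) ^ μ = 0 := by
      simp only [mul_pow, ← pow_mul]
      rw [← Finset.sum_mul]
      simp only [mul_comm _ μ, pow_mul]
      rw [geom_sum_eq hne, ← pow_mul, mul_comm μ, pow_mul, hprim.pow_eq_one]
      simp
    rw [← Finset.mul_sum]
    split_ifs
    · rw [← Complex.re_sum, hsum, Complex.zero_re, mul_zero]
    · rw [← Complex.im_sum, hsum, Complex.zero_im, mul_zero]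

theorem sum_irrepRep_rotCyclic (ℓ : ℕ) (w : Irrep ℓ) :
    ∑ k ∈ Finset.range (ℓ + 1), irrepRep ℓ (rotCyclic ℓ k) w =
      ((ℓ + 1 : ℝ) * w ⟨ℓ, by omega⟩) • zeroWeight ℓ := by
  have : ∑ k ∈ Finset.range (ℓ + 1), irrepRep ℓ (rotCyclic ℓ k) =
      ((ℓ + 1 : ℝ) • LinearMap.proj (φ := fun _ : Fin (2 * ℓ + 1) => ℝ) ⟨ℓ, by omega⟩).smulRight
        (zeroWeight ℓ) := irrep_hom_ext fun x => by
    rw [LinearMap.sum_apply]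
    simp only [irrepRep_sphericalHarmonic, sum_rotCyclic_sphericalHarmonic]
    simp
  have h := LinearMap.congr_fun this w
  rw [LinearMap.sum_apply] at h
  rw [h]
  simp

theorem sphericalHarmonic_northPole (ℓ : ℕ) : ∃ y : ℝ,
    sphericalHarmonic ℓ ![0, 0, 1] = y • zeroWeight ℓ := by
  refine ⟨sphericalHarmonic ℓ ![0, 0, 1] ⟨ℓ, by omega⟩, ?_⟩
  have h := sum_rotCyclic_sphericalHarmonic ℓ ![0, 0, 1]
  have h1 : ∀ k, (rotCyclic ℓ k).1.mulVec ![0, 0, 1] = ![0, 0, 1] := fun k => by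
    funext i
    fin_cases i <;> simp [rotCyclic, rotZ, Matrix.mulVec, dotProduct, Fin.sum_univ_three]
  simp only [h1, Finset.sum_const, Finset.card_range, mul_smul] at h
  have h2 : ((ℓ : ℝ) + 1) ≠ 0 := by positivity
  refine smul_right_injective _ h2 ?_
  simp only
  rw [← h, ← Nat.cast_smul_eq_nsmul ℝ]
  push_cast
  rfl

/-- **Schur's lemma** for `W_ℓ`, over the real numbers. -/
theorem exists_eq_smul_of_equivariant {ℓ : ℕ} (Q : Irrep ℓ →ₗ[ℝ] Irrep ℓ)
    (hQ : ∀ R w, Q (irrepRep ℓ R w) = irrepRep ℓ R (Q w)) : ∃ a : ℝ, ∀ w, Q w = a • w := by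
  have h2 : ((ℓ : ℝ) + 1) ≠ 0 := by positivity
  -- `Q` commutes with the projection onto weight zero, so it preserves the line spanned by the
  -- weight zero vector.
  have h0 : Q (zeroWeight ℓ) = (Q (zeroWeight ℓ) ⟨ℓ, by omega⟩) • zeroWeight ℓ := by
    have h := sum_irrepRep_rotCyclic ℓ (Q (zeroWeight ℓ))
    simp only [← hQ] at h
    rw [← map_sum, sum_irrepRep_rotCyclic, map_smul] at h
    simp only [zeroWeight, Pi.single_eq_same, mul_one] at h ⊢
    rw [mul_smul] at h
    exact smul_right_injective _ h2 h
  generalize (Q (zeroWeight ℓ) ⟨ℓ, by omega⟩) = a at h0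
  -- Every `Y^ℓ(x)` is a multiple of a rotated weight zero vector, and these values span `W_ℓ`.
  refine ⟨a, LinearMap.congr_fun (f := Q) (g := a • LinearMap.id) (irrep_hom_ext fun x => ?_)⟩
  obtain ⟨y, hy⟩ := sphericalHarmonic_northPole ℓ
  obtain ⟨r, R, rfl⟩ := exists_rotation_northPole x
  rw [sphericalHarmonic_smul, ← irrepRep_sphericalHarmonic, hy, map_smul, hQ, map_smul, h0]
  simp only [LinearMap.smul_apply, LinearMap.id_apply, map_smul, smul_smul]
  ring_nf

theorem continuous_irrepRep_apply {X : Type*} [TopologicalSpace X] {ℓ : ℕ} {R : X → SO3}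
    {w : X → Irrep ℓ} (hR : Continuous R) (hw : Continuous w) :
    Continuous fun x => irrepRep ℓ (R x) (w x) := by
  simp only [irrepRep_apply]
  exact ((continuous_wignerD ℓ).comp hR).matrix_mulVec hw

/-- `W_ℓ` is irreducible. -/
theorem invariant_eq_bot_or_top {ℓ : ℕ} (E : Submodule ℝ (Irrep ℓ))
    (hE : ∀ R, ∀ w ∈ E, irrepRep ℓ R w ∈ E) : E = ⊥ ∨ E = ⊤ := by
  obtain ⟨g, hg⟩ := LinearMap.exists_leftInverse_of_injective E.subtype E.ker_subtype
  set p : Irrep ℓ →ₗ[ℝ] Irrep ℓ := E.subtype ∘ₗ g with hp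
  have hpE : ∀ w ∈ E, p w = w := fun w hw => by
    have := LinearMap.congr_fun hg ⟨w, hw⟩
    exact congrArg Subtype.val this
  have hmem : ∀ R w, (irrepRep ℓ R ∘ₗ p ∘ₗ irrepRep ℓ R⁻¹) w ∈ E := fun R w =>
    hE R _ (g _).2
  have hcont : ∀ w, Continuous fun R => (irrepRep ℓ R ∘ₗ p ∘ₗ irrepRep ℓ R⁻¹) w := fun w =>
    continuous_irrepRep_apply continuous_id (p.continuous_of_finiteDimensional.comp
      (continuous_irrepRep_apply continuous_inv continuous_const))
  -- The averaged projection still maps into `E` and fixes `E` pointwise, but is now equivariant,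
  -- hence scalar by Schur. If `E` is nonzero the scalar is `1`.
  set Q := averageLinear (fun R => irrepRep ℓ R ∘ₗ p ∘ₗ irrepRep ℓ R⁻¹) hcont with hQ
  have hQE : ∀ w, Q w ∈ E := fun w =>
    E.convex.integral_mem E.closed_of_finiteDimensional
      (Filter.Eventually.of_forall fun R => hmem R w) (integrable_of_continuous_SO3 (hcont w))
  have hid : ∀ w ∈ E, Q w = w := fun w hw => by
    have : ∀ R, (irrepRep ℓ R ∘ₗ p ∘ₗ irrepRep ℓ R⁻¹) w = w := fun R => by
      simp only [LinearMap.comp_apply]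
      rw [hpE _ (hE R⁻¹ w hw), ← Module.End.mul_apply, ← map_mul, mul_inv_cancel, map_one,
        Module.End.one_apply]
    rw [hQ, averageLinear_apply]
    simp only [this]
    simp
  obtain ⟨a, ha⟩ := exists_eq_smul_of_equivariant Q fun R w =>
    averageLinear_conj_equivariant (irrepRep ℓ) (irrepRep ℓ) p hcont R w
  refine or_iff_not_imp_left.2 fun hne => ?_
  obtain ⟨w, hw, hw0⟩ := E.ne_bot_iff.1 hne
  have h1 : a = 1 := by
    have := hid w hw
    rw [ha] at this
    have h3 : (a - 1) • w = 0 := by rw [sub_smul, this, one_smul, sub_self]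
    exact sub_eq_zero.1 ((smul_eq_zero.1 h3).resolve_right hw0)
  refine eq_top_iff.2 fun v _ => ?_
  have := hQE v
  rwa [ha, h1, one_smul] at this

/-! ### Consequences of irreducibility for intertwiners. -/

theorem ker_eq_bot_of_equivariant {ℓ : ℕ} {V : Type*} [AddCommGroup V] [Module ℝ V]
    (τ : Representation ℝ SO3 V) (A : Irrep ℓ →ₗ[ℝ] V)
    (hA : ∀ R w, A (irrepRep ℓ R w) = τ R (A w)) (h0 : A ≠ 0) : A.ker = ⊥ := by
  refine (invariant_eq_bot_or_top A.ker fun R w hw => ?_).resolve_right fun h =>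
    h0 (LinearMap.ker_eq_top.1 h)
  rw [LinearMap.mem_ker] at hw ⊢
  rw [hA, hw, map_zero]

/-- A nonzero `A` would be bijective by irreducibility of both sides, contradicting `2ℓ + 1 ≠ 2ℓ' +
1`. -/
theorem eq_zero_of_equivariant_of_ne {ℓ ℓ' : ℕ} (hne : ℓ ≠ ℓ') (A : Irrep ℓ →ₗ[ℝ] Irrep ℓ')
    (hA : ∀ R w, A (irrepRep ℓ R w) = irrepRep ℓ' R (A w)) : A = 0 := by
  by_contra h0
  have hker := ker_eq_bot_of_equivariant (irrepRep ℓ') A hA h0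
  have hrange : A.range = ⊤ := by
    refine (invariant_eq_bot_or_top A.range ?_).resolve_left fun h =>
      h0 (LinearMap.range_eq_bot.1 h)
    rintro R _ ⟨w, rfl⟩
    exact ⟨irrepRep ℓ R w, hA R w⟩
  have := (LinearEquiv.ofBijective A
    ⟨LinearMap.ker_eq_bot.1 hker, LinearMap.range_eq_top.1 hrange⟩).finrank_eq
  simp at this
  exact hne this

/-! ### Transvectants -/

section Transvectant

variable {K : Type*} [Field K]

/-- Bilinear differential operators: `transvect β k f g = ∑_I β (∂_I f) (∂_I g)`, the sum over all
`k`-tuples `I` of coordinates. -/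
def transvect (β : MvPolynomial (Fin 3) K →ₗ[K] MvPolynomial (Fin 3) K →ₗ[K] MvPolynomial (Fin 3) K) :
    ℕ → (MvPolynomial (Fin 3) K →ₗ[K] MvPolynomial (Fin 3) K →ₗ[K] MvPolynomial (Fin 3) K)
  | 0 => β
  | k + 1 => ∑ i, (transvect β k).compl₁₂ (pderiv i).toLinearMap (pderiv i).toLinearMap

variable (β : MvPolynomial (Fin 3) K →ₗ[K] MvPolynomial (Fin 3) K →ₗ[K] MvPolynomial (Fin 3) K)

theorem transvect_succ (k : ℕ) (f g : MvPolynomial (Fin 3) K) :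
    transvect β (k + 1) f g = ∑ i, transvect β k (pderiv i f) (pderiv i g) := by
  simp [transvect, LinearMap.sum_apply]

variable {β}

theorem transvect_linSubst {R : Matrix (Fin 3) (Fin 3) K} (hR : R * R.transpose = 1)
    (hβ : ∀ f g, β (linSubst R f) (linSubst R g) = linSubst R (β f g)) (k : ℕ)
    (f g : MvPolynomial (Fin 3) K) :
    transvect β k (linSubst R f) (linSubst R g) = linSubst R (transvect β k f g) := by
  induction k generalizing f g with
  | zero => exact hβ f g
  | succ k ih =>
    rw [transvect_succ, transvect_succ, sum_pderiv_linSubst hR, map_sum]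
    exact Finset.sum_congr rfl fun i _ => ih _ _

theorem transvect_isHomogeneous {d : ℕ → ℕ → ℕ}
    (hβ : ∀ (p q : ℕ) (f g : MvPolynomial (Fin 3) K), f.IsHomogeneous p → g.IsHomogeneous q →
      (β f g).IsHomogeneous (d p q)) (k : ℕ) {p q : ℕ} {f g : MvPolynomial (Fin 3) K}
    (hf : f.IsHomogeneous p) (hg : g.IsHomogeneous q) :
    (transvect β k f g).IsHomogeneous (d (p - k) (q - k)) := by
  induction k generalizing f g p q with
  | zero => exact hβ p q f g hf hg
  | succ k ih =>
    rw [transvect_succ]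
    refine IsHomogeneous.sum _ _ _ fun i _ => ?_
    have := ih (hf.pderiv (i := i)) (hg.pderiv (i := i))
    rwa [Nat.sub_sub, Nat.sub_sub, Nat.add_comm 1 k] at this

theorem transvect_map {L : Type*} [Field L] (φ : K →+* L)
    {β' : MvPolynomial (Fin 3) L →ₗ[L] MvPolynomial (Fin 3) L →ₗ[L] MvPolynomial (Fin 3) L}
    (hβ : ∀ f g, map φ (β f g) = β' (map φ f) (map φ g)) (k : ℕ) (f g : MvPolynomial (Fin 3) K) :
    map φ (transvect β k f g) = transvect β' k (map φ f) (map φ g) := by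
  induction k generalizing f g with
  | zero => exact hβ f g
  | succ k ih =>
    rw [transvect_succ, transvect_succ, map_sum]
    refine Finset.sum_congr rfl fun i _ => ?_
    rw [ih, pderiv_map, pderiv_map]

/-- The linear form with coefficients `u`. -/
def linForm (u : Fin 3 → K) : MvPolynomial (Fin 3) K := ∑ i, C (u i) * X i

theorem eval_linForm (u w : Fin 3 → K) : eval w (linForm u) = u ⬝ᵥ w := by
  simp [linForm, dotProduct]

theorem pderiv_linForm_pow (u : Fin 3 → K) (p : ℕ) (i : Fin 3) :
    pderiv i (linForm u ^ p) = ((p : K) * u i) • linForm u ^ (p - 1) := by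
  have h : pderiv i (linForm u) = C (u i) := by
    simp only [linForm, map_sum, pderiv_C_mul, pderiv_X]
    rw [Finset.sum_eq_single i]
    · simp
    · intro b _ hb; simp [hb.symm]
    · simp
  rw [pderiv_pow, h, ← C_mul', map_mul, map_natCast]
  ring

/-- Each differentiation of a power of a linear form lowers the exponent by one, and each
contraction produces `u ⬝ᵥ v`. Transvectants thus become explicit on such powers, where their
nonvanishing is tested. -/
theorem transvect_linForm_pow (u v : Fin 3 → K) (k p q : ℕ) :
    transvect β k (linForm u ^ p) (linForm v ^ q) =
      (((p.descFactorial k : ℕ) : K) * (q.descFactorial k : ℕ) * (u ⬝ᵥ v) ^ k) •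
        β (linForm u ^ (p - k)) (linForm v ^ (q - k)) := by
  induction k generalizing p q with
  | zero => simp [transvect]
  | succ k ih =>
    rw [transvect_succ]
    simp only [pderiv_linForm_pow, map_smul, LinearMap.smul_apply, ih, smul_smul]
    rw [← Finset.sum_smul, Nat.sub_sub, Nat.sub_sub, Nat.add_comm 1 k]
    congr 1
    have e : ∀ a : ℕ, ((a.descFactorial (k + 1) : ℕ) : K) = a * ((a - 1).descFactorial k : ℕ) := by
      intro a
      rcases a with _ | a
      · simp
      · rw [Nat.succ_descFactorial_succ]; simp
    rw [e, e, pow_succ]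
    simp only [dotProduct, Finset.mul_sum]
    refine Finset.sum_congr rfl fun i _ => by ring

variable (K) in
/-- The bilinear operator `(f, g) ↦ det (x, ∇f, ∇g)`. -/
def detForm :
    MvPolynomial (Fin 3) K →ₗ[K] MvPolynomial (Fin 3) K →ₗ[K] MvPolynomial (Fin 3) K :=
  LinearMap.mk₂ K (fun f g => Matrix.det (Matrix.of ![fun i => X i, fun i => pderiv i f,
      fun i => pderiv i g]))
    (fun f f' g => by simp [Matrix.det_fin_three]; ring)
    (fun c f g => by simp [Matrix.det_fin_three, smul_eq_C_mul]; ring)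
    (fun f g g' => by simp [Matrix.det_fin_three]; ring)
    (fun c f g => by simp [Matrix.det_fin_three, smul_eq_C_mul]; ring)

theorem detForm_apply (f g : MvPolynomial (Fin 3) K) : detForm K f g =
    Matrix.det (Matrix.of ![fun i => X i, fun i => pderiv i f, fun i => pderiv i g]) := rfl

/-- Orthogonality lets `R` be factored out of all three rows `x`, `∇f`, `∇g` at once, and `det R =
1` removes it. -/
theorem detForm_linSubst {R : Matrix (Fin 3) (Fin 3) K} (hR : R.transpose * R = 1)
    (hdet : R.det = 1) (f g : MvPolynomial (Fin 3) K) :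
    detForm K (linSubst R f) (linSubst R g) = linSubst R (detForm K f g) := by
  have h : Matrix.of ![fun i => X i, fun i => pderiv i (linSubst R f),
      fun i => pderiv i (linSubst R g)] =
      ((linSubst R).mapMatrix (Matrix.of ![fun i => X i, fun i => pderiv i f,
        fun i => pderiv i g])) * R.map C := by
    have hR' : ∀ j k, ∑ i, R i j * R i k = if j = k then 1 else 0 := fun j k => by
      have := congrFun (congrFun hR j) k
      rwa [Matrix.mul_apply, Matrix.one_apply] at this
    ext1 i j
    rw [Matrix.mul_apply]
    fin_cases i
    · simp only [AlgHom.mapMatrix_apply, Matrix.map_apply, Matrix.of_apply]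
      simp only [Fin.zero_eta, Matrix.cons_val_zero, linSubst_X, Finset.sum_mul]
      rw [Finset.sum_comm]
      have : ∀ k : Fin 3, ∑ i, C (R i k) * X k * C (R i j) =
          (X k : MvPolynomial (Fin 3) K) * C (if k = j then 1 else 0) := fun k => by
        rw [← hR', map_sum, Finset.mul_sum]
        exact Finset.sum_congr rfl fun i _ => by rw [C_mul]; ring
      simp only [this]
      rw [Finset.sum_eq_single j]
      · simp
      · intro b _ hb; simp [hb]
      · simp
    · simp [pderiv_linSubst, mul_comm]
    · simp [pderiv_linSubst, mul_comm]
  rw [detForm_apply, h, Matrix.det_mul, detForm_apply, AlgHom.map_det]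
  have : (R.map (C : K → MvPolynomial (Fin 3) K)).det = 1 := by
    rw [show R.map (C : K → MvPolynomial (Fin 3) K) = (C : K →+* _).mapMatrix R from rfl,
      ← RingHom.map_det, hdet, map_one]
  rw [this, mul_one]

theorem detForm_isHomogeneous (p q : ℕ) (f g : MvPolynomial (Fin 3) K) (hf : f.IsHomogeneous p)
    (hg : g.IsHomogeneous q) : (detForm K f g).IsHomogeneous (1 + (p - 1) + (q - 1)) := by
  have h : ∀ i j k : Fin 3, (X i * pderiv j f * pderiv k g).IsHomogeneous (1 + (p - 1) + (q - 1)) :=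
    fun i j k => ((isHomogeneous_X K i).mul hf.pderiv).mul hg.pderiv
  rw [detForm_apply, Matrix.det_fin_three]
  simp only [Matrix.of_apply, Matrix.cons_val]
  exact (((((h _ _ _).sub (h _ _ _)).sub (h _ _ _)).add (h _ _ _)).add (h _ _ _)).sub (h _ _ _)

theorem detForm_map {L : Type*} [Field L] (φ : K →+* L) (f g : MvPolynomial (Fin 3) K) :
    map φ (detForm K f g) = detForm L (map φ f) (map φ g) := by
  simp [detForm_apply, Matrix.det_fin_three, pderiv_map]

end Transvectant

/-! ### Nonvanishing of transvectants on the null cone. -/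

theorem rePow_map (μ : ℕ) :
    map (algebraMap ℝ ℂ) (rePow μ).1 + C Complex.I * map (algebraMap ℝ ℂ) (rePow μ).2 =
      linForm ![1, Complex.I, 0] ^ μ ∧
    map (algebraMap ℝ ℂ) (rePow μ).1 - C Complex.I * map (algebraMap ℝ ℂ) (rePow μ).2 =
      linForm ![1, -Complex.I, 0] ^ μ := by
  have hI : (C Complex.I * C Complex.I : MvPolynomial (Fin 3) ℂ) = -1 := by
    rw [← C_mul, Complex.I_mul_I, C_neg, C_1]
  induction μ with
  | zero => simp [rePow]
  | succ μ ih =>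
    rw [pow_succ', pow_succ', ← ih.1, ← ih.2]
    simp only [rePow, map_sub, map_add, map_mul, map_X, linForm, Fin.sum_univ_three,
      Matrix.cons_val, C_1, C_0, C_neg]
    generalize map (algebraMap ℝ ℂ) (rePow μ).1 = A
    generalize map (algebraMap ℝ ℂ) (rePow μ).2 = B
    constructor
    · linear_combination (-X 1 * B) * hI
    · linear_combination (-X 1 * B) * hI

theorem smul_mem_nullIdeal (a : ℝ) {f : MvPolynomial (Fin 3) ℝ} (hf : f ∈ nullIdeal) :
    a • f ∈ nullIdeal := by
  rw [smul_eq_C_mul]; exact nullIdeal.mul_mem_left _ hf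

/-- Powers of `x + iy` and `x - iy` are complex combinations of real harmonic forms. If all
transvectants of spherical harmonics were in the null ideal, the transvectant of these powers would
vanish at the null vector `(1, 0, i)`; there it is a nonzero multiple of the value assumed nonzero
in `hne`, since the coefficient vectors have product `2`. -/
theorem exists_transvect_notMem_nullIdeal
    {β : MvPolynomial (Fin 3) ℝ →ₗ[ℝ] MvPolynomial (Fin 3) ℝ →ₗ[ℝ] MvPolynomial (Fin 3) ℝ}
    {β' : MvPolynomial (Fin 3) ℂ →ₗ[ℂ] MvPolynomial (Fin 3) ℂ →ₗ[ℂ] MvPolynomial (Fin 3) ℂ}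
    (hβ : ∀ f g, map (algebraMap ℝ ℂ) (β f g) = β' (map (algebraMap ℝ ℂ) f) (map (algebraMap ℝ ℂ) g))
    {p q k : ℕ} (hp : k ≤ p) (hq : k ≤ q)
    (hne : eval ![1, 0, Complex.I] (β' (linForm ![1, Complex.I, 0] ^ (p - k))
      (linForm ![1, -Complex.I, 0] ^ (q - k))) ≠ 0) :
    ∃ i j, transvect β k (harmonicPoly p i) (harmonicPoly q j) ∉ nullIdeal := by
  by_contra! h
  have hall : ∀ f g : MvPolynomial (Fin 3) ℝ, f.IsHomogeneous p → laplacian f = 0 →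
      g.IsHomogeneous q → laplacian g = 0 →
      eval ![1, 0, Complex.I] (transvect β' k (map (algebraMap ℝ ℂ) f) (map (algebraMap ℝ ℂ) g)) =
        0 := by
    intro f g hf hf' hg hg'
    rw [← transvect_map _ hβ, eval_map, ← aeval_def]
    refine mem_nullIdeal.1 ?_ _ (by simp)
    obtain ⟨c, rfl⟩ := exists_eq_sum_harmonicPoly hf hf'
    obtain ⟨c', rfl⟩ := exists_eq_sum_harmonicPoly hg hg'
    rw [map_sum]
    refine sum_mem fun j _ => ?_
    rw [map_smul, map_sum, LinearMap.sum_apply]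
    refine smul_mem_nullIdeal _ (sum_mem fun i _ => ?_)
    rw [map_smul, LinearMap.smul_apply]
    exact smul_mem_nullIdeal _ (h i j)
  have h1 := rePow_isHomogeneous p
  have h2 := rePow_isHomogeneous q
  have h3 := laplacian_rePow p
  have h4 := laplacian_rePow q
  have key : eval ![1, 0, Complex.I] (transvect β' k (linForm ![1, Complex.I, 0] ^ p)
      (linForm ![1, -Complex.I, 0] ^ q)) = 0 := by
    rw [← (rePow_map p).1, ← (rePow_map q).2]
    simp only [C_mul', map_add, map_sub, map_smul, LinearMap.add_apply, LinearMap.smul_apply,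
      smul_eval, hall _ _ h1.1 h3.1 h2.1 h4.1, hall _ _ h1.1 h3.1 h2.2 h4.2,
      hall _ _ h1.2 h3.2 h2.1 h4.1, hall _ _ h1.2 h3.2 h2.2 h4.2]
    ring
  rw [transvect_linForm_pow, smul_eval] at key
  have hd : (![1, Complex.I, 0] : Fin 3 → ℂ) ⬝ᵥ ![1, -Complex.I, 0] = 2 := by
    simp [dotProduct, Fin.sum_univ_three]; norm_num
  have hpf : ((p.descFactorial k : ℕ) : ℂ) ≠ 0 := by
    rw [Nat.cast_ne_zero, Ne, Nat.descFactorial_eq_zero_iff_lt]; omega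
  have hqf : ((q.descFactorial k : ℕ) : ℂ) ≠ 0 := by
    rw [Nat.cast_ne_zero, Ne, Nat.descFactorial_eq_zero_iff_lt]; omega
  rw [hd] at key
  exact mul_ne_zero (mul_ne_zero (mul_ne_zero hpf hqf) (pow_ne_zero _ two_ne_zero)) hne key

/-! ### Existence of Clebsch-Gordan decompositions -/

theorem linSubst_harmonicPoly (ℓ : ℕ) (R : SO3) (j : Fin (2 * ℓ + 1)) :
    linSubst R.1 (harmonicPoly ℓ j) = ∑ k, wignerD ℓ R j k • harmonicPoly ℓ k := by
  refine MvPolynomial.funext fun x => ?_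
  rw [eval_linSubst, eval_harmonicPoly, sphericalHarmonic_mulVec]
  simp [Matrix.mulVec, dotProduct, eval_harmonicPoly, smul_eval]

theorem linSubst_mem_nullIdeal (R : SO3) {f : MvPolynomial (Fin 3) ℝ} (hf : f ∈ nullIdeal) :
    linSubst R.1 f ∈ nullIdeal := by
  intro w hw
  have h1 : aeval w (linSubst R.1 f) = aeval (fun i => ∑ j, (R.1 i j : ℂ) * w j) f := by
    rw [linSubst, ← AlgHom.comp_apply, comp_aeval]
    simp
  rw [h1]
  apply hf
  have hR' : ∀ j k, ∑ i, (R.1 i j : ℂ) * R.1 i k = if j = k then 1 else 0 := fun j k => by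
    have := congrFun (congrFun R.transpose_mul j) k
    rw [Matrix.mul_apply, Matrix.one_apply] at this
    simp only [Matrix.transpose_apply] at this
    have h3 := congrArg Complex.ofReal this
    rw [Complex.ofReal_sum] at h3
    simp only [Complex.ofReal_mul] at h3
    rw [h3]
    split_ifs <;> simp
  have h00 := hR' 0 0
  have h01 := hR' 0 1
  have h02 := hR' 0 2
  have h11 := hR' 1 1
  have h12 := hR' 1 2
  have h22 := hR' 2 2
  simp [Fin.sum_univ_three] at h00 h01 h02 h11 h12 h22 ⊢
  linear_combination hw + w 0 ^ 2 * h00 + w 1 ^ 2 * h11 + w 2 ^ 2 * h22 + 2 * w 0 * w 1 * h01 +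
    2 * w 0 * w 2 * h02 + 2 * w 1 * w 2 * h12

/-- The representation of `SO(3)` on `W_p ⊗ W_q`. -/
abbrev tensorRep (p q : ℕ) : Representation ℝ SO3 (Irrep p ⊗[ℝ] Irrep q) :=
  (irrepRep p).tprod (irrepRep q)

theorem tensorRep_tmul (p q : ℕ) (R : SO3) (v : Irrep p) (w : Irrep q) :
    tensorRep p q R (v ⊗ₜ[ℝ] w) = irrepRep p R v ⊗ₜ[ℝ] irrepRep q R w := rfl

theorem irrepRep_single (ℓ : ℕ) (R : SO3) (j : Fin (2 * ℓ + 1)) :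
    irrepRep ℓ R (Pi.single j 1) = ∑ i, wignerD ℓ R i j • (Pi.single i 1 : Irrep ℓ) := by
  rw [irrepRep_apply, Matrix.mulVec_single_one]
  conv_lhs => rw [pi_eq_sum_univ' (Matrix.col (wignerD ℓ R) j)]
  rfl

theorem eq_zero_of_sum_smul_single_tmul_single {p q : ℕ}
    (a : Fin (2 * p + 1) → Fin (2 * q + 1) → ℝ)
    (h : ∑ i, ∑ j, a i j • ((Pi.single i 1 : Irrep p) ⊗ₜ[ℝ] (Pi.single j 1 : Irrep q)) = 0)
    (i : Fin (2 * p + 1)) (j : Fin (2 * q + 1)) : a i j = 0 := by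
  set b := (Pi.basisFun ℝ (Fin (2 * p + 1))).tensorProduct (Pi.basisFun ℝ (Fin (2 * q + 1)))
  have hb := Fintype.linearIndependent_iff.1 b.linearIndependent (fun x => a x.1 x.2) (by
    rw [Fintype.sum_prod_type]
    simpa [b, Module.Basis.tensorProduct_apply] using h) (i, j)
  exact hb

theorem sum_sum_sum_comm {α β γ M : Type*} [Fintype α] [Fintype β] [Fintype γ] [AddCommMonoid M]
    (v : α → β → γ → M) : ∑ i, ∑ j, ∑ m, v i j m = ∑ m, ∑ i, ∑ j, v i j m := by
  rw [Finset.sum_comm (s := (Finset.univ : Finset γ))]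
  exact Finset.sum_congr rfl fun i _ => Finset.sum_comm

/-- Modulo the null ideal, `B(Y^p_i, Y^q_j) = ∑_m b_{ijm} Y^ℓ_m`. Invariance of `B` says that `(D^p
⊗ D^q) b = b D^ℓ`, so `b`, read as a map from `W_ℓ` into the tensor product, is an intertwiner.
Reading it in this direction avoids orthogonality of the Wigner matrices. -/
theorem exists_equivariant_of_bilinear {p q ℓ : ℕ}
    (B : MvPolynomial (Fin 3) ℝ →ₗ[ℝ] MvPolynomial (Fin 3) ℝ →ₗ[ℝ] MvPolynomial (Fin 3) ℝ)
    (hB : ∀ (R : SO3) f g, B (linSubst R.1 f) (linSubst R.1 g) = linSubst R.1 (B f g))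
    (hdeg : ∀ i j, (B (harmonicPoly p i) (harmonicPoly q j)).IsHomogeneous ℓ)
    (hne : ∃ i j, B (harmonicPoly p i) (harmonicPoly q j) ∉ nullIdeal) :
    ∃ Ψ : Irrep ℓ →ₗ[ℝ] Irrep p ⊗[ℝ] Irrep q, Ψ ≠ 0 ∧
      ∀ R w, Ψ (irrepRep ℓ R w) = tensorRep p q R (Ψ w) := by
  have hex : ∀ i j, ∃ b : Fin (2 * ℓ + 1) → ℝ,
      B (harmonicPoly p i) (harmonicPoly q j) - ∑ m, b m • harmonicPoly ℓ m ∈ nullIdeal := by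
    intro i j
    obtain ⟨b, q', -, -, h⟩ := exists_harmonic_decomposition (hdeg i j)
    refine ⟨b, ?_⟩
    rw [h, add_sub_cancel_left]
    exact nullIdeal.mul_mem_right _ normSqPoly_mem_nullIdeal
  choose b hb using hex
  have hrel : ∀ (R : SO3) i j m', ∑ i', ∑ j', wignerD p R i i' * wignerD q R j j' * b i' j' m' =
      ∑ m, b i j m * wignerD ℓ R m m' := by
    intro R i j m'
    have h1 := linSubst_mem_nullIdeal R (hb i j)
    rw [map_sub, ← hB, linSubst_harmonicPoly, linSubst_harmonicPoly] at h1
    simp only [map_sum, map_smul, LinearMap.sum_apply, LinearMap.smul_apply,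
      linSubst_harmonicPoly] at h1
    have h2 : ∑ i', ∑ j', (wignerD p R i i' * wignerD q R j j') •
        (B (harmonicPoly p i') (harmonicPoly q j') - ∑ m, b i' j' m • harmonicPoly ℓ m) ∈
          nullIdeal := sum_mem fun i' _ => sum_mem fun j' _ => smul_mem_nullIdeal _ (hb i' j')
    have h3 := sub_mem h1 h2
    have h4 : ∑ m', (∑ i', ∑ j', wignerD p R i i' * wignerD q R j j' * b i' j' m' -
        ∑ m, b i j m * wignerD ℓ R m m') • harmonicPoly ℓ m' ∈ nullIdeal := by
      convert h3 using 1
      simp only [smul_sub, sub_smul, Finset.sum_sub_distrib, Finset.sum_smul, Finset.smul_sum,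
        smul_smul]
      have e1 : ∀ v : Fin (2 * p + 1) → Fin (2 * q + 1) → MvPolynomial (Fin 3) ℝ,
          ∑ x, ∑ y, (wignerD q R j x * wignerD p R i y) • v y x =
            ∑ x, ∑ y, (wignerD p R i x * wignerD q R j y) • v x y := fun v => by
        rw [Finset.sum_comm]
        exact Finset.sum_congr rfl fun _ _ => Finset.sum_congr rfl fun _ _ => by rw [mul_comm]
      have e2 : ∑ m', ∑ i', ∑ j', (wignerD p R i i' * wignerD q R j j' * b i' j' m') •
          harmonicPoly ℓ m' = ∑ i', ∑ j', ∑ m', (wignerD p R i i' * wignerD q R j j' * b i' j' m') •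
            harmonicPoly ℓ m' := (sum_sum_sum_comm _).symm
      have e3 : ∑ m', ∑ m, (b i j m * wignerD ℓ R m m') • harmonicPoly ℓ m' =
          ∑ m, ∑ m', (b i j m * wignerD ℓ R m m') • harmonicPoly ℓ m' := Finset.sum_comm
      rw [e2, e3]
      rw [e1 (fun x y => B (harmonicPoly p x) (harmonicPoly q y))]
      abel
    have := congrFun (eq_zero_of_sum_mem_nullIdeal _ h4) m'
    exact sub_eq_zero.1 this
  let Ψ : Irrep ℓ →ₗ[ℝ] Irrep p ⊗[ℝ] Irrep q :=
    ∑ i, ∑ j, (∑ m, b i j m • LinearMap.proj (φ := fun _ : Fin (2 * ℓ + 1) => ℝ) m).smulRight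
      ((Pi.single i 1 : Irrep p) ⊗ₜ[ℝ] (Pi.single j 1 : Irrep q))
  have hΨ : ∀ w, Ψ w = ∑ i, ∑ j, (∑ m, b i j m * w m) •
      ((Pi.single i 1 : Irrep p) ⊗ₜ[ℝ] (Pi.single j 1 : Irrep q)) := fun w => by
    simp [Ψ, LinearMap.sum_apply]
  refine ⟨Ψ, fun h0 => ?_, fun R w => ?_⟩
  · obtain ⟨i, j, hij⟩ := hne
    refine hij ?_
    have hb0 : ∀ m, b i j m = 0 := fun m => by
      have h1 := hΨ (Pi.single m 1)
      rw [h0, LinearMap.zero_apply] at h1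
      have := eq_zero_of_sum_smul_single_tmul_single _ h1.symm i j
      simpa [Pi.single_apply] using this
    simpa [hb0] using hb i j
  · rw [hΨ, hΨ]
    simp only [map_sum, map_smul, tensorRep_tmul, irrepRep_single, TensorProduct.sum_tmul,
      TensorProduct.tmul_sum, TensorProduct.smul_tmul_smul, Finset.smul_sum, smul_smul]
    have e : ∀ (v : Fin (2 * p + 1) → Fin (2 * q + 1) → Fin (2 * q + 1) → Fin (2 * p + 1) →
        Irrep p ⊗[ℝ] Irrep q),
        ∑ i', ∑ j', ∑ j, ∑ i, v i' j' j i = ∑ i, ∑ j, ∑ i', ∑ j', v i' j' j i := fun v => by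
      rw [sum_sum_sum_comm, Finset.sum_comm (t := (Finset.univ : Finset (Fin (2 * q + 1))))]
      exact Finset.sum_congr rfl fun j _ => sum_sum_sum_comm _
    rw [e]
    simp only [← Finset.sum_smul]
    refine Finset.sum_congr rfl fun i _ => Finset.sum_congr rfl fun j _ => ?_
    congr 1
    have h1 : ∀ i' j', (∑ m, b i' j' m * w m) * (wignerD p R i i' * wignerD q R j j') =
        ∑ m, w m * (wignerD p R i i' * wignerD q R j j' * b i' j' m) := fun i' j' => by
      rw [Finset.sum_mul]
      exact Finset.sum_congr rfl fun m _ => by ring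
    simp only [h1]
    rw [sum_sum_sum_comm]
    simp only [← Finset.mul_sum]
    simp only [hrel]
    simp only [irrepRep_apply, Matrix.mulVec, dotProduct, Finset.mul_sum]
    rw [Finset.sum_comm]
    exact Finset.sum_congr rfl fun _ _ => Finset.sum_congr rfl fun _ _ => by ring

theorem exists_equivariant_embedding {p q ℓ : ℕ}
    (hℓ : ℓ ∈ Finset.Icc (max p q - min p q) (p + q)) :
    ∃ Ψ : Irrep ℓ →ₗ[ℝ] Irrep p ⊗[ℝ] Irrep q, Ψ ≠ 0 ∧
      ∀ R w, Ψ (irrepRep ℓ R w) = tensorRep p q R (Ψ w) := by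
  rw [Finset.mem_Icc] at hℓ
  -- Contracting `k` pairs of derivatives lowers the total degree by `2k`, and the determinant form
  -- lowers it by one more, so the parity of `p + q - ℓ` selects the bilinear form. The lower bound
  -- on `ℓ` gives `k ≤ min p q`.
  obtain ⟨k, hk | hk⟩ := Nat.even_or_odd' (p + q - ℓ)
  · refine exists_equivariant_of_bilinear (transvect (LinearMap.mul ℝ _) k)
      (fun R => transvect_linSubst R.mul_transpose (fun f g => ?_) k) (fun i j => ?_) ?_
    · simp
    · have := transvect_isHomogeneous (β := LinearMap.mul ℝ (MvPolynomial (Fin 3) ℝ))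
        (d := fun a b => a + b) (fun _ _ f g hf hg => hf.mul hg) k
        (harmonicPoly_isHomogeneous p i) (harmonicPoly_isHomogeneous q j)
      rwa [show p - k + (q - k) = ℓ by omega] at this
    · refine exists_transvect_notMem_nullIdeal (β' := LinearMap.mul ℂ _) (fun f g => by simp)
        (show k ≤ p by omega) (show k ≤ q by omega) ?_
      simp [eval_linForm]
  · refine exists_equivariant_of_bilinear (transvect (detForm ℝ) k)
      (fun R => transvect_linSubst R.mul_transpose
        (detForm_linSubst R.transpose_mul R.2.2) k) (fun i j => ?_) ?_
    · have := transvect_isHomogeneous detForm_isHomogeneous k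
        (harmonicPoly_isHomogeneous p i) (harmonicPoly_isHomogeneous q j)
      rwa [show 1 + (p - k - 1) + (q - k - 1) = ℓ by omega] at this
    · refine exists_transvect_notMem_nullIdeal (detForm_map _)
        (show k ≤ p by omega) (show k ≤ q by omega) ?_
      have hp : ((p - k : ℕ) : ℂ) ≠ 0 := by rw [Nat.cast_ne_zero]; omega
      have hq : ((q - k : ℕ) : ℂ) ≠ 0 := by rw [Nat.cast_ne_zero]; omega
      simp only [detForm_apply, Matrix.det_fin_three, Matrix.of_apply, Matrix.cons_val,
        pderiv_linForm_pow, map_sub, map_add, map_mul, smul_eval, map_pow, eval_linForm, eval_X]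
      simp [dotProduct, Fin.sum_univ_three]
      ring_nf
      simp [hp, hq]

theorem continuous_tensorRep_inv {p q : ℕ} {E : Type*} [NormedAddCommGroup E] [NormedSpace ℝ E]
    (L : Irrep p ⊗[ℝ] Irrep q →ₗ[ℝ] E) (t : Irrep p ⊗[ℝ] Irrep q) :
    Continuous fun R : SO3 => L (tensorRep p q R⁻¹ t) := by
  induction t using TensorProduct.induction_on with
  | zero => simp only [map_zero]; exact continuous_const
  | add x y hx hy => simp only [map_add]; exact hx.add hy
  | tmul v w =>
    have h : ∀ R : SO3, L (tensorRep p q R⁻¹ (v ⊗ₜ[ℝ] w)) = ∑ i, ∑ j,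
        (irrepRep p R⁻¹ v i * irrepRep q R⁻¹ w j) •
          L ((Pi.single i 1 : Irrep p) ⊗ₜ[ℝ] (Pi.single j 1 : Irrep q)) := fun R => by
      rw [tensorRep_tmul]
      conv_lhs => rw [pi_eq_sum_univ' (irrepRep p R⁻¹ v), pi_eq_sum_univ' (irrepRep q R⁻¹ w)]
      simp only [TensorProduct.sum_tmul, TensorProduct.tmul_sum, TensorProduct.smul_tmul_smul,
        map_sum, map_smul]
      rw [Finset.sum_comm]
    simp only [h]
    have hc : ∀ (ℓ : ℕ) (u : Irrep ℓ) i, Continuous fun R : SO3 => irrepRep ℓ R⁻¹ u i :=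
      fun ℓ u i => (continuous_apply i).comp
        (continuous_irrepRep_apply continuous_inv continuous_const)
    exact continuous_finsetSum _ fun i _ => continuous_finsetSum _ fun j _ =>
      ((hc p v i).mul (hc q w j)).smul continuous_const

/-- Irreducibility makes `Ψ` injective. Averaging any left inverse over the group makes it
equivariant, and equivariance of `Ψ` keeps it a left inverse. -/
theorem exists_equivariant_leftInverse {p q ℓ : ℕ} (Ψ : Irrep ℓ →ₗ[ℝ] Irrep p ⊗[ℝ] Irrep q)
    (h0 : Ψ ≠ 0) (hΨ : ∀ R w, Ψ (irrepRep ℓ R w) = tensorRep p q R (Ψ w)) :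
    ∃ Θ : Irrep p ⊗[ℝ] Irrep q →ₗ[ℝ] Irrep ℓ, (∀ w, Θ (Ψ w) = w) ∧
      ∀ R t, Θ (tensorRep p q R t) = irrepRep ℓ R (Θ t) := by
  obtain ⟨L, hL⟩ := LinearMap.exists_leftInverse_of_injective Ψ
    (ker_eq_bot_of_equivariant (tensorRep p q) Ψ hΨ h0)
  have hcont : ∀ t, Continuous fun R => (irrepRep ℓ R ∘ₗ L ∘ₗ tensorRep p q R⁻¹) t := fun t =>
    continuous_irrepRep_apply continuous_id (continuous_tensorRep_inv L t)
  refine ⟨averageLinear _ hcont, fun w => ?_, fun R t =>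
    averageLinear_conj_equivariant (tensorRep p q) (irrepRep ℓ) L hcont R t⟩
  rw [averageLinear_apply]
  have : ∀ R, (irrepRep ℓ R ∘ₗ L ∘ₗ tensorRep p q R⁻¹) (Ψ w) = w := fun R => by
    simp only [LinearMap.comp_apply]
    rw [← hΨ, ← LinearMap.comp_apply L Ψ, hL, LinearMap.id_apply, ← Module.End.mul_apply, ← map_mul,
      mul_inv_cancel, map_one, Module.End.one_apply]
  simp only [this]
  simp

theorem sum_Icc_two_mul_add_one (p q : ℕ) :
    ∑ ℓ ∈ Finset.Icc (max p q - min p q) (p + q), (2 * ℓ + 1) = (2 * p + 1) * (2 * q + 1) := by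
  have h : ∀ a b : ℕ, ∑ ℓ ∈ Finset.Icc a (a + b), (2 * ℓ + 1) = (b + 1) * (2 * a + b + 1) := by
    intro a b
    induction b with
    | zero => simp
    | succ b ih =>
      rw [← Nat.add_assoc, Finset.sum_Icc_succ_top (by omega), ih]
      ring
  rcases le_total p q with hpq | hpq
  · obtain ⟨r, rfl⟩ := Nat.exists_eq_add_of_le hpq
    rw [max_eq_right hpq, min_eq_left hpq, show p + r - p = r by omega,
      show p + (p + r) = r + 2 * p by ring, h]
    ring
  · obtain ⟨r, rfl⟩ := Nat.exists_eq_add_of_le hpq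
    rw [max_eq_left hpq, min_eq_right hpq, show q + r - q = r by omega,
      show q + r + q = r + 2 * q by ring, h]
    ring

/-- The embeddings for different `ℓ` are independent because `Θ ℓ ∘ₗ Ψ ℓ'` vanishes for `ℓ ≠ ℓ'`.
Since the numbers `2ℓ + 1` add up to `(2p + 1)(2q + 1)`, their sum is an isomorphism. -/
theorem exists_clebschGordan (p q : ℕ) :
    ∃ U : (Irrep p ⊗[ℝ] Irrep q) ≃ₗ[ℝ]
      ((ℓ : Finset.Icc (max p q - min p q) (p + q)) → Irrep ℓ),
      ∀ (R : SO3) (v : Irrep p) (w : Irrep q)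
        (ℓ : Finset.Icc (max p q - min p q) (p + q)),
        U ((wignerD p R).mulVec v ⊗ₜ[ℝ] (wignerD q R).mulVec w) ℓ =
          (wignerD ℓ R).mulVec (U (v ⊗ₜ[ℝ] w) ℓ) := by
  choose Ψ h0 hΨ using fun ℓ : Finset.Icc (max p q - min p q) (p + q) =>
    exists_equivariant_embedding ℓ.2
  choose Θ hΘΨ hΘ using fun ℓ => exists_equivariant_leftInverse (Ψ ℓ) (h0 ℓ) (hΨ ℓ)
  let Φ : ((ℓ : Finset.Icc (max p q - min p q) (p + q)) → Irrep ℓ) →ₗ[ℝ] Irrep p ⊗[ℝ] Irrep q :=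
    ∑ ℓ, Ψ ℓ ∘ₗ LinearMap.proj ℓ
  have hΦ : ∀ w, Φ w = ∑ ℓ, Ψ ℓ (w ℓ) := fun w => by simp [Φ, LinearMap.sum_apply]
  have hinj : Function.Injective Φ := by
    rw [injective_iff_map_eq_zero]
    intro w hw
    funext ℓ
    have h1 := congrArg (Θ ℓ) hw
    rw [hΦ, map_sum, map_zero, Finset.sum_eq_single ℓ, hΘΨ] at h1
    · exact h1
    · intro ℓ' _ hne
      have : Θ ℓ ∘ₗ Ψ ℓ' = 0 := eq_zero_of_equivariant_of_ne (fun h => hne (Subtype.ext h)) _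
        fun R w => by rw [LinearMap.comp_apply, hΨ, hΘ, LinearMap.comp_apply]
      exact LinearMap.congr_fun this _
    · simp
  have hdim : Module.finrank ℝ
      ((ℓ : Finset.Icc (max p q - min p q) (p + q)) → Irrep ℓ) =
        Module.finrank ℝ (Irrep p ⊗[ℝ] Irrep q) := by
    rw [Module.finrank_tensorProduct, Module.finrank_pi_fintype]
    simp only [Module.finrank_fin_fun]
    rw [Finset.sum_coe_sort (Finset.Icc (max p q - min p q) (p + q)) fun ℓ => 2 * ℓ + 1,
      sum_Icc_two_mul_add_one]
  let e := LinearEquiv.ofInjectiveOfFinrankEq Φ hinj hdim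
  have he : ∀ w, e w = Φ w := fun w => rfl
  refine ⟨e.symm, fun R v w ℓ => ?_⟩
  have h1 : e.symm ((wignerD p R).mulVec v ⊗ₜ[ℝ] (wignerD q R).mulVec w) =
      fun ℓ : Finset.Icc (max p q - min p q) (p + q) =>
        irrepRep ℓ R (e.symm (v ⊗ₜ[ℝ] w) ℓ) := by
    rw [LinearEquiv.symm_apply_eq, he, hΦ]
    simp only [hΨ]
    rw [← map_sum, ← hΦ, ← he, LinearEquiv.apply_symm_apply]
    rfl
  rw [h1]
  rfl

theorem nonempty_clebschGordan : Nonempty ClebschGordan := by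
  choose U hU using exists_clebschGordan
  exact ⟨⟨U, hU⟩⟩

/-! ### Filters whose components span the homogeneous polynomials of a given degree -/

/-- The parameters of a convolution layer whose filter is `(‖x‖^(r-ℓ) Y^ℓ(x))_ℓ`, for `ℓ ≤ r` of the
same parity as `r`. -/
def radialParams {D : ℕ} (r : Fin (D + 1)) : ConvParams D where
  θ₀ := 0
  radial ℓ := if ℓ ≤ r ∧ Even ((r : ℕ) - ℓ) then Polynomial.X ^ (r : ℕ) else 0
  radial_degree ℓ := by
    split_ifs
    · rw [Polynomial.natDegree_X_pow]; omega
    · simp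

theorem euclNorm_sq (x : Fin 3 → ℝ) : euclNorm x ^ 2 = x 0 ^ 2 + x 1 ^ 2 + x 2 ^ 2 := by
  rw [euclNorm, EuclideanSpace.norm_sq_eq]
  simp [Fin.sum_univ_three]

theorem euclNorm_smul_unitVec (x : Fin 3 → ℝ) : euclNorm x • unitVec x = x := by
  by_cases h : euclNorm x = 0
  · have hx : x = 0 := by
      rw [euclNorm, norm_eq_zero] at h
      exact congrArg WithLp.ofLp h
    simp [hx, unitVec]
  · rw [unitVec, smul_smul, mul_inv_cancel₀ h, one_smul]

theorem convFilter_radialParams {D : ℕ} {r : Fin (D + 1)} {ℓ : Fin (D + 1)} (h : ℓ ≤ r)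
    (h' : Even ((r : ℕ) - ℓ)) (x : Fin 3 → ℝ) :
    convFilter (radialParams r) x ℓ = euclNorm x ^ ((r : ℕ) - ℓ) • sphericalHarmonic ℓ x := by
  conv_rhs => rw [← euclNorm_smul_unitVec x, sphericalHarmonic_smul, smul_smul,
    euclNorm_smul_unitVec]
  rw [← pow_add, Nat.sub_add_cancel (Fin.le_def.1 h)]
  simp [convFilter, radialParams, h, h']
  rfl

/-- Induction through the harmonic decomposition: the harmonic part is read from component `d` of
the filter, and the factor `‖x‖²` of the remainder is absorbed into the power of the norm,
preserving parity. The case `d = r` is the goal. -/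
theorem exists_filter_functional {D : ℕ} (r : Fin (D + 1)) {d : ℕ} (hd : d ≤ r)
    (hpar : Even ((r : ℕ) - d)) {q : MvPolynomial (Fin 3) ℝ} (hq : q.IsHomogeneous d) :
    ∃ κ : W (filterDegrees D).deg →ₗ[ℝ] ℝ, ∀ x,
      euclNorm x ^ ((r : ℕ) - d) * eval x q = κ (convFilter (radialParams r) x) := by
  induction d using Nat.strong_induction_on generalizing q with
  | _ d ih =>
    obtain ⟨c, q', h1, h2, rfl⟩ := exists_harmonic_decomposition hq
    have hq' : ∃ κ : W (filterDegrees D).deg →ₗ[ℝ] ℝ, ∀ x,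
        euclNorm x ^ ((r : ℕ) - d) * eval x (normSqPoly * q') =
          κ (convFilter (radialParams r) x) := by
      by_cases hd2 : d < 2
      · exact ⟨0, fun x => by simp [h2 hd2]⟩
      · obtain ⟨κ, hκ⟩ := ih (d - 2) (by omega) (by omega)
          (by rw [show (r : ℕ) - (d - 2) = (r - d) + 2 by omega]; exact hpar.add even_two) h1
        refine ⟨κ, fun x => ?_⟩
        rw [← hκ, show (r : ℕ) - (d - 2) = (r - d) + 2 by omega, pow_add, euclNorm_sq]
        simp [normSqPoly]
        ring
    obtain ⟨κ, hκ⟩ := hq'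
    let ℓ : Fin (D + 1) := ⟨d, by omega⟩
    let κ' : W (filterDegrees D).deg →ₗ[ℝ] ℝ :=
      (∑ j, c j • LinearMap.proj (φ := fun _ : Fin (2 * d + 1) => ℝ) j) ∘ₗ
        LinearMap.proj (φ := fun ℓ : Fin (D + 1) => Irrep ℓ) ℓ
    refine ⟨κ' + κ, fun x => ?_⟩
    rw [map_add, mul_add, hκ, LinearMap.add_apply]
    congr 1
    have h3 := convFilter_radialParams (r := r) (ℓ := ℓ) (Fin.le_def.2 hd) hpar x
    have h4 : κ' (convFilter (radialParams r) x) =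
        ∑ j, c j * (convFilter (radialParams r) x ℓ) j := by
      have hgen : ∀ v : Irrep d, (∑ j, c j • LinearMap.proj (φ := fun _ : Fin (2 * d + 1) => ℝ) j :
          Irrep d →ₗ[ℝ] ℝ) v = ∑ j, c j * v j := fun v => by simp [LinearMap.sum_apply]
      exact hgen _
    rw [h4, h3]
    simp only [map_sum, smul_eval, eval_harmonicPoly, Finset.mul_sum]
    exact Finset.sum_congr rfl fun j _ => by simp only [Pi.smul_apply, smul_eq_mul, ℓ]; ring

/-- The product of a multiset of linear forms. -/
def formProd {V : Type*} [AddCommGroup V] [Module ℝ V] (s : Multiset (V →ₗ[ℝ] ℝ)) (v : V) : ℝ :=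
  (s.map fun φ => φ v).prod

theorem multiset_prod_isHomogeneous {α : Type*} (s : Multiset α)
    {f : α → MvPolynomial (Fin 3) ℝ} (hf : ∀ φ, (f φ).IsHomogeneous 1) :
    ((s.map f).prod).IsHomogeneous (Multiset.card s) := by
  induction s using Multiset.induction_on with
  | empty => simpa using isHomogeneous_one (Fin 3) ℝ
  | cons φ s ih =>
    rw [Multiset.map_cons, Multiset.prod_cons, Multiset.card_cons, add_comm]
    exact (hf φ).mul ih

theorem exists_filter_functional_formProd {D : ℕ} (s : Multiset ((Fin 3 → ℝ) →ₗ[ℝ] ℝ))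
    (r : Fin (D + 1)) (hs : Multiset.card s = r) :
    ∃ κ : W (filterDegrees D).deg →ₗ[ℝ] ℝ, ∀ x,
      formProd s x = κ (convFilter (radialParams r) x) := by
  let q : MvPolynomial (Fin 3) ℝ := (s.map fun φ => linForm fun i => φ (Pi.single i 1)).prod
  have hq : q.IsHomogeneous r := by
    rw [← hs]
    exact multiset_prod_isHomogeneous s fun φ =>
      IsHomogeneous.sum _ _ _ fun j _ => (isHomogeneous_X ℝ j).C_mul _
  obtain ⟨κ, hκ⟩ := exists_filter_functional r le_rfl (by simp) hq
  refine ⟨κ, fun x => ?_⟩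
  rw [← hκ, Nat.sub_self, pow_zero, one_mul]
  simp only [q, map_multiset_prod, Multiset.map_map, Function.comp_def, eval_linForm, formProd]
  congr 1
  refine Multiset.map_congr rfl fun φ _ => ?_
  conv_lhs => rw [pi_eq_sum_univ' x]
  simp [dotProduct, mul_comm]

/-! ### The functions computed by the convolution layers -/

/-- Invert the blocks one by one and reassemble. Consequently every functional on the tensor product
is still a functional of the layer's output. -/
theorem ClebschGordan.exists_leftInverse (U : ClebschGordan) (l₁ l₂ : Degrees) [Finite l₁.ι]
    [Finite l₂.ι] : ∃ L : W (tensorDegrees l₁ l₂).deg →ₗ[ℝ] W l₁.deg ⊗[ℝ] W l₂.deg,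
      ∀ t, L (U.map l₁ l₂ t) = t := by
  classical
  have := Fintype.ofFinite l₁.ι
  have := Fintype.ofFinite l₂.ι
  let B : (p : l₁.ι × l₂.ι) → W (tensorDegrees l₁ l₂).deg →ₗ[ℝ]
      ((ℓ : Finset.Icc (max (l₁.deg p.1) (l₂.deg p.2) - min (l₁.deg p.1) (l₂.deg p.2))
        (l₁.deg p.1 + l₂.deg p.2)) → Irrep ℓ) := fun p =>
    LinearMap.pi fun ℓ => LinearMap.proj (φ := fun q => Irrep ((tensorDegrees l₁ l₂).deg q)) ⟨p, ℓ⟩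
  let L : W (tensorDegrees l₁ l₂).deg →ₗ[ℝ] W l₁.deg ⊗[ℝ] W l₂.deg := ∑ p : l₁.ι × l₂.ι,
    (TensorProduct.map (LinearMap.single ℝ (fun i => Irrep (l₁.deg i)) p.1)
      (LinearMap.single ℝ (fun i => Irrep (l₂.deg i)) p.2)) ∘ₗ
      (U.U (l₁.deg p.1) (l₂.deg p.2)).symm.toLinearMap ∘ₗ B p
  have h : L ∘ₗ U.map l₁ l₂ = LinearMap.id := by
    refine TensorProduct.ext' fun v w => ?_
    have hB : ∀ p, B p (U.map l₁ l₂ (v ⊗ₜ[ℝ] w)) =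
        U.U (l₁.deg p.1) (l₂.deg p.2) (v p.1 ⊗ₜ[ℝ] w p.2) := fun p => rfl
    rw [LinearMap.comp_apply, LinearMap.sum_apply]
    simp only [LinearMap.comp_apply, hB, LinearEquiv.coe_coe, LinearEquiv.symm_apply_apply,
      TensorProduct.map_tmul, LinearMap.id_apply]
    rw [Fintype.sum_prod_type]
    conv_rhs => rw [← Finset.univ_sum_single v, ← Finset.univ_sum_single w, TensorProduct.sum_tmul]
    refine Finset.sum_congr rfl fun i _ => ?_
    rw [TensorProduct.tmul_sum]
    rfl
  exact ⟨L, LinearMap.congr_fun h⟩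

instance (D J : ℕ) : Finite (featDegrees D J).ι := by
  induction J with
  | zero => exact inferInstanceAs (Finite Unit)
  | succ J ih =>
    have : Finite (filterDegrees D).ι := inferInstanceAs (Finite (Fin (D + 1)))
    exact inferInstanceAs (Finite (Σ p : (filterDegrees D).ι × (featDegrees D J).ι,
      Finset.Icc (max ((filterDegrees D).deg p.1) ((featDegrees D J).deg p.2) -
        min ((filterDegrees D).deg p.1) ((featDegrees D J).deg p.2))
      ((filterDegrees D).deg p.1 + (featDegrees D J).deg p.2)))

/-- The features after `J` layers with filters of degrees `r 0, …, r (J - 1)`. -/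
def chainFeature (U : ClebschGordan) {D n : ℕ} (r : ℕ → Fin (D + 1)) (J : ℕ) (X : PointCloud n)
    (a : Fin n) : W (featDegrees D J).deg :=
  (forward U (fun j => radialParams (r j)) J X).2 a

theorem forward_fst (U : ClebschGordan) {D n : ℕ} (P : ℕ → ConvParams D) (J : ℕ)
    (X : PointCloud n) : (forward U P J X).1 = X := by
  induction J with
  | zero => rfl
  | succ J ih => exact ih

theorem chainFeature_succ (U : ClebschGordan) {D n : ℕ} (r : ℕ → Fin (D + 1)) (J : ℕ)
    (X : PointCloud n) (a : Fin n) :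
    chainFeature U r (J + 1) X a = U.map (filterDegrees D) (featDegrees D J)
      (∑ b, convFilter (radialParams (r J)) (X a - X b) ⊗ₜ[ℝ] chainFeature U r J X b) := by
  simp only [chainFeature, forward, convLayer, forward_fst]
  congr 1
  rw [show (radialParams (r J)).θ₀ = 0 from rfl, zero_smul, zero_add]

theorem chainFeature_congr (U : ClebschGordan) {D n : ℕ} {r r' : ℕ → Fin (D + 1)} {J : ℕ}
    (h : ∀ j < J, r j = r' j) (X : PointCloud n) (a : Fin n) :
    chainFeature U r J X a = chainFeature U r' J X a := by
  induction J generalizing a with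
  | zero => rfl
  | succ J ih =>
    rw [chainFeature_succ, chainFeature_succ, h J (by omega)]
    simp only [ih fun j hj => h j (by omega)]
    rfl

/-- The span of the functions computed by linear functionals of the features after `J` layers. -/
def chainSpan (U : ClebschGordan) (D n J : ℕ) : Submodule ℝ (Fin n → PointCloud n → ℝ) :=
  Submodule.span ℝ {h | ∃ (r : ℕ → Fin (D + 1)) (κ : W (featDegrees D J).deg →ₗ[ℝ] ℝ),
    h = fun a X => κ (chainFeature U r J X a)}

/-- One more layer: the readout is `κ' ⊗ κ` composed with the left inverse of the Clebsch–Gordan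
map, where `κ'` extracts the product of linear forms from the filter and `κ` computes `h`. -/
theorem sum_formProd_mul_mem_chainSpan (U : ClebschGordan) {D n J : ℕ}
    {h : Fin n → PointCloud n → ℝ} (hh : h ∈ chainSpan U D n J)
    (s : Multiset ((Fin 3 → ℝ) →ₗ[ℝ] ℝ)) (hs : Multiset.card s ≤ D) :
    (fun a X => ∑ b, formProd s (X a - X b) * h b X) ∈ chainSpan U D n (J + 1) := by
  induction hh using Submodule.span_induction with
  | mem h hh =>
    obtain ⟨r, κ, rfl⟩ := hh
    have : Finite (filterDegrees D).ι := inferInstanceAs (Finite (Fin (D + 1)))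
    obtain ⟨L, hL⟩ := U.exists_leftInverse (filterDegrees D) (featDegrees D J)
    obtain ⟨κ', hκ'⟩ := exists_filter_functional_formProd s
      (⟨Multiset.card s, by omega⟩ : Fin (D + 1)) rfl
    -- The first `J` layers use only `r 0, …, r (J - 1)`, so the filter degree at index `J` is free.
    refine Submodule.subset_span ⟨Function.update r J ⟨Multiset.card s, by omega⟩,
      LinearMap.mul' ℝ ℝ ∘ₗ TensorProduct.map κ' κ ∘ₗ L, ?_⟩
    funext a X
    rw [chainFeature_succ]
    change _ = LinearMap.mul' ℝ ℝ (TensorProduct.map κ' κ (L (U.map _ _ _)))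
    rw [hL, Function.update_self, map_sum, map_sum]
    refine Finset.sum_congr rfl fun b _ => ?_
    rw [TensorProduct.map_tmul, LinearMap.mul'_apply, ← hκ', chainFeature_congr U (fun j hj => ?_)]
    rw [Function.update_of_ne hj.ne]
  | zero =>
    convert Submodule.zero_mem _ using 1
    funext a X
    simp
  | add f g _ _ hf hg =>
    convert Submodule.add_mem _ hf hg using 1
    funext a X
    simp [mul_add, Finset.sum_add_distrib]
  | smul c f _ hf =>
    convert Submodule.smul_mem _ c hf using 1
    funext a X
    simp only [Pi.smul_apply, smul_eq_mul, Finset.mul_sum]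
    exact Finset.sum_congr rfl fun b _ => by ring

theorem sum_multiset_sum_map {α β M : Type*} [AddCommMonoid M] (s : Finset α) (T : Multiset β)
    (F : α → β → M) : ∑ x ∈ s, (T.map (F x)).sum = (T.map fun t => ∑ x ∈ s, F x t).sum :=
  Multiset.sum_map_sum_map s.1 T

/-- Routing all differences through `b₀` splits each linear form into a part in `x_a - x_{b₀}` and a
part in the `x_{b₀} - x_{b_i}`. Expanding the product leaves a convolution over `b₀` applied to sums
of the same kind with one index fewer; degrees only split, so they never exceed `D`. -/
theorem sum_formProd_mem_chainSpan (U : ClebschGordan) {D n J : ℕ}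
    (s : Multiset ((Fin J → Fin 3 → ℝ) →ₗ[ℝ] ℝ)) (hs : Multiset.card s ≤ D) :
    (fun a X => ∑ b : Fin J → Fin n, formProd s fun i => X a - X (b i)) ∈ chainSpan U D n J := by
  induction J with
  | zero =>
    refine Submodule.subset_span ⟨fun _ => 0, formProd s 0 •
      (LinearMap.proj (φ := fun _ : Fin (2 * 0 + 1) => ℝ) 0 ∘ₗ
        LinearMap.proj (φ := fun _ : Unit => Irrep 0) ()), ?_⟩
    funext a X
    rw [Fintype.sum_unique, Subsingleton.elim (fun i => X a - X (_ : Fin n)) (0 : Fin 0 → Fin 3 → ℝ)]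
    exact (mul_one _).symm
  | succ J ih =>
    let α : ((Fin (J + 1) → Fin 3 → ℝ) →ₗ[ℝ] ℝ) → ((Fin 3 → ℝ) →ₗ[ℝ] ℝ) := fun φ =>
      φ ∘ₗ LinearMap.pi fun _ => LinearMap.id
    -- The zeroth slot receives `0` because `x_{b₀} - x_{b₀} = 0`.
    let β : ((Fin (J + 1) → Fin 3 → ℝ) →ₗ[ℝ] ℝ) → ((Fin J → Fin 3 → ℝ) →ₗ[ℝ] ℝ) := fun φ =>
      φ ∘ₗ LinearMap.pi (Fin.cons 0 fun i => LinearMap.proj i)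
    have hφ : ∀ (φ : (Fin (J + 1) → Fin 3 → ℝ) →ₗ[ℝ] ℝ) (X : PointCloud n) (a b₀ : Fin n)
        (b : Fin J → Fin n), φ (fun i => X a - X ((Fin.cons b₀ b : Fin (J + 1) → Fin n) i)) =
          α φ (X a - X b₀) + β φ (fun i => X b₀ - X (b i)) := by
      intro φ X a b₀ b
      simp only [α, β, LinearMap.comp_apply]
      rw [← map_add]
      congr 1
      funext i
      refine Fin.cases ?_ (fun i => ?_) i <;> simp
    have key : (fun (a : Fin n) (X : PointCloud n) =>
        ∑ b : Fin (J + 1) → Fin n, formProd s fun i => X a - X (b i)) =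
        (s.antidiagonal.map fun p => fun (a : Fin n) (X : PointCloud n) =>
          ∑ b₀, formProd (p.1.map α) (X a - X b₀) *
            ∑ b : Fin J → Fin n, formProd (p.2.map β) fun i => X b₀ - X (b i)).sum := by
      funext a X
      have hsum : ∀ (T : Multiset (Multiset ((Fin (J + 1) → Fin 3 → ℝ) →ₗ[ℝ] ℝ) ×
          Multiset ((Fin (J + 1) → Fin 3 → ℝ) →ₗ[ℝ] ℝ)))
          (F : _ → Fin n → PointCloud n → ℝ), (T.map F).sum a X = (T.map fun p => F p a X).sum := by
        intro T F
        induction T using Multiset.induction_on with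
        | empty => simp
        | cons x T ih => simp [ih]
      rw [hsum, ← Fintype.sum_equiv (Fin.consEquiv fun _ => Fin n)
        (fun x : Fin n × (Fin J → Fin n) => formProd s fun i =>
          X a - X ((Fin.cons x.1 x.2 : Fin (J + 1) → Fin n) i)) _ (fun x => rfl),
        Fintype.sum_prod_type]
      simp only [Finset.mul_sum]
      simp only [formProd, hφ, Multiset.prod_map_add, Multiset.map_map, Function.comp_def,
        sum_multiset_sum_map]
    rw [key]
    refine multiset_sum_mem _ fun h hh => ?_
    obtain ⟨p, hp, rfl⟩ := Multiset.mem_map.1 hh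
    have hcard : Multiset.card p.1 + Multiset.card p.2 = Multiset.card s := by
      rw [← Multiset.card_add, Multiset.mem_antidiagonal.1 hp]
    exact sum_formProd_mul_mem_chainSpan U
      (ih (p.2.map β) (by rw [Multiset.card_map]; omega)) _ (by rw [Multiset.card_map]; omega)

/-! ### Symmetrized products of linear forms -/

section FormProd

variable {V : Type*} [AddCommGroup V] [Module ℝ V]

theorem formProd_zero_left (v : V) : formProd 0 v = 1 := by simp [formProd]

theorem formProd_zero_right {s : Multiset (V →ₗ[ℝ] ℝ)} (hs : s ≠ 0) : formProd s (0 : V) = 0 := by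
  obtain ⟨φ, hφ⟩ := Multiset.exists_mem_of_ne_zero hs
  exact Multiset.prod_eq_zero (Multiset.mem_map.2 ⟨φ, hφ, map_zero φ⟩)

theorem formProd_add_left (s t : Multiset (V →ₗ[ℝ] ℝ)) (v : V) :
    formProd (s + t) v = formProd s v * formProd t v := by simp [formProd]

theorem formProd_sum_left {ι : Type*} (S : Finset ι) (s : ι → Multiset (V →ₗ[ℝ] ℝ)) (v : V) :
    formProd (∑ i ∈ S, s i) v = ∏ i ∈ S, formProd (s i) v := by
  classical
  induction S using Finset.induction_on with
  | empty => simp [formProd]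
  | insert i S hi ih => rw [Finset.sum_insert hi, Finset.prod_insert hi, formProd_add_left, ih]

end FormProd

/-- The power sum `∑_c φ(x_a - x_c)` of a product `φ` of linear forms. -/
def powerSum {n : ℕ} (t : Multiset ((Fin 3 → ℝ) →ₗ[ℝ] ℝ)) (a : Fin n) (X : PointCloud n) : ℝ :=
  ∑ c, formProd t (X a - X c)

theorem powerSum_zero {n : ℕ} (a : Fin n) (X : PointCloud n) : powerSum 0 a X = n := by
  simp [powerSum, formProd_zero_left]

/-- The span of the products of `J` power sums of total degree at most `d`. -/
def prodSpan (n J d : ℕ) : Submodule ℝ (Fin n → PointCloud n → ℝ) :=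
  Submodule.span ℝ {h | ∃ T : Fin J → Multiset ((Fin 3 → ℝ) →ₗ[ℝ] ℝ),
    ∑ i, Multiset.card (T i) ≤ d ∧ h = fun a X => ∏ i, powerSum (T i) a X}

theorem prodSpan_mono {n J d d' : ℕ} (h : d ≤ d') : prodSpan n J d ≤ prodSpan n J d' :=
  Submodule.span_mono fun _ ⟨T, hT, e⟩ => ⟨T, hT.trans h, e⟩

theorem prodSpan_le_chainSpan (U : ClebschGordan) (D n J : ℕ) :
    prodSpan n J D ≤ chainSpan U D n J := by
  refine Submodule.span_le.2 ?_
  rintro _ ⟨T, hT, rfl⟩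
  have key := sum_formProd_mem_chainSpan U (D := D) (n := n) (J := J)
    (∑ i, (T i).map fun φ => φ ∘ₗ LinearMap.proj i) (by simpa [map_sum] using hT)
  rw [SetLike.mem_coe]
  convert key using 1
  funext a X
  simp only [powerSum, Finset.prod_univ_sum, Fintype.piFinset_univ, formProd_sum_left]
  simp only [formProd, Multiset.map_map]
  rfl

/-- The power sum of the empty product is the constant `n`, so an unused slot can be filled with `t`
at the price of a factor `n`. The degree bound guarantees an unused slot. -/
theorem mul_powerSum_mem_prodSpan {n J d : ℕ} {h : Fin n → PointCloud n → ℝ}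
    (hh : h ∈ prodSpan n J d) {t : Multiset ((Fin 3 → ℝ) →ₗ[ℝ] ℝ)} (ht : t ≠ 0)
    (hJ : d + Multiset.card t ≤ J) :
    (fun a X => h a X * powerSum t a X) ∈ prodSpan n J (d + Multiset.card t) := by
  have ht' : 0 < Multiset.card t := Multiset.card_pos.2 ht
  induction hh using Submodule.span_induction with
  | mem h hh =>
    obtain ⟨T, hT, rfl⟩ := hh
    obtain ⟨i, hi⟩ : ∃ i, T i = 0 := by
      by_contra! hne
      have := Finset.card_nsmul_le_sum Finset.univ (fun i => Multiset.card (T i)) 1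
        fun i _ => Multiset.card_pos.2 (hne i)
      simp at this
      omega
    have hmem : (fun (a : Fin n) (X : PointCloud n) => ∏ j, powerSum (Function.update T i t j) a X) ∈
        prodSpan n J (d + Multiset.card t) := by
      refine Submodule.subset_span ⟨_, ?_, rfl⟩
      rw [← Finset.add_sum_erase _ _ (Finset.mem_univ i), Function.update_self, add_comm]
      refine Nat.add_le_add_right (le_trans ?_ hT) _
      rw [← Finset.add_sum_erase _ _ (Finset.mem_univ i)]
      refine le_trans (le_of_eq (Finset.sum_congr rfl fun j hj => ?_)) (Nat.le_add_left _ _)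
      rw [Function.update_of_ne (Finset.ne_of_mem_erase hj)]
    convert Submodule.smul_mem _ (n : ℝ) hmem using 1
    funext a X
    simp only [Pi.smul_apply, smul_eq_mul]
    rw [← Finset.mul_prod_erase _ _ (Finset.mem_univ i),
      ← Finset.mul_prod_erase _ (fun j => powerSum (Function.update T i t j) a X)
        (Finset.mem_univ i), Function.update_self, hi, powerSum_zero,
      Finset.prod_congr rfl fun j hj => by
        rw [← Function.update_of_ne (Finset.ne_of_mem_erase hj) t T]]
    ring
  | zero =>
    convert Submodule.zero_mem _ using 1
    funext a X
    simp
  | add f g _ _ hf hg =>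
    convert Submodule.add_mem _ hf hg using 1
    funext a X
    simp [add_mul]
  | smul c f _ hf =>
    convert Submodule.smul_mem _ c hf using 1
    funext a X
    simp [mul_assoc]

theorem const_mem_prodSpan (n J d : ℕ) (c : ℝ) : (fun _ _ => c) ∈ prodSpan n J d := by
  -- For `n = 0` there is no point at which to evaluate; otherwise `J` empty power sums multiply to
  -- `n ^ J`, which is divided out.
  rcases Nat.eq_zero_or_pos n with rfl | hn
  · convert Submodule.zero_mem _ using 1
  · have hmem : (fun (a : Fin n) (X : PointCloud n) => ∏ _i : Fin J, powerSum 0 a X) ∈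
        prodSpan n J d := Submodule.subset_span ⟨fun _ => 0, by simp, rfl⟩
    convert Submodule.smul_mem _ (c / n ^ J) hmem using 1
    funext a X
    have : (n : ℝ) ^ J ≠ 0 := by positivity
    simp [powerSum_zero, this]

/-- The sum over all permutations `σ` with `σ a' = a` of `∏_{b ∈ S} φ_b(x_a - x_{σ b})`. -/
def symmSum {n : ℕ} (S : Finset (Fin n)) (t : Fin n → Multiset ((Fin 3 → ℝ) →ₗ[ℝ] ℝ)) (a' a : Fin n)
    (X : PointCloud n) : ℝ :=
  ∑ σ : Equiv.Perm (Fin n),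
    if σ a' = a then ∏ b ∈ S, formProd (t b) (X a - X (σ b)) else 0

/-- Index the power sum by `σ c`. For `c` outside `S ∪ {a'}`, exchanging `c` and `b₀` gives the
symmetrized product over `S ∪ {b₀}`; for `c ∈ S` two factors at the same point merge; for `c = a'` a
nonempty product of linear forms is evaluated at `0`. -/
theorem symmSum_mul_powerSum {n : ℕ} {S : Finset (Fin n)}
    {t : Fin n → Multiset ((Fin 3 → ℝ) →ₗ[ℝ] ℝ)} {a' b₀ : Fin n} (ha' : a' ∉ insert b₀ S)
    (hb₀ : b₀ ∉ S) (ht : t b₀ ≠ 0) (a : Fin n) (X : PointCloud n) :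
    symmSum S t a' a X * powerSum (t b₀) a X =
      (insert a' S)ᶜ.card * symmSum (insert b₀ S) t a' a X +
        ∑ b ∈ S, symmSum S (Function.update t b (t b + t b₀)) a' a X := by
  have h1 : symmSum S t a' a X * powerSum (t b₀) a X = ∑ c, ∑ σ : Equiv.Perm (Fin n),
      if σ a' = a then (∏ b ∈ S, formProd (t b) (X a - X (σ b))) *
        formProd (t b₀) (X a - X (σ c)) else 0 := by
    rw [Finset.sum_comm, symmSum, Finset.sum_mul]
    refine Finset.sum_congr rfl fun σ _ => ?_
    split_ifs with h
    · rw [← Finset.mul_sum, powerSum]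
      congr 1
      exact (Equiv.sum_comp σ fun c => formProd (t b₀) (X a - X c)).symm
    · simp
  have ha'S : a' ∉ S := fun h => ha' (Finset.mem_insert_of_mem h)
  rw [h1, ← Finset.sum_compl_add_sum (insert a' S), Finset.sum_insert ha'S]
  congr 1
  · rw [← nsmul_eq_mul]
    refine Finset.sum_eq_card_nsmul fun c hc => ?_
    rw [Finset.mem_compl, Finset.mem_insert, not_or] at hc
    refine Fintype.sum_equiv (Equiv.mulRight (Equiv.swap c b₀)) _ _ fun σ => ?_
    have e1 : Equiv.swap c b₀ a' = a' :=
      Equiv.swap_apply_of_ne_of_ne (Ne.symm hc.1) fun h => ha' (h ▸ Finset.mem_insert_self _ _)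
    simp only [Equiv.coe_mulRight, Equiv.Perm.mul_apply, e1]
    split_ifs with h
    · rw [Finset.prod_insert hb₀, Equiv.swap_apply_right, mul_comm]
      congr 1
      refine Finset.prod_congr rfl fun b hb => ?_
      rw [Equiv.swap_apply_of_ne_of_ne (ne_of_mem_of_not_mem hb hc.2)
        (ne_of_mem_of_not_mem hb hb₀)]
    · rfl
  · rw [add_eq_right.2]
    · refine Finset.sum_congr rfl fun c hc => Finset.sum_congr rfl fun σ _ => ?_
      split_ifs with h
      · rw [← Finset.mul_prod_erase _ _ hc,
          ← Finset.mul_prod_erase _ (fun b => formProd (Function.update t c (t c + t b₀) b) _) hc,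
          Function.update_self, formProd_add_left,
          Finset.prod_congr rfl fun j hj => by
            rw [← Function.update_of_ne (Finset.ne_of_mem_erase hj) (t c + t b₀) t]]
        ring
      · rfl
    · refine Finset.sum_eq_zero fun σ _ => ?_
      split_ifs with h
      · rw [h, sub_self, formProd_zero_right ht, mul_zero]
      · rfl

/-- The preceding identity is solved for the product over the larger set; the merged terms have the
same total degree and live on the smaller set. -/
theorem symmSum_mem_prodSpan {n J d : ℕ} (hJ : d ≤ J) (S : Finset (Fin n))
    (t : Fin n → Multiset ((Fin 3 → ℝ) →ₗ[ℝ] ℝ)) (a' : Fin n) (ha' : a' ∉ S)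
    (ht : ∀ b ∈ S, t b ≠ 0) (hd : ∑ b ∈ S, Multiset.card (t b) ≤ d) :
    symmSum S t a' ∈ prodSpan n J d := by
  induction S using Finset.induction_on generalizing t d with
  | empty =>
    convert const_mem_prodSpan n J d (symmSum ∅ t a' a' 0) using 1
    funext a X
    simp only [symmSum, Finset.prod_empty]
    refine Fintype.sum_equiv (Equiv.mulLeft (Equiv.swap a a')) _ _ fun σ => ?_
    congr 1
    rw [Equiv.coe_mulLeft, Equiv.Perm.mul_apply, eq_iff_iff, Equiv.swap_apply_eq_iff,
      Equiv.swap_apply_right]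
  | insert b₀ S hb₀ ih =>
    rw [Finset.sum_insert hb₀] at hd
    have ha'S : a' ∉ S := fun h => ha' (Finset.mem_insert_of_mem h)
    have htS : ∀ b ∈ S, t b ≠ 0 := fun b hb => ht b (Finset.mem_insert_of_mem hb)
    have h1 := mul_powerSum_mem_prodSpan (ih (d := ∑ b ∈ S, Multiset.card (t b)) (by omega) t ha'S
      htS le_rfl) (ht b₀ (Finset.mem_insert_self _ _)) (by omega)
    have h2 : ∑ b ∈ S, symmSum S (Function.update t b (t b + t b₀)) a' ∈ prodSpan n J d := by
      refine Submodule.sum_mem _ fun b hb => ih hJ _ ha'S (fun c hc => ?_) ?_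
      · by_cases h : c = b
        · subst h
          rw [Function.update_self]
          exact fun h => htS c hc (add_eq_zero.1 h).1
        · rw [Function.update_of_ne h]
          exact htS c hc
      · refine le_trans (le_of_eq ?_) hd
        rw [← Finset.add_sum_erase _ _ hb, Function.update_self, ← Finset.add_sum_erase S _ hb,
          Multiset.card_add, Finset.sum_congr rfl fun j hj => by
            rw [Function.update_of_ne (Finset.ne_of_mem_erase hj)]]
        omega
    have h3 := Submodule.sub_mem _ (prodSpan_mono (by omega) h1 : _ ∈ prodSpan n J d) h2
    -- The coefficient to be divided out counts the points outside `S ∪ {a'}`, among them `b₀`.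
    have hcard : 0 < (insert a' S)ᶜ.card := Finset.card_pos.2 ⟨b₀, by
      rw [Finset.mem_compl, Finset.mem_insert, not_or]
      exact ⟨fun h => ha' (h ▸ Finset.mem_insert_self _ _), hb₀⟩⟩
    convert Submodule.smul_mem _ (((insert a' S)ᶜ.card : ℝ)⁻¹) h3 using 1
    funext a X
    simp only [Pi.smul_apply, Pi.sub_apply, smul_eq_mul, Finset.sum_apply,
      symmSum_mul_powerSum ha' hb₀ (ht b₀ (Finset.mem_insert_self _ _))]
    rw [add_sub_cancel_right, ← mul_assoc, inv_mul_cancel₀ (by positivity), one_mul]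

theorem symmetrized_monomial_mem_prodSpan {n J d : ℕ} (hJ : d ≤ J) (m : Fin n × Fin 3 →₀ ℕ)
    (hm : (m.sum fun _ e => e) ≤ d) (a' : Fin n) :
    (fun (a : Fin n) (X : PointCloud n) => ∑ σ : Equiv.Perm (Fin n),
      if σ a' = a then ∏ s, (X (σ s.1) s.2 - X a s.2) ^ m s else 0) ∈ prodSpan n J d := by
  -- The sign passes from `x_b - x_a` in the polynomial to `x_a - x_b` in the filters.
  let t : Fin n → Multiset ((Fin 3 → ℝ) →ₗ[ℝ] ℝ) := fun b =>
    ∑ i, Multiset.replicate (m (b, i)) (-LinearMap.proj i)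
  have hform : ∀ b v, formProd (t b) v = ∏ i, (-(v i)) ^ m (b, i) := by
    intro b v
    simp only [t, formProd_sum_left]
    simp [formProd]
  have hcard : ∑ b, Multiset.card (t b) = m.sum fun _ e => e := by
    rw [Finsupp.sum_fintype _ _ fun _ => rfl, Fintype.sum_prod_type]
    simp [t]
  have heq : ∀ (a : Fin n) (X : PointCloud n), (∑ σ : Equiv.Perm (Fin n),
      if σ a' = a then ∏ s, (X (σ s.1) s.2 - X a s.2) ^ m s else 0) =
      ∑ σ : Equiv.Perm (Fin n), if σ a' = a then ∏ b, formProd (t b) (X a - X (σ b)) else 0 := by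
    intro a X
    refine Finset.sum_congr rfl fun σ _ => ?_
    simp only [hform, Fintype.prod_prod_type, Pi.sub_apply, neg_sub]
  simp only [heq]
  classical
  -- If a coordinate of the point `a'` occurs in the monomial, the factor `x_{σ a'} - x_a = 0`
  -- annihilates every term.
  by_cases hta : t a' = 0
  · have hmem := symmSum_mem_prodSpan hJ (Finset.univ.filter fun b => t b ≠ 0) t a' (by simp [hta])
      (by simp) ((Finset.sum_le_univ_sum_of_nonneg fun _ => Nat.zero_le _).trans
        (hcard.le.trans hm))
    convert hmem using 1
    funext a X
    refine Finset.sum_congr rfl fun σ _ => ?_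
    congr 1
    refine (Finset.prod_subset (Finset.filter_subset _ _) fun b _ hb => ?_).symm
    rw [not_not.1 fun h => hb (Finset.mem_filter.2 ⟨Finset.mem_univ b, h⟩), formProd_zero_left]
  · convert Submodule.zero_mem _ using 1
    funext a X
    refine Finset.sum_eq_zero fun σ _ => ?_
    split_ifs with h
    · refine Finset.prod_eq_zero (Finset.mem_univ a') ?_
      rw [h, sub_self, formProd_zero_right hta]
    · rfl

/-- Sorting the permutations by `a' = σ⁻¹ a` fixes the polynomial used, and leaves symmetrized
monomials with `σ a' = a`. -/
theorem symmetrized_polynomial_mem_prodSpan {n J d : ℕ} (hJ : d ≤ J)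
    (q : Fin n → MvPolynomial (Fin n × Fin 3) ℝ) (hq : ∀ a, (q a).totalDegree ≤ d) :
    (fun (a : Fin n) (X : PointCloud n) => ∑ σ : Equiv.Perm (Fin n),
      MvPolynomial.eval (fun s => X (σ s.1) s.2 - X a s.2) (q (σ⁻¹ a))) ∈ prodSpan n J d := by
  have hmem : ∑ a', ∑ m ∈ (q a').support, (q a').coeff m •
      (fun (a : Fin n) (X : PointCloud n) => ∑ σ : Equiv.Perm (Fin n),
        if σ a' = a then ∏ s, (X (σ s.1) s.2 - X a s.2) ^ m s else 0) ∈ prodSpan n J d :=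
    Submodule.sum_mem _ fun a' _ => Submodule.sum_mem _ fun m hm => Submodule.smul_mem _ _
      (symmetrized_monomial_mem_prodSpan hJ m ((MvPolynomial.le_totalDegree hm).trans (hq a')) a')
  convert hmem using 1
  funext a X
  simp only [Finset.sum_apply, Pi.smul_apply, smul_eq_mul, Finset.mul_sum]
  have : ∀ a', ∑ m ∈ (q a').support, ∑ σ : Equiv.Perm (Fin n), (q a').coeff m *
      (if σ a' = a then ∏ s, (X (σ s.1) s.2 - X a s.2) ^ m s else 0) =
      ∑ σ : Equiv.Perm (Fin n), if σ a' = a then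
        MvPolynomial.eval (fun s => X (σ s.1) s.2 - X a s.2) (q a') else 0 := by
    intro a'
    rw [Finset.sum_comm]
    refine Finset.sum_congr rfl fun σ _ => ?_
    split_ifs with h
    · rw [MvPolynomial.eval_eq']
    · simp
  simp only [this]
  rw [Finset.sum_comm]
  refine Finset.sum_congr rfl fun σ _ => ?_
  simp only [← Equiv.eq_symm_apply, Finset.sum_ite_eq', Finset.mem_univ, if_true]
  rfl

theorem symmetrized_polynomial_mem_chainSpan (U : ClebschGordan) {D n : ℕ}
    (q : Fin n → MvPolynomial (Fin n × Fin 3) ℝ) (hq : ∀ a, (q a).totalDegree ≤ D) :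
    (fun (a : Fin n) (X : PointCloud n) => ∑ σ : Equiv.Perm (Fin n),
      MvPolynomial.eval (fun s => X (σ s.1) s.2 - X a s.2) (q (σ⁻¹ a))) ∈
        chainSpan U D n (2 * D) :=
  prodSpan_le_chainSpan U D n (2 * D) (symmetrized_polynomial_mem_prodSpan (by omega) q hq)

/-! ### Equivariance of the features -/

/-- The representation of `SO(3)` on `W_l`. -/
def rotateRep {ι : Type} (l : ι → ℕ) : Representation ℝ SO3 (W l) where
  toFun R := LinearMap.pi fun i => irrepRep (l i) R ∘ₗ LinearMap.proj i
  map_one' := LinearMap.ext fun w => funext fun i => wignerD_mulVec_one (l i) (w i)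
  map_mul' R S := LinearMap.ext fun w => funext fun i => wignerD_mulVec_mul (l i) R S (w i)

theorem rotateRep_apply {ι : Type} (l : ι → ℕ) (R : SO3) (w : W l) :
    rotateRep l R w = rotate l R w := rfl

theorem continuous_rotateRep_apply {Z : Type*} [TopologicalSpace Z] {κ : Type} (l : κ → ℕ)
    {R : Z → SO3} {w : Z → W l} (hR : Continuous R) (hw : Continuous w) :
    Continuous fun z => rotateRep l (R z) (w z) :=
  continuous_pi fun i => continuous_irrepRep_apply hR ((continuous_apply i).comp hw)

theorem euclNorm_mulVec (R : SO3) (x : Fin 3 → ℝ) : euclNorm (R.1.mulVec x) = euclNorm x := by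
  have hdot : ∀ y : Fin 3 → ℝ, euclNorm y ^ 2 = y ⬝ᵥ y := fun y => by
    rw [euclNorm_sq, dotProduct, Fin.sum_univ_three]
    ring
  refine (pow_left_inj₀ (norm_nonneg _) (norm_nonneg _) two_ne_zero).1 ?_
  change euclNorm _ ^ 2 = euclNorm _ ^ 2
  rw [hdot, hdot, Matrix.dotProduct_mulVec, Matrix.vecMul_mulVec, SO3.transpose_mul,
    Matrix.vecMul_one]

theorem unitVec_mulVec (R : SO3) (x : Fin 3 → ℝ) :
    unitVec (R.1.mulVec x) = R.1.mulVec (unitVec x) := by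
  rw [unitVec, unitVec, euclNorm_mulVec, Matrix.mulVec_smul]

theorem convFilter_mulVec {D : ℕ} (P : ConvParams D) (R : SO3) (x : Fin 3 → ℝ) :
    convFilter P (R.1.mulVec x) = rotate (filterDegrees D).deg R (convFilter P x) := by
  funext ℓ
  change (P.radial ℓ).eval (euclNorm (R.1.mulVec x)) • sphericalHarmonic _ (unitVec (R.1.mulVec x)) =
    (wignerD _ R).mulVec ((P.radial ℓ).eval (euclNorm x) • sphericalHarmonic _ (unitVec x))
  rw [euclNorm_mulVec, unitVec_mulVec, sphericalHarmonic_mulVec, Matrix.mulVec_smul]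

theorem ClebschGordan.map_rotate_tmul_rotate (U : ClebschGordan) (l₁ l₂ : Degrees) (R : SO3)
    (v : W l₁.deg) (w : W l₂.deg) :
    U.map l₁ l₂ (rotate l₁.deg R v ⊗ₜ[ℝ] rotate l₂.deg R w) =
      rotate (tensorDegrees l₁ l₂).deg R (U.map l₁ l₂ (v ⊗ₜ[ℝ] w)) :=
  funext fun q => U.equivariant _ _ R (v q.1.1) (w q.1.2) q.2

theorem wignerD_zero_mulVec (R : SO3) (w : Irrep 0) : (wignerD 0 R).mulVec w = w := by
  have hw : w ∈ Submodule.span ℝ (Set.range (sphericalHarmonic 0)) := by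
    rw [span_sphericalHarmonic]; trivial
  induction hw using Submodule.span_induction with
  | mem w hw =>
    obtain ⟨x, rfl⟩ := hw
    have h : ∀ y, sphericalHarmonic 0 y = sphericalHarmonic 0 0 := fun y => by
      simpa using (sphericalHarmonic_smul 0 0 y).symm
    rw [← sphericalHarmonic_mulVec, h, h x]
  | zero => rw [Matrix.mulVec_zero]
  | add v w _ _ hv hw => rw [Matrix.mulVec_add, hv, hw]
  | smul c w _ hw => rw [Matrix.mulVec_smul, hw]

theorem chainFeature_mulVec (U : ClebschGordan) {D n : ℕ} (r : ℕ → Fin (D + 1)) (J : ℕ) (R : SO3)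
    (X : PointCloud n) (a : Fin n) :
    chainFeature U r J (fun b => R.1.mulVec (X b)) a =
      rotateRep (featDegrees D J).deg R (chainFeature U r J X a) := by
  induction J generalizing a with
  | zero => exact funext fun _ => (wignerD_zero_mulVec R _).symm
  | succ J ih =>
    rw [chainFeature_succ, chainFeature_succ, map_sum, map_sum]
    refine Eq.trans ?_ (map_sum (rotateRep (tensorDegrees (filterDegrees D) (featDegrees D J)).deg R)
      _ _).symm
    refine Finset.sum_congr rfl fun b _ => ?_
    rw [ih, ← Matrix.mulVec_sub, convFilter_mulVec, rotateRep_apply,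
      U.map_rotate_tmul_rotate]
    rfl

/-! ### Networks -/

/-- Superfluous branches get the zero readout, so any larger number of branches is also admissible.
-/
theorem sum_mem_network (U : ClebschGordan) {C D n K : ℕ} (lT : Fin K → ℕ) {ι : Type*} [Fintype ι]
    (hC : Fintype.card ι ≤ C) (Λ : ι → (W (featDegrees D (2 * D)).deg →ₗ[ℝ] W lT))
    (hΛ : ∀ i, Λ i ∈ pool D lT) (P : ι → ℕ → ConvParams D) :
    (fun (X : PointCloud n) (a : Fin n) => ∑ i, Λ i ((forward U (P i) (2 * D) X).2 a)) ∈
      network U C D n lT := by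
  obtain ⟨e⟩ : Nonempty (ι ↪ Fin C) :=
    Function.Embedding.nonempty_of_card_le (by rwa [Fintype.card_fin])
  refine ⟨Function.extend e Λ 0, fun c X => (forward U
    (Function.extend e P (fun _ _ => radialParams 0) c) (2 * D) X).2, fun c => ?_,
    fun c => ⟨_, fun X => rfl⟩, fun X a => ?_⟩
  · by_cases h : ∃ i, e i = c
    · obtain ⟨i, rfl⟩ := h
      rw [e.injective.extend_apply]
      exact hΛ i
    · rw [Function.extend_apply' _ _ _ h]
      exact fun R w => (map_zero (rotateRep lT R)).symm
  · refine Fintype.sum_of_injective e e.injective _ _ (fun c hc => ?_) fun i => ?_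
    · rw [Function.extend_apply' _ _ _ hc]
      rfl
    · simp only [e.injective.extend_apply]

/-- The extension by zero of a finite sequence of degrees. -/
def tupleSeq {D J : ℕ} (r : Fin J → Fin (D + 1)) (j : ℕ) : Fin (D + 1) :=
  if h : j < J then r ⟨j, h⟩ else 0

/-- Terms with the same sequence of filter degrees share their features, so their functionals add up
to one. The resulting count `(D + 1) ^ J` depends neither on `n` nor on the target. -/
theorem exists_functionals_of_mem_chainSpan {U : ClebschGordan} {D n J : ℕ}
    {h : Fin n → PointCloud n → ℝ} (hh : h ∈ chainSpan U D n J) :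
    ∃ κ : (Fin J → Fin (D + 1)) → (W (featDegrees D J).deg →ₗ[ℝ] ℝ), ∀ a X,
      h a X = ∑ r, κ r (chainFeature U (tupleSeq r) J X a) := by
  induction hh using Submodule.span_induction with
  | mem h hh =>
    obtain ⟨r, κ, rfl⟩ := hh
    refine ⟨Pi.single (fun j => r j) κ, fun a X => ?_⟩
    rw [Finset.sum_eq_single (fun j : Fin J => r j) (fun r' _ hr' => ?_) (by simp),
      Pi.single_eq_same]
    · refine congrArg κ (chainFeature_congr U (fun j hj => ?_) X a)
      rw [tupleSeq, dif_pos hj]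
    · rw [Pi.single_eq_of_ne hr', LinearMap.zero_apply]
  | zero => exact ⟨0, by simp⟩
  | add f g _ _ hf hg =>
    obtain ⟨κ, hκ⟩ := hf
    obtain ⟨κ', hκ'⟩ := hg
    exact ⟨κ + κ', fun a X => by simp [hκ, hκ', Finset.sum_add_distrib]⟩
  | smul c f _ hf =>
    obtain ⟨κ, hκ⟩ := hf
    exact ⟨c • κ, fun a X => by simp [hκ, Finset.mul_sum]⟩

/-- The translation invariant and permutation equivariant function obtained by symmetrizing a
polynomial map. -/
def symmetrize {n K : ℕ} {lT : Fin K → ℕ}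
    (q : Fin n → (i : Fin K) → Fin (2 * lT i + 1) → MvPolynomial (Fin n × Fin 3) ℝ)
    (X : PointCloud n) (a : Fin n) : W lT :=
  fun i m => ∑ σ : Equiv.Perm (Fin n),
    MvPolynomial.eval (fun s => X (σ s.1) s.2 - X a s.2) (q (σ⁻¹ a) i m)

theorem continuous_symmetrize {n K : ℕ} {lT : Fin K → ℕ}
    (q : Fin n → (i : Fin K) → Fin (2 * lT i + 1) → MvPolynomial (Fin n × Fin 3) ℝ) (a : Fin n) :
    Continuous fun X => symmetrize q X a :=
  continuous_pi fun i => continuous_pi fun m => continuous_finsetSum _ fun σ _ =>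
    (MvPolynomial.continuous_eval _).comp (by fun_prop)

/-- Rotating the features back is the same as rotating the point cloud back. Averaging the readouts
therefore averages the function they compute. -/
theorem exists_network_eq_average (U : ClebschGordan) {C D n K : ℕ} {lT : Fin K → ℕ}
    (hC : (D + 1) ^ (2 * D) ≤ C)
    (q : Fin n → (i : Fin K) → Fin (2 * lT i + 1) → MvPolynomial (Fin n × Fin 3) ℝ)
    (hq : ∀ a i m, (q a i m).totalDegree ≤ D) :
    ∃ g ∈ network U C D n lT, ∀ X a,
      g X a = ∫ R : SO3, rotate lT R (symmetrize q (fun b => R⁻¹.1.mulVec (X b)) a) ∂haarSO3 := by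
  choose κ hκ using fun i m => exists_functionals_of_mem_chainSpan
    (symmetrized_polynomial_mem_chainSpan U (fun a => q a i m) fun a => hq a i m)
  let Λ : (Fin (2 * D) → Fin (D + 1)) → (W (featDegrees D (2 * D)).deg →ₗ[ℝ] W lT) := fun r =>
    LinearMap.pi fun i => LinearMap.pi fun m => κ i m r
  have hΛ : ∀ X a, symmetrize q X a = ∑ r, Λ r (chainFeature U (tupleSeq r) (2 * D) X a) := by
    intro X a
    funext i m
    rw [Finset.sum_apply, Finset.sum_apply]
    exact hκ i m a X
  have hcont : ∀ r v, Continuous fun R : SO3 =>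
      (rotateRep lT R ∘ₗ Λ r ∘ₗ rotateRep (featDegrees D (2 * D)).deg R⁻¹) v := fun r v =>
    continuous_rotateRep_apply lT continuous_id
      ((Λ r).continuous_of_finiteDimensional.comp
        (continuous_rotateRep_apply _ continuous_inv continuous_const))
  refine ⟨_, sum_mem_network U lT (ι := Fin (2 * D) → Fin (D + 1)) (by simpa using hC)
    (fun r => averageLinear _ (hcont r)) (fun r R w => ?_)
    (fun r j => radialParams (tupleSeq r j)), fun X a => ?_⟩
  · exact averageLinear_conj_equivariant _ (rotateRep lT) (Λ r) (hcont r) R w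
  · change ∑ r, averageLinear _ (hcont r) (chainFeature U (tupleSeq r) (2 * D) X a) = _
    simp only [averageLinear_apply]
    rw [← integral_finsetSum _ fun r _ => integrable_of_continuous_SO3 (hcont r _)]
    refine integral_congr_ae (Filter.Eventually.of_forall fun R => ?_)
    simp only [hΛ, chainFeature_mulVec, ← rotateRep_apply, map_sum, LinearMap.comp_apply]

/-! ### Equivariant functions -/

theorem IsEquivariant.apply_perm_sub {n K : ℕ} {lT : Fin K → ℕ} {f : PointCloud n → Fin n → W lT}
    (hf : IsEquivariant lT f) (t : Fin 3 → ℝ) (σ : Equiv.Perm (Fin n)) (X : PointCloud n)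
    (a : Fin n) : f (fun b => X (σ b) - t) (σ⁻¹ a) = f X a := by
  have h := congrFun (hf t 1 σ⁻¹ X) (σ⁻¹ a)
  have h1 : actIn t 1 σ⁻¹ X = fun b => X (σ b) - t := by
    funext b
    simp [actIn]
  have h2 : actOut lT 1 σ⁻¹ (f X) (σ⁻¹ a) = f X a := by
    rw [actOut, ← rotateRep_apply, map_one]
    simp
  rw [← h1, h, h2]

theorem IsEquivariant.rotate_apply {n K : ℕ} {lT : Fin K → ℕ} {f : PointCloud n → Fin n → W lT}
    (hf : IsEquivariant lT f) (R : SO3) (X : PointCloud n) (a : Fin n) :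
    rotate lT R (f (fun b => R⁻¹.1.mulVec (X b)) a) = f X a := by
  have h := congrFun (hf 0 R⁻¹ 1 X) a
  have h1 : actIn 0 R⁻¹ 1 X = fun b => R⁻¹.1.mulVec (X b) := by
    funext b
    simp [actIn]
  have h2 : actOut lT R⁻¹ 1 (f X) a = rotateRep lT R⁻¹ (f X a) := rfl
  rw [← h1, h, h2, ← rotateRep_apply, ← Module.End.mul_apply, ← map_mul, mul_inv_cancel, map_one,
    Module.End.one_apply]

/-- By equivariance `f X a` equals each of the `n!` values of `f` at the permuted clouds centred at
`x_a`, so the errors are averaged. With `δ = 0` this reproduces polynomials exactly; with `δ > 0` it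
serves the approximation. -/
theorem IsEquivariant.norm_sub_symmetrize_le {n K : ℕ} {lT : Fin K → ℕ}
    {f : PointCloud n → Fin n → W lT} (hf : IsEquivariant lT f)
    (q : Fin n → (i : Fin K) → Fin (2 * lT i + 1) → MvPolynomial (Fin n × Fin 3) ℝ) {δ : ℝ}
    (hδ : 0 ≤ δ) (X : PointCloud n) (a : Fin n)
    (hq : ∀ (σ : Equiv.Perm (Fin n)) i m, |f (fun b => X (σ b) - X a) (σ⁻¹ a) i m -
      MvPolynomial.eval (fun s => X (σ s.1) s.2 - X a s.2) (q (σ⁻¹ a) i m)| ≤ δ) :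
    ‖f X a - symmetrize (fun a i m => (n.factorial : ℝ)⁻¹ • q a i m) X a‖ ≤ δ := by
  have hsum : ∀ c : ℝ, ∑ _σ : Equiv.Perm (Fin n), (n.factorial : ℝ)⁻¹ * c = c := fun c => by
    rw [Finset.sum_const, Finset.card_univ, Fintype.card_perm, Fintype.card_fin, nsmul_eq_mul,
      ← mul_assoc, mul_inv_cancel₀ (by positivity), one_mul]
  refine (pi_norm_le_iff_of_nonneg hδ).2 fun i => (pi_norm_le_iff_of_nonneg hδ).2 fun m => ?_
  rw [Pi.sub_apply, Pi.sub_apply, ← hsum (f X a i m), symmetrize, ← Finset.sum_sub_distrib,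
    Real.norm_eq_abs]
  refine (Finset.abs_sum_le_sum_abs _ _).trans ((Finset.sum_le_sum fun σ _ => ?_).trans (hsum δ).le)
  rw [MvPolynomial.smul_eval, ← mul_sub, abs_mul, abs_of_pos (by positivity),
    ← hf.apply_perm_sub (X a) σ X a]
  exact mul_le_mul_of_nonneg_left (hq σ i m) (by positivity)

theorem mem_network_of_isPolynomial (U : ClebschGordan) {C D n K : ℕ} {lT : Fin K → ℕ}
    (hC : (D + 1) ^ (2 * D) ≤ C) {p : PointCloud n → Fin n → W lT} (hp : IsEquivariant lT p)
    (hpD : IsPolynomialOfDegreeLE D lT p) : p ∈ network U C D n lT := by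
  choose q hq hqp using hpD
  obtain ⟨g, hg, hgp⟩ := exists_network_eq_average U hC
    (fun a i m => ((n.factorial : ℝ)⁻¹) • q a i m)
    fun a i m => (MvPolynomial.totalDegree_smul_le _ _).trans (hq a i m)
  have hsymm : ∀ X a, symmetrize (fun a i m => ((n.factorial : ℝ)⁻¹) • q a i m) X a = p X a :=
    fun X a => (sub_eq_zero.1 (norm_le_zero_iff.1 (hp.norm_sub_symmetrize_le q le_rfl X a
      fun σ i m => by rw [hqp]; simp))).symm
  convert hg using 1
  funext X a
  simp only [hgp, hsymm, hp.rotate_apply, integral_const, probReal_univ, one_smul]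

/-! ### Approximation of continuous equivariant functions -/

theorem exists_mvPolynomial_near {σ : Type*} [Finite σ] {E : Type*} [TopologicalSpace E]
    (x : σ → E → ℝ) (hx : ∀ s, Continuous (x s)) (hsep : ∀ y z, (∀ s, x s y = x s z) → y = z)
    {S : Set E} (hS : IsCompact S) {f : E → ℝ} (hf : Continuous f) {δ : ℝ} (hδ : 0 < δ) :
    ∃ q : MvPolynomial σ ℝ, ∀ y ∈ S, |f y - MvPolynomial.eval (fun s => x s y) q| < δ := by
  have : CompactSpace S := isCompact_iff_compactSpace.1 hS
  let X : σ → C(S, ℝ) := fun s => ⟨fun y => x s y, (hx s).comp continuous_subtype_val⟩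
  let A : Subalgebra ℝ C(S, ℝ) := (MvPolynomial.aeval (R := ℝ) X).range
  have hA : A.SeparatesPoints := by
    intro y z hyz
    obtain ⟨s, hs⟩ : ∃ s, x s y ≠ x s z := by
      by_contra! h
      exact hyz (Subtype.ext (hsep _ _ h))
    exact ⟨X s, ⟨X s, ⟨MvPolynomial.X s, MvPolynomial.aeval_X _ _⟩, rfl⟩, hs⟩
  obtain ⟨⟨g, q, rfl⟩, hg⟩ := ContinuousMap.exists_mem_subalgebra_near_continuous_of_separatesPoints
    A hA (fun y : S => f y) (hf.comp continuous_subtype_val) δ hδ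
  refine ⟨q, fun y hy => ?_⟩
  have h := hg ⟨y, hy⟩
  rw [Real.norm_eq_abs, abs_sub_comm] at h
  convert h using 3
  have : (ContinuousMap.evalAlgHom ℝ ℝ (⟨y, hy⟩ : S)).comp (MvPolynomial.aeval X) =
      MvPolynomial.aeval fun s => x s y := by
    ext s
    simp [X]
  exact (MvPolynomial.aeval_eq_eval (fun s => x s y) ▸ (DFunLike.congr_fun this q).symm)

/-- Compactness of `SO(3)` and of the unit ball; a uniform bound takes the place of orthogonality of
the Wigner matrices. -/
theorem exists_norm_rotate_le {K : ℕ} (lT : Fin K → ℕ) :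
    ∃ M : ℝ, 0 < M ∧ ∀ (R : SO3) (w : W lT), ‖rotate lT R w‖ ≤ M * ‖w‖ := by
  obtain ⟨M, hM⟩ := (isCompact_univ.prod (isCompact_closedBall (0 : W lT) 1)).exists_bound_of_continuousOn
    (continuous_rotateRep_apply lT (R := fun z : SO3 × W lT => z.1) continuous_fst
      continuous_snd).continuousOn
  refine ⟨max M 1, by positivity, fun R w => ?_⟩
  have hw : rotate lT R w = ‖w‖ • rotateRep lT R (‖w‖⁻¹ • w) := by
    rw [← map_smul, smul_smul]
    rcases eq_or_ne w 0 with rfl | h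
    · simp [← rotateRep_apply]
    · rw [mul_inv_cancel₀ (norm_ne_zero_iff.2 h), one_smul, rotateRep_apply]
  rw [hw, norm_smul, norm_norm, mul_comm]
  refine mul_le_mul_of_nonneg_right (le_trans (hM (R, ‖w‖⁻¹ • w) ⟨Set.mem_univ _, ?_⟩)
    (le_max_left _ _)) (norm_nonneg _)
  rw [mem_closedBall_zero_iff, norm_smul, norm_inv, norm_norm]
  exact inv_mul_le_one

theorem continuous_rotate_symmetrize {n K : ℕ} {lT : Fin K → ℕ}
    (q : Fin n → (i : Fin K) → Fin (2 * lT i + 1) → MvPolynomial (Fin n × Fin 3) ℝ)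
    (X : PointCloud n) (a : Fin n) :
    Continuous fun R : SO3 => rotate lT R (symmetrize q (fun b => R⁻¹.1.mulVec (X b)) a) := by
  have h1 : Continuous fun R : SO3 => R⁻¹.1 := continuous_subtype_val.comp continuous_inv
  have h2 : Continuous fun R : SO3 => (fun b => R⁻¹.1.mulVec (X b) : PointCloud n) :=
    continuous_pi fun b => h1.matrix_mulVec continuous_const
  have h3 := (continuous_symmetrize q a).comp h2
  simp only [← rotateRep_apply]
  exact continuous_rotateRep_apply lT (R := fun R => R) continuous_id h3

theorem IsEquivariant.norm_sub_average_le {n K : ℕ} {lT : Fin K → ℕ}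
    {f : PointCloud n → Fin n → W lT} (hf : IsEquivariant lT f)
    (q : Fin n → (i : Fin K) → Fin (2 * lT i + 1) → MvPolynomial (Fin n × Fin 3) ℝ) {M δ : ℝ}
    (hM : ∀ (R : SO3) (w : W lT), ‖rotate lT R w‖ ≤ M * ‖w‖) (hM0 : 0 ≤ M) (X : PointCloud n)
    (a : Fin n) (hq : ∀ R : SO3, ‖f (fun b => R⁻¹.1.mulVec (X b)) a -
      symmetrize q (fun b => R⁻¹.1.mulVec (X b)) a‖ ≤ δ) :
    ‖f X a - ∫ R : SO3, rotate lT R (symmetrize q (fun b => R⁻¹.1.mulVec (X b)) a) ∂haarSO3‖ ≤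
      M * δ := by
  have hint := integral_sub (integrable_const (μ := haarSO3) (f X a))
    (integrable_of_continuous_SO3 (continuous_rotate_symmetrize q X a))
  rw [integral_const, probReal_univ, one_smul] at hint
  rw [← hint]
  have hle : ∀ R : SO3,
      ‖f X a - rotate lT R (symmetrize q (fun b => R⁻¹.1.mulVec (X b)) a)‖ ≤ M * δ := by
    intro R
    have hsub : ∀ v w : W lT, rotate lT R v - rotate lT R w = rotate lT R (v - w) := fun v w =>
      (map_sub (rotateRep lT R) v w).symm
    rw [← hf.rotate_apply R X a, hsub]
    exact (hM R _).trans (mul_le_mul_of_nonneg_left (hq R) hM0)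
  have hnorm := norm_integral_le_of_norm_le_const (μ := haarSO3) (Filter.Eventually.of_forall hle)
  rwa [probReal_univ, mul_one] at hnorm

theorem exists_network_near (U : ClebschGordan) {n K : ℕ} {lT : Fin K → ℕ}
    {f : PointCloud n → Fin n → W lT} (hf : Continuous f) (hfe : IsEquivariant lT f)
    {S : Set (PointCloud n)} (hS : IsCompact S) {ε : ℝ} (hε : 0 < ε) :
    ∃ D : ℕ, ∃ g ∈ network U ((D + 1) ^ (2 * D)) D n lT, ∀ X ∈ S, ‖f X - g X‖ < ε := by
  obtain ⟨M, hM, hrot⟩ := exists_norm_rotate_le lT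
  -- Averaging over rotations costs the factor `M`, leaving the final error `ε / 2 < ε`.
  let δ : ℝ := ε / (2 * M)
  have hδ : 0 < δ := by positivity
  let Φ : Equiv.Perm (Fin n) → Fin n → PointCloud n × SO3 → PointCloud n := fun σ a Z b =>
    Z.2⁻¹.1.mulVec (Z.1 (σ b)) - Z.2⁻¹.1.mulVec (Z.1 a)
  have hΦ : ∀ σ a, Continuous (Φ σ a) := by
    intro σ a
    have hinv : Continuous fun Z : PointCloud n × SO3 => Z.2⁻¹.1 :=
      continuous_subtype_val.comp (continuous_inv.comp continuous_snd)
    refine continuous_pi fun b => ?_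
    exact (hinv.matrix_mulVec ((continuous_apply (σ b)).comp continuous_fst)).sub
      (hinv.matrix_mulVec ((continuous_apply a).comp continuous_fst))
  -- All rotated, permuted and centred copies of clouds in `S`: exactly the arguments at which
  -- symmetrization and averaging evaluate the polynomials.
  let T : Set (PointCloud n) := ⋃ σ, ⋃ a, Φ σ a '' (S ×ˢ Set.univ)
  have hT : IsCompact T := isCompact_iUnion fun σ => isCompact_iUnion fun a =>
    (hS.prod isCompact_univ).image (hΦ σ a)
  have happrox : ∀ (a : Fin n) (i : Fin K) (m : Fin (2 * lT i + 1)),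
      ∃ q : MvPolynomial (Fin n × Fin 3) ℝ, ∀ Y ∈ T,
        |f Y a i m - MvPolynomial.eval (fun s => Y s.1 s.2) q| < δ := fun a i m =>
    exists_mvPolynomial_near (fun (s : Fin n × Fin 3) (Y : PointCloud n) => Y s.1 s.2)
      (fun s => by fun_prop) (fun Y Z h => funext fun b => funext fun j => h (b, j)) hT
      (by fun_prop) hδ
  choose q hq using happrox
  let D : ℕ := Finset.univ.sup fun a => Finset.univ.sup fun i => Finset.univ.sup fun m =>
    (q a i m).totalDegree
  have hD : ∀ a i m, (q a i m).totalDegree ≤ D := fun a i m =>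
    (Finset.le_sup (f := fun m => (q a i m).totalDegree) (Finset.mem_univ m)).trans
      ((Finset.le_sup (f := fun i => Finset.univ.sup fun m => (q a i m).totalDegree)
        (Finset.mem_univ i)).trans (Finset.le_sup (f := fun a => Finset.univ.sup fun i =>
          Finset.univ.sup fun m => (q a i m).totalDegree) (Finset.mem_univ a)))
  obtain ⟨g, hg, hgq⟩ := exists_network_eq_average U (le_refl ((D + 1) ^ (2 * D)))
    (fun a i m => ((n.factorial : ℝ)⁻¹) • q a i m)
    fun a i m => (MvPolynomial.totalDegree_smul_le _ _).trans (hD a i m)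
  refine ⟨D, g, hg, fun X hX => ?_⟩
  refine (pi_norm_lt_iff hε).2 fun a => ?_
  have hbound : ‖f X a - g X a‖ ≤ M * δ := by
    rw [hgq]
    refine hfe.norm_sub_average_le _ hrot hM.le X a fun R =>
      hfe.norm_sub_symmetrize_le q hδ.le _ a fun σ i m => (hq (σ⁻¹ a) i m (Φ σ a (X, R)) ?_).le
    exact Set.mem_iUnion.2 ⟨σ, Set.mem_iUnion.2 ⟨a, (X, R), ⟨hX, Set.mem_univ _⟩, rfl⟩⟩
  refine hbound.trans_lt ?_
  have : M * δ = ε / 2 := by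
    simp only [δ]
    field_simp
  linarith

end TFN

end

/-! ### Universality of the architecture. -/

theorem theorem2 :
    Nonempty TFN.ClebschGordan ∧
    ∃ C : ℕ → ℕ, ∀ (U : TFN.ClebschGordan) (n K : ℕ) (lT : Fin K → ℕ),
      (∀ (D C' : ℕ), C D ≤ C' → ∀ p : TFN.PointCloud n → Fin n → TFN.W lT,
        TFN.IsEquivariant lT p → TFN.IsPolynomialOfDegreeLE D lT p →
          p ∈ TFN.network U C' D n lT) ∧
      (∀ f : TFN.PointCloud n → Fin n → TFN.W lT,
        Continuous f → TFN.IsEquivariant lT f →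
          ∀ S : Set (TFN.PointCloud n), IsCompact S → ∀ ε : ℝ, 0 < ε →
            ∃ D : ℕ, ∃ g ∈ TFN.network U (C D) D n lT, ∀ X ∈ S, ‖f X - g X‖ < ε) :=
  ⟨TFN.nonempty_clebschGordan, fun D => (D + 1) ^ (2 * D), fun U _ _ _ =>
    ⟨fun _ _ hC _ hp hpD => TFN.mem_network_of_isPolynomial U hC hp hpD,
      fun _ hf hfe _ hS _ hε => TFN.exists_network_near U hf hfe hS hε⟩⟩
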